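/- Let $\theta>0$, $a>-1$, $b>-1$, $a+b>-1$, and put $\alpha=\frac{a+b+1}{\theta}-1$, $h_n=\frac{\theta}{2n\theta+a+b+1}$. **Kernels.** A $\theta$-deformed Cauchy biorthogonal system is a pair of sequences of real polynomials $(\hat P_n)_{n\ge0}$, $(\hat Q_n)_{n\ge0}$ with $\deg\hat P_n=\deg\hat Q_n=n$ and $$\iint_{\mathbb R_+^2}\frac{e^{-(x+y)}}{x+y}x^ay^b\,\hat P_n(x^\theta)\hat Q_m(y^\theta)\,dx\,dy=\frac{h_n}{\theta}\,\delta_{n,m}\qquad(n,m\ge 0).$$ Put $K_N(x,y)=\sum_{n=0}^{N-1}\frac{\theta}{h_n}\hat P_n(x^\theta)\hat Q_n(y^\theta)$. The correlation kernels of the $\theta$-deformed Cauchy two-matrix model with Laguerre weights are defined, for positive arguments, by $$K_{01}(x,x')=\int_{\mathbb R_+}\frac{K_N(x,y)}{x'+y}y^be^{-y}dy,\qquad K_{10}(y,y')=\int_{\mathbb R_+}\frac{K_N(x,y')}{x+y}x^ae^{-x}dx,$$ $$K_{11}(y,x)=\iint_{\mathbb R_+^2}\frac{K_N(x',y')}{(x'+y)(x+y')}x'^ay'^be^{-(x'+y')}dx'dy'-\frac1{x+y}.$$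 **Special functions.** For $c\in\mathbb R$ and $\delta>0$ let $\gamma=\gamma_{c,\delta}$ be the loop that comes from $-\infty-i\delta$ horizontally to $c-i\delta$, goes vertically to $c+i\delta$ and returns horizontally to $-\infty+i\delta$. For $\kappa\in\mathbb R$, $z>0$, $N\ge1$ define $$G^\theta_{N,\kappa}(z)=\int_\gamma\frac{du}{2\pi i}\frac{\Gamma(u)\Gamma(\alpha+N+1-u)}{\Gamma(N+u)\Gamma(\alpha+1-u)\Gamma(\kappa-\theta u+1)}z^{-u},$$ $$\tilde G^\theta_{N,\kappa}(z)=\int_\gamma\frac{du}{2\pi i}\frac{\pi}{\sin((u\theta-\kappa)\pi)}\frac{\Gamma(u)\Gamma(\alpha+N+1-u)}{\Gamma(N+u)\Gamma(\alpha+1-u)\Gamma(\kappa-\theta u+1)}z^{-u},$$ $$G^\theta_{\infty,\kappa}(z)=\int_\gamma\frac{du}{2\pi i}\frac{\Gamma(u)z^{-u}}{\Gamma(\alpha+1-u)\Gamma(\kappa-\theta u+1)},\qquad \tilde G^\theta_{\infty,\kappa}(z)=\int_\gamma\frac{du}{2\pi i}\frac{\Gamma(u)\Gamma(\theta u-\kappa)z^{-u}}{\Gamma(\alpha+1-u)},$$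 where $c>0$ for the functions $G$ and $c>\max(0,\kappa/\theta)$ for the functions $\tilde G$; the loops may be chosen independently for the different functions. The Fox H-function is $$H^{m,n}_{p,q}\left[z\left|{(a_1,A_1);\dots;(a_p,A_p)\atop(b_1,B_1);\dots;(b_q,B_q)}\right.\right]=\int_\gamma\frac{ds}{2\pi i}\frac{\prod_{j=1}^m\Gamma(b_j+B_js)\prod_{j=1}^n\Gamma(1-a_j-A_js)}{\prod_{j=m+1}^q\Gamma(1-b_j-B_js)\prod_{j=n+1}^p\Gamma(a_j+A_js)}z^{-s}.$$ **Claim.** Biorthogonal systems exist. All the contour integrals above converge absolutely, one has $$\tilde G^\theta_{N,\kappa}(z)=\int_{\gamma}\frac{du}{2\pi i}\frac{\Gamma(u)\Gamma(\alpha+N+1-u)\Gamma(\theta u-\kappa)}{\Gamma(N+u)\Gamma(\alpha+1-u)}z^{-u},$$ and, with the same loop on both sides, $$G^\theta_{N,\kappa}=H^{1,1}_{2,3}\left[z\left|{(-\alpha-N,1);(N,1)\atop(0,1);(-\alpha,1);(-\kappa,\theta)}\right.\right],\quad \tilde G^\theta_{N,\kappa}=H^{2,1}_{2,3}\left[z\left|{(-\alpha-N,1);(N,1)\atop(0,1);(-\kappa,\theta);(-\alpha,1)}\right.\right],$$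 $$G^\theta_{\infty,\kappa}=H^{1,0}_{0,3}\left[z\left|{-\atop(0,1);(-\alpha,1);(-\kappa,\theta)}\right.\right],\quad \tilde G^\theta_{\infty,\kappa}=H^{2,0}_{0,3}\left[z\left|{-\atop(0,1);(-\kappa,\theta);(-\alpha,1)}\right.\right].$$ For every biorthogonal system, every $N\ge1$ and all $x,x',y,y'>0$, $$K_{01}(x,x')=\theta e^{x'}x'^b\int_0^1t^\alpha G^\theta_{N,a}(tx^\theta)\tilde G^\theta_{N,b}(tx'^\theta)\,dt,$$ $$K_{10}(y,y')=\theta e^{y}y^a\int_0^1t^\alpha \tilde G^\theta_{N,a}(ty^\theta)G^\theta_{N,b}(ty'^\theta)\,dt,$$ $$K_{11}(y,x)=\theta e^{x+y}x^by^a\int_0^1t^\alpha \tilde G^\theta_{N,a}(ty^\theta)\tilde G^\theta_{N,b}(tx^\theta)\,dt-\frac{e^{x+y}}{x+y},$$ and for all $X,X',Y,Y'>0$ $$\lim_{N\to\infty}N^{-2(\alpha+1)+\frac{2b}{\theta}}K_{01}\Big(\frac{X}{N^{2/\theta}},\frac{X'}{N^{2/\theta}}\Big)=\theta X'^b\int_0^1t^\alpha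 G^\theta_{\infty,a}(tX^\theta)\tilde G^\theta_{\infty,b}(tX'^\theta)\,dt,$$ $$\lim_{N\to\infty}N^{-2(\alpha+1)+\frac{2a}{\theta}}K_{10}\Big(\frac{Y}{N^{2/\theta}},\frac{Y'}{N^{2/\theta}}\Big)=\theta Y^a\int_0^1t^\alpha \tilde G^\theta_{\infty,a}(tY^\theta)G^\theta_{\infty,b}(tY'^\theta)\,dt,$$ $$\lim_{N\to\infty}\left(N^{-\frac2\theta}K_{11}\Big(\frac{Y}{N^{2/\theta}},\frac{X}{N^{2/\theta}}\Big)+\frac1{X+Y}\right)=\theta X^bY^a\int_0^1t^\alpha \tilde G^\theta_{\infty,a}(tY^\theta)\tilde G^\theta_{\infty,b}(tX^\theta)\,dt,$$ all the integrals over $t\in[0,1]$ being absolutely convergent. -/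

import Mathlib

open MeasureTheory Filter Topology

noncomputable section

namespace CauchyTwoMatrix

/-! ### Biorthogonal polynomials and correlation kernels -/

/-- The normalisation `h_n = θ / (2 n θ + a + b + 1)`. -/
def h (θ a b : ℝ) (n : ℕ) : ℝ := θ / (2 * n * θ + a + b + 1)

/-- The pairing `∬ e^{-(x+y)} / (x+y) x^a y^b p(x^θ) q(y^θ) dx dy` over the positive quadrant. -/
def pairing (θ a b : ℝ) (p q : Polynomial ℝ) : ℝ :=
  ∫ w in Set.Ioi (0 : ℝ) ×ˢ Set.Ioi (0 : ℝ),
    Real.exp (-(w.1 + w.2)) / (w.1 + w.2) * w.1 ^ a * w.2 ^ b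
      * p.eval (w.1 ^ θ) * q.eval (w.2 ^ θ)

/-- `P n`, `Q n` (of degree `n`) are θ-deformed Cauchy biorthogonal polynomials for the Laguerre
weights `x^a e^{-x}`, `y^b e^{-y}`, normalised by `⟨P n, Q n⟩ = h_n / θ`. -/
structure IsBiorthogonal (θ a b : ℝ) (P Q : ℕ → Polynomial ℝ) : Prop where
  natDegree_left : ∀ n, (P n).natDegree = n
  natDegree_right : ∀ n, (Q n).natDegree = n
  pairing_eq : ∀ n m, pairing θ a b (P n) (Q m) = if n = m then h θ a b n / θ else 0

/-- The Christoffel–Darboux kernel `K_N(x,y) = ∑_{n<N} (θ / h_n) P_n(x^θ) Q_n(y^θ)`. -/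
def cdKernel (θ a b : ℝ) (P Q : ℕ → Polynomial ℝ) (N : ℕ) (x y : ℝ) : ℝ :=
  ∑ n ∈ Finset.range N, θ / h θ a b n * (P n).eval (x ^ θ) * (Q n).eval (y ^ θ)

/-- `K₀₁(x,x')`. -/
def K01 (θ a b : ℝ) (P Q : ℕ → Polynomial ℝ) (N : ℕ) (x x' : ℝ) : ℝ :=
  ∫ y in Set.Ioi (0 : ℝ), cdKernel θ a b P Q N x y / (x' + y) * y ^ b * Real.exp (-y)

/-- `K₁₀(y,y')`. -/
def K10 (θ a b : ℝ) (P Q : ℕ → Polynomial ℝ) (N : ℕ) (y y' : ℝ) : ℝ :=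
  ∫ x in Set.Ioi (0 : ℝ), cdKernel θ a b P Q N x y' / (x + y) * x ^ a * Real.exp (-x)

/-- `K₁₁(y,x)`; the integration variables are `w.1 = x'`, `w.2 = y'`. -/
def K11 (θ a b : ℝ) (P Q : ℕ → Polynomial ℝ) (N : ℕ) (y x : ℝ) : ℝ :=
  (∫ w in Set.Ioi (0 : ℝ) ×ˢ Set.Ioi (0 : ℝ),
    cdKernel θ a b P Q N w.1 w.2 / ((w.1 + y) * (x + w.2))
      * w.1 ^ a * w.2 ^ b * Real.exp (-(w.1 + w.2))) - 1 / (x + y)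

/-! ### Contour integrals -/

/-- A loop that comes from `-∞ - iδ`, runs along `Im u = -δ` to `c - iδ`, up to `c + iδ`, and back
along `Im u = δ` to `-∞ + iδ`, where `c = vertex` and `δ = width > 0`. It encloses, in the positive
sense, exactly the part of the real axis to the left of `c`. -/
structure HankelLoop where
  vertex : ℝ
  width : ℝ
  width_pos : 0 < width

/-- Absolute convergence of the integral of `f` along the loop. -/
def LoopIntegrable (γ : HankelLoop) (f : ℂ → ℂ) : Prop :=
  IntegrableOn (fun s : ℝ => f (s - γ.width * Complex.I)) (Set.Iic γ.vertex) ∧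
  IntervalIntegrable (fun s : ℝ => f (γ.vertex + s * Complex.I)) volume (-γ.width) γ.width ∧
  IntegrableOn (fun s : ℝ => f (s + γ.width * Complex.I)) (Set.Iic γ.vertex)

/-- `(2πi)⁻¹ ∫_γ f(u) du`. -/
def loopIntegral (γ : HankelLoop) (f : ℂ → ℂ) : ℂ :=
  (2 * Real.pi * Complex.I)⁻¹ *
    ((∫ s in Set.Iic γ.vertex, f (s - γ.width * Complex.I))
      + (∫ s in (-γ.width)..γ.width, f (γ.vertex + s * Complex.I)) * Complex.I
      - ∫ s in Set.Iic γ.vertex, f (s + γ.width * Complex.I))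

/-- The Fox H-function `H^{m,n}_{p,q}[z]` with upper parameters `(a_j, A_j) = up j` and lower
parameters `(b_j, B_j) = low j`, as a Mellin–Barnes integral along the loop `γ`. -/
def foxH (m n : ℕ) {p q : ℕ} (up : Fin p → ℝ × ℝ) (low : Fin q → ℝ × ℝ)
    (γ : HankelLoop) (z : ℝ) : ℂ :=
  loopIntegral γ fun s =>
    ((∏ j : Fin q with j.val < m, Complex.Gamma ((low j).1 + (low j).2 * s))
        * ∏ j : Fin p with j.val < n, Complex.Gamma (1 - (up j).1 - (up j).2 * s))
      / ((∏ j : Fin q with m ≤ j.val, Complex.Gamma (1 - (low j).1 - (low j).2 * s))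
        * ∏ j : Fin p with n ≤ j.val, Complex.Gamma ((up j).1 + (up j).2 * s))
      * (z : ℂ) ^ (-s)

/-- Integrand of `G^θ_{N,κ}(z)`. -/
def gIntegrand (θ α κ : ℝ) (N : ℕ) (z : ℝ) (u : ℂ) : ℂ :=
  Complex.Gamma u * Complex.Gamma (α + N + 1 - u)
    / (Complex.Gamma (N + u) * Complex.Gamma (α + 1 - u) * Complex.Gamma (κ - θ * u + 1))
    * (z : ℂ) ^ (-u)

/-- Integrand of `G̃^θ_{N,κ}(z)`, trigonometric form. -/
def gTildeIntegrand (θ α κ : ℝ) (N : ℕ) (z : ℝ) (u : ℂ) : ℂ :=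
  Real.pi / Complex.sin ((u * θ - κ) * Real.pi) * gIntegrand θ α κ N z u

/-- Integrand of `G̃^θ_{N,κ}(z)`, Gamma function form. -/
def gTildeIntegrand' (θ α κ : ℝ) (N : ℕ) (z : ℝ) (u : ℂ) : ℂ :=
  Complex.Gamma u * Complex.Gamma (α + N + 1 - u) * Complex.Gamma (θ * u - κ)
    / (Complex.Gamma (N + u) * Complex.Gamma (α + 1 - u)) * (z : ℂ) ^ (-u)

/-- Integrand of `G^θ_{∞,κ}(z)`. -/
def gInfIntegrand (θ α κ : ℝ) (z : ℝ) (u : ℂ) : ℂ :=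
  Complex.Gamma u * (z : ℂ) ^ (-u)
    / (Complex.Gamma (α + 1 - u) * Complex.Gamma (κ - θ * u + 1))

/-- Integrand of `G̃^θ_{∞,κ}(z)`. -/
def gTildeInfIntegrand (θ α κ : ℝ) (z : ℝ) (u : ℂ) : ℂ :=
  Complex.Gamma u * Complex.Gamma (θ * u - κ) * (z : ℂ) ^ (-u) / Complex.Gamma (α + 1 - u)

/-- `G^θ_{N,κ}(z)`. -/
def G (γ : HankelLoop) (θ α κ : ℝ) (N : ℕ) (z : ℝ) : ℂ :=
  loopIntegral γ (gIntegrand θ α κ N z)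

/-- `G̃^θ_{N,κ}(z)`. -/
def GTilde (γ : HankelLoop) (θ α κ : ℝ) (N : ℕ) (z : ℝ) : ℂ :=
  loopIntegral γ (gTildeIntegrand θ α κ N z)

/-- `G^θ_{∞,κ}(z)`. -/
def GInf (γ : HankelLoop) (θ α κ : ℝ) (z : ℝ) : ℂ :=
  loopIntegral γ (gInfIntegrand θ α κ z)

/-- `G̃^θ_{∞,κ}(z)`. -/
def GTildeInf (γ : HankelLoop) (θ α κ : ℝ) (z : ℝ) : ℂ :=
  loopIntegral γ (gTildeInfIntegrand θ α κ z)

end CauchyTwoMatrix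

end

open CauchyTwoMatrix

/-! Put β = α + 1 = (a+b+1)/θ. Everything rests on the rational function (β-u)_N / (u)_N (`ratF`)
and its partial fractions (-1)^N + ∑_{j<N} A_j/(u+j), where A_j = `coefA β N j`.

Kernels. The identity e^{-(x+y)}/(x+y) = ∫_1^∞ e^{-r(x+y)} dr separates the variables. After
dividing x^{jθ} by Γ(a+jθ+1) and y^{kθ} by Γ(b+kθ+1), the Gram matrix of the pairing becomes the
Cauchy matrix θ⁻¹/(β+j+k). Jacobi coefficients diagonalise it, so biorthogonal systems exist, and
its inverse is θ A_j A_k/(β+j+k) (`sum_coefA_mul_coefA`). Hence for every biorthogonal system K_N is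
the double sum of θ A_j A_k/(β+j+k) times normalised monomials (`cdKernel_eq_sum`). A Cauchy
transform in one variable turns its normalised monomials into e^x ∫_1^∞ r^{-κ-jθ-1} e^{-rx} dr, with
κ = a or b.

Special functions. The Gamma quotient common to the integrands of G_N and G̃_N is `ratF`. Partial
fractions and residues give G_N(z) = ∑ A_j z^j/Γ(κ+jθ+1) (`loopN_invGamma`). Deforming the loop to a
vertical line and inverting Mellin transforms gives G̃_N = (-1)^N e + ∑ A_j u_j (`loopN_Gamma`),
where e = `expFun` has transform Γ(θu-κ) and u_j = `tailFun` has transform Γ(θu-κ)/(u+j). At z =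
x^θ, u_j is x^{-κ} times the exponential integral above (`tailFun_rpow`).

Link. Both families satisfy z u_j' = j u_j - e, with e = 0 for monomials. Integrating the derivative
of t^β u_j v_k over [0,1] expresses (β+j+k) ∫ t^{β-1} u_j v_k by boundary values and integrals with
e or f. Since `ratF` vanishes at β+k, ∑_j A_j/(β+j+k) = -(-1)^N, and the cross terms cancel
(`integral_sum_mul_sum`). What is left is the double sum of the kernel and ∫ t^{β-1} e f. The latter
is nonzero only for K₁₁, where it accounts for the change from 1/(x+y) to e^{x+y}/(x+y).

Limits. (β-u)_N/(u)_N is asymptotic to N^{β-2u} Γ(u)/Γ(β-u) (`tendsto_scaledRatF`), and the rescaled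
quotient grows at most exponentially to the left along the loop, uniformly in N
(`norm_scaledRatF_le`). The remaining factor decays faster than any exponential, so dominated
convergence applies on the loop. A second dominated convergence, in t, needs bounds z^{-c} and
z^{-d} with c + d < β. The explicit formulas show that G_N and G̃_N do not depend on the loop, so c
and d can be read off from auxiliary loops; suitable values exist by `exists_exponents`. -/

noncomputable section

namespace CauchyTwoMatrix

/-! ### Partial fractions and the inverse of the Cauchy matrix -/

section PartialFractions

variable {K : Type*} [Field K] [CharZero K]

/-- Partial fractions for a proper rational function with simple poles at `0, -1, …, 1 - N`. -/
theorem eval_div_prod_eq_sum (p : Polynomial K) (N : ℕ) (hp : p.degree < N) {u : K}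
    (hu : ∀ i < N, u + i ≠ 0) :
    p.eval u / ∏ i ∈ Finset.range N, (u + i)
      = ∑ j ∈ Finset.range N, p.eval (-(j : K))
          * (∏ i ∈ (Finset.range N).erase j, ((i : K) - j)⁻¹) / (u + j) := by
  have hinj : Set.InjOn (fun i : ℕ => -(i : K)) (Finset.range N) := by
    intro i _ j _ hij
    simpa using hij
  have h1 := Lagrange.eq_interpolate (s := Finset.range N) hinj (f := p) (by simpa using hp)
  have h2 := Lagrange.eval_interpolate_not_at_node (s := Finset.range N)
    (v := fun i : ℕ => -(i : K)) (fun i => p.eval (-(i : K))) (x := u) (by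
      intro i hi h
      exact hu i (Finset.mem_range.1 hi) (by rw [h]; ring))
  rw [← h1, Lagrange.eval_nodal] at h2
  have h3 : ∏ i ∈ Finset.range N, (u + i) ≠ 0 :=
    Finset.prod_ne_zero_iff.2 fun i hi => hu i (Finset.mem_range.1 hi)
  simp only [sub_neg_eq_add] at h2
  rw [h2, mul_div_cancel_left₀ _ h3]
  refine Finset.sum_congr rfl fun j _ => ?_
  have : Lagrange.nodalWeight (Finset.range N) (fun i : ℕ => -(i : K)) j
      = ∏ i ∈ (Finset.range N).erase j, ((i : K) - j)⁻¹ := by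
    unfold Lagrange.nodalWeight
    refine Finset.prod_congr rfl fun i _ => ?_
    congr 1; ring
  rw [this]; ring

/-- The residue at `u = -j` of `(β - u)_N / (u)_N`. -/
def coefA (β : K) (N j : ℕ) : K :=
  (∏ i ∈ Finset.range N, (β + j + i)) * ∏ i ∈ (Finset.range N).erase j, ((i : K) - j)⁻¹

/-- The rational function `(β - u)_N / (u)_N`. -/
def ratF (β : K) (N : ℕ) (u : K) : K :=
  (∏ i ∈ Finset.range N, (β - u + i)) / ∏ i ∈ Finset.range N, (u + i)

/-- Numerator and denominator both have degree N, with leading coefficients (-1)^N and 1, so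
subtracting (-1)^N leaves a proper fraction. The subtracted part does not change the residues,
because the denominator vanishes at the nodes. -/
theorem ratF_eq_sum (β : K) (N : ℕ) {u : K} (hu : ∀ i < N, u + i ≠ 0) :
    ratF β N u = (-1) ^ N + ∑ j ∈ Finset.range N, coefA β N j / (u + j) := by
  classical
  set p1 : Polynomial K := ∏ i ∈ Finset.range N, (Polynomial.X - Polynomial.C (β + i)) with hp1
  set p2 : Polynomial K := ∏ i ∈ Finset.range N, (Polynomial.X - Polynomial.C (-(i : K))) with hp2
  have m1 : p1.Monic := Polynomial.monic_prod_of_monic _ _ fun i _ => Polynomial.monic_X_sub_C _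
  have m2 : p2.Monic := Polynomial.monic_prod_of_monic _ _ fun i _ => Polynomial.monic_X_sub_C _
  have d1 : p1.degree = N := by
    rw [hp1, Polynomial.degree_prod]; simp only [Polynomial.degree_X_sub_C]; simp
  have d2 : p2.degree = N := by
    rw [hp2, Polynomial.degree_prod]; simp only [Polynomial.degree_X_sub_C]; simp
  have hdeg : (Polynomial.C ((-1 : K) ^ N) * (p1 - p2)).degree < N := by
    rw [Polynomial.degree_C_mul (by simp)]
    have := Polynomial.degree_sub_lt_left (d1.trans d2.symm) m1.ne_zero
      (m1.leadingCoeff.trans m2.leadingCoeff.symm)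
    rwa [d1] at this
  have e1 : ∀ x, (-1 : K) ^ N * p1.eval x = ∏ i ∈ Finset.range N, (β - x + i) := by
    intro x
    rw [hp1, Polynomial.eval_prod]
    conv_lhs => rw [← Finset.card_range N, ← Finset.prod_const, Finset.card_range,
      ← Finset.prod_mul_distrib]
    refine Finset.prod_congr rfl fun i _ => ?_
    simp; ring
  have e2 : ∀ x, p2.eval x = ∏ i ∈ Finset.range N, (x + i) := by
    intro x
    rw [hp2, Polynomial.eval_prod]
    refine Finset.prod_congr rfl fun i _ => ?_
    simp
  have key := eval_div_prod_eq_sum _ N hdeg hu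
  have h3 : ∏ i ∈ Finset.range N, (u + i) ≠ 0 :=
    Finset.prod_ne_zero_iff.2 fun i hi => hu i (Finset.mem_range.1 hi)
  simp only [Polynomial.eval_mul, Polynomial.eval_C, Polynomial.eval_sub, mul_sub, e1, e2] at key
  rw [sub_div, mul_div_assoc, div_self h3] at key
  rw [ratF, sub_eq_iff_eq_add.1 key, add_comm, mul_one]
  congr 1
  refine Finset.sum_congr rfl fun j hj => ?_
  have : ∏ i ∈ Finset.range N, (-(j : K) + i) = 0 :=
    Finset.prod_eq_zero hj (by simp)
  rw [this, coefA]
  simp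

/-- For k < N the point β + k is a zero of `ratF`; this is the expansion evaluated there. It is what
cancels the cross terms in `integral_sum_mul_sum`. -/
theorem sum_coefA_div (β : K) (N : ℕ) {k : ℕ} (hk : k < N) (hβ : ∀ i : ℕ, β + i ≠ 0) :
    ∑ j ∈ Finset.range N, coefA β N j / (β + j + k) = -(-1) ^ N := by
  have hne : ∀ i < N, (β + k : K) + i ≠ 0 := fun i _ => by
    have := hβ (k + i); push_cast at this; rwa [← add_assoc] at this
  have h1 := ratF_eq_sum β N hne
  have h2 : ratF β N (β + k) = 0 := by
    rw [ratF, Finset.prod_eq_zero (Finset.mem_range.2 hk) (by ring), zero_div]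
  rw [h2] at h1
  have h3 : ∑ j ∈ Finset.range N, coefA β N j / (β + j + k)
      = ∑ j ∈ Finset.range N, coefA β N j / (β + k + j) :=
    Finset.sum_congr rfl fun j _ => by rw [add_right_comm]
  rw [h3]; linear_combination -h1

/-- The inverse of the Cauchy matrix. Cancelling β+j+k against A_k leaves the residue at -k of
p(u)/(u)_N with p = ∏_{i≠j}(β+i-u). The sum over k is therefore A_j times p(u)/(u)_N at u = β+l, and
p vanishes there unless l = j. -/
theorem sum_coefA_mul_coefA (β : K) (N : ℕ) {j l : ℕ} (hj : j < N) (hl : l < N)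
    (hβ : ∀ i : ℕ, β + i ≠ 0) :
    ∑ k ∈ Finset.range N, coefA β N j * coefA β N k / (β + j + k) * (1 / (β + k + l))
      = if j = l then 1 else 0 := by
  classical
  have hne : ∀ m n : ℕ, (β + m : K) + n ≠ 0 := fun m n => by
    have := hβ (m + n); push_cast at this; rwa [← add_assoc] at this
  set p : Polynomial K :=
    ∏ i ∈ (Finset.range N).erase j, (Polynomial.C (β + i) - Polynomial.X) with hp
  have e : ∀ x, p.eval x = ∏ i ∈ (Finset.range N).erase j, (β + i - x) := by
    intro x
    rw [hp, Polynomial.eval_prod]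
    exact Finset.prod_congr rfl fun i _ => by simp
  have hdeg : p.degree < N := by
    refine (Polynomial.degree_prod_le _ _).trans_lt ?_
    have : ∀ i ∈ (Finset.range N).erase j,
        (Polynomial.C (β + (i : K)) - Polynomial.X).degree ≤ 1 := by
      intro i _
      refine (Polynomial.degree_sub_le _ _).trans ?_
      simp only [Polynomial.degree_X, max_le_iff, le_refl, and_true]
      exact Polynomial.degree_C_le.trans (by norm_num)
    refine (Finset.sum_le_sum this).trans_lt ?_
    simp only [Finset.sum_const, Finset.card_erase_of_mem (Finset.mem_range.2 hj),
      Finset.card_range, nsmul_eq_mul, mul_one]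
    exact_mod_cast Nat.sub_lt (by omega) one_pos
  have key := eval_div_prod_eq_sum p N hdeg (u := β + l) (fun i _ => hne l i)
  have h1 : ∀ k ∈ Finset.range N,
      coefA β N j * coefA β N k / (β + j + k) * (1 / (β + k + l))
      = coefA β N j * (p.eval (-(k : K))
          * (∏ i ∈ (Finset.range N).erase k, ((i : K) - k)⁻¹) / (β + l + k)) := by
    intro k _
    have h2 : coefA β N k = p.eval (-(k : K)) * (β + j + k)
        * ∏ i ∈ (Finset.range N).erase k, ((i : K) - k)⁻¹ := by
      rw [coefA, e, ← Finset.prod_erase_mul _ _ (Finset.mem_range.2 hj)]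
      congr 2
      · exact Finset.prod_congr rfl fun i _ => by ring
      · ring
    rw [h2, add_right_comm β (k : K) l]
    have := hne j k
    field_simp
  rw [Finset.sum_congr rfl h1, ← Finset.mul_sum, ← key, e]
  split_ifs with hjl
  · subst hjl
    have h4 : ∏ i ∈ Finset.range N, (β + j + (i : K)) ≠ 0 :=
      Finset.prod_ne_zero_iff.2 fun i _ => hne j i
    have h5 : (∏ i ∈ (Finset.range N).erase j, ((i : K) - j)⁻¹)
        * ∏ i ∈ (Finset.range N).erase j, (β + i - (β + j)) = 1 := by
      rw [← Finset.prod_mul_distrib]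
      refine Finset.prod_eq_one fun i hi => ?_
      have : (i : K) - j ≠ 0 := sub_ne_zero.2 (by exact_mod_cast (Finset.mem_erase.1 hi).1)
      rw [add_sub_add_left_eq_sub, inv_mul_cancel₀ this]
    rw [coefA, mul_div_assoc', mul_assoc, h5, mul_one, div_self h4]
  · rw [Finset.prod_eq_zero (i := l) (by simp [hl, Ne.symm hjl]) (by ring)]
    simp

/-- Coefficients of the shifted Jacobi polynomials for the weight `t ^ (β - 1)` on `[0, 1]`. -/
def jacobiCoef (β : K) (n j : ℕ) : K :=
  (∏ i ∈ Finset.range n, (β + j + i)) * ∏ i ∈ (Finset.range (n + 1)).erase j, ((i : K) - j)⁻¹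

/-- Partial fractions of ∏_{i<n}(β+i-u) / ∏_{i≤n}(u+i) at u = β + k. Since 1/(β+j+k) = ∫_0^1
t^{β-1+j+k} dt, the zeros k < n express orthogonality of the Jacobi polynomial to lower powers. -/
theorem sum_jacobiCoef_div (β : K) (n k : ℕ) (hβ : ∀ i : ℕ, β + i ≠ 0) :
    ∑ j ∈ Finset.range (n + 1), jacobiCoef β n j / (β + k + j)
      = (∏ i ∈ Finset.range n, ((i : K) - k)) / ∏ i ∈ Finset.range (n + 1), (β + k + i) := by
  have hne : ∀ i < n + 1, (β + k : K) + i ≠ 0 := fun i _ => by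
    have := hβ (k + i); push_cast at this; rwa [← add_assoc] at this
  set p : Polynomial K := ∏ i ∈ Finset.range n, (Polynomial.C (β + i) - Polynomial.X) with hp
  have e : ∀ x, p.eval x = ∏ i ∈ Finset.range n, (β + i - x) := by
    intro x
    rw [hp, Polynomial.eval_prod]
    exact Finset.prod_congr rfl fun i _ => by simp
  have hdeg : p.degree < (n + 1 : ℕ) := by
    refine (Polynomial.degree_prod_le _ _).trans_lt ?_
    have : ∀ i ∈ Finset.range n, (Polynomial.C (β + (i : K)) - Polynomial.X).degree ≤ 1 := by
      intro i _
      refine (Polynomial.degree_sub_le _ _).trans ?_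
      simp only [Polynomial.degree_X, max_le_iff, le_refl, and_true]
      exact Polynomial.degree_C_le.trans (by norm_num)
    refine (Finset.sum_le_sum this).trans_lt ?_
    simp only [Finset.sum_const, Finset.card_range, nsmul_eq_mul, mul_one]
    exact_mod_cast Nat.lt_succ_self n
  have key := eval_div_prod_eq_sum p (n + 1) hdeg hne
  rw [e] at key
  have h1 : ∏ i ∈ Finset.range n, ((i : K) - k) = ∏ i ∈ Finset.range n, (β + i - (β + k)) :=
    Finset.prod_congr rfl fun i _ => by ring
  rw [h1, key]
  refine Finset.sum_congr rfl fun j _ => ?_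
  rw [e, jacobiCoef]
  congr 2
  exact Finset.prod_congr rfl fun i _ => by ring

theorem sum_jacobiCoef_div_of_lt (β : K) {n k : ℕ} (hk : k < n) (hβ : ∀ i : ℕ, β + i ≠ 0) :
    ∑ j ∈ Finset.range (n + 1), jacobiCoef β n j / (β + k + j) = 0 := by
  rw [sum_jacobiCoef_div β n k hβ, Finset.prod_eq_zero (Finset.mem_range.2 hk) (sub_self _),
    zero_div]

theorem jacobiCoef_self_ne_zero (β : K) (n : ℕ) (hβ : ∀ i : ℕ, β + i ≠ 0) :
    jacobiCoef β n n ≠ 0 := by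
  refine mul_ne_zero (Finset.prod_ne_zero_iff.2 fun i _ => ?_)
    (Finset.prod_ne_zero_iff.2 fun i hi => inv_ne_zero (sub_ne_zero.2 ?_))
  · have := hβ (n + i); push_cast at this; rwa [← add_assoc] at this
  · exact_mod_cast (Finset.mem_erase.1 hi).1

theorem sum_sum_jacobiCoef (β : K) (n m : ℕ) (hβ : ∀ i : ℕ, β + i ≠ 0) :
    ∑ j ∈ Finset.range (n + 1), ∑ k ∈ Finset.range (m + 1),
      jacobiCoef β n j * jacobiCoef β m k / (β + j + k)
      = if n = m then 1 / (β + 2 * n) else 0 := by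
  rcases lt_trichotomy n m with hnm | rfl | hnm
  · rw [if_neg hnm.ne]
    refine Finset.sum_eq_zero fun j hj => ?_
    have := sum_jacobiCoef_div_of_lt β (n := m) (k := j)
      (by have := Finset.mem_range.1 hj; omega) hβ
    simp only [mul_div_assoc, ← Finset.mul_sum, this, mul_zero]
  -- By orthogonality to lower powers only the top index k = n contributes, and its value is the
  -- norm.
  · rw [if_pos rfl, Finset.sum_comm, Finset.sum_range_succ]
    have h0 : ∀ k, ∑ j ∈ Finset.range (n + 1), jacobiCoef β n j * jacobiCoef β n k / (β + j + k)
        = jacobiCoef β n k * ∑ j ∈ Finset.range (n + 1), jacobiCoef β n j / (β + k + j) := by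
      intro k
      rw [Finset.mul_sum]
      exact Finset.sum_congr rfl fun j _ => by rw [add_right_comm]; ring
    rw [Finset.sum_eq_zero, zero_add, h0, sum_jacobiCoef_div β n n hβ, jacobiCoef,
      Finset.range_add_one, Finset.erase_insert (by simp), Finset.prod_insert (by simp)]
    · have h1 : ∏ i ∈ Finset.range n, (β + n + (i : K)) ≠ 0 :=
        Finset.prod_ne_zero_iff.2 fun i _ => by
          have := hβ (n + i); push_cast at this; rwa [← add_assoc] at this
      have h2 : ∏ i ∈ Finset.range n, ((i : K) - n) ≠ 0 :=
        Finset.prod_ne_zero_iff.2 fun i hi => sub_ne_zero.2 (by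
          exact_mod_cast (Finset.mem_range.1 hi).ne)
      have h3 : β + 2 * n ≠ 0 := by simpa using hβ (2 * n)
      have h4 : β + n + n = β + 2 * n := by ring
      rw [Finset.prod_inv_distrib, h4]
      field_simp
    · intro k hk
      rw [h0, sum_jacobiCoef_div_of_lt β (Finset.mem_range.1 hk) hβ, mul_zero]
  · rw [if_neg hnm.ne', Finset.sum_comm]
    refine Finset.sum_eq_zero fun k hk => ?_
    have := sum_jacobiCoef_div_of_lt β (n := n) (k := k)
      (by have := Finset.mem_range.1 hk; omega) hβ
    have h1 : ∀ j ∈ Finset.range (n + 1), jacobiCoef β n j * jacobiCoef β m k / (β + j + k)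
        = jacobiCoef β m k * (jacobiCoef β n j / (β + k + j)) := fun j _ => by
      rw [add_right_comm]; ring
    rw [Finset.sum_congr rfl h1, ← Finset.mul_sum, this, mul_zero]

end PartialFractions

theorem ofReal_coefA (β : ℝ) (N j : ℕ) : ((coefA β N j : ℝ) : ℂ) = coefA (β : ℂ) N j := by
  simp [coefA]

/-! ### Moments of the weights -/

/-- Tonelli needs no integrability in advance; the value of the `lintegral` then delivers
integrability and the integral together. -/
theorem integrable_and_integral_eq_of_lintegral {X : Type*} [MeasurableSpace X] {μ : Measure X}
    {f : X → ℝ} (hf : AEStronglyMeasurable f μ) (h0 : 0 ≤ᵐ[μ] f) {v : ℝ} (hv : 0 ≤ v)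
    (h : ∫⁻ x, ENNReal.ofReal (f x) ∂μ = ENNReal.ofReal v) :
    Integrable f μ ∧ ∫ x, f x ∂μ = v := by
  refine ⟨(lintegral_ofReal_ne_top_iff_integrable hf h0).1 (by simp [h]), ?_⟩
  rw [integral_eq_lintegral_of_nonneg_ae h0 hf, h, ENNReal.toReal_ofReal hv]

/-- The Bochner integral of a non-integrable function is 0 by convention, so a positive value
certifies integrability. -/
theorem integrable_of_integral_pos {X : Type*} [MeasurableSpace X] {μ : Measure X}
    {f : X → ℝ} (h : 0 < ∫ x, f x ∂μ) : Integrable f μ := by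
  by_contra hf
  rw [integral_undef hf] at h
  exact lt_irrefl _ h

theorem lintegral_rpow_mul_exp {s r : ℝ} (hs : -1 < s) (hr : 0 < r) :
    ∫⁻ x in Set.Ioi (0 : ℝ), ENNReal.ofReal (x ^ s * Real.exp (-(r * x)))
      = ENNReal.ofReal (Real.Gamma (s + 1) * r ^ (-(s + 1))) := by
  have h1 := Real.integral_rpow_mul_exp_neg_mul_Ioi (a := s + 1) (by linarith) hr
  simp only [add_sub_cancel_right] at h1
  have hG := Real.Gamma_pos_of_pos (s := s + 1) (by linarith)
  have hpos : 0 < ∫ t in Set.Ioi (0 : ℝ), t ^ s * Real.exp (-(r * t)) := by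
    rw [h1]; positivity
  rw [← ofReal_integral_eq_lintegral_ofReal (integrable_of_integral_pos hpos), h1]
  · rw [one_div, Real.inv_rpow hr.le, Real.rpow_neg hr.le, mul_comm]
  · filter_upwards [ae_restrict_mem measurableSet_Ioi] with x hx
    have : (0 : ℝ) < x := hx
    positivity

theorem lintegral_exp_Ioi_one {c : ℝ} (hc : 0 < c) :
    ∫⁻ r in Set.Ioi (1 : ℝ), ENNReal.ofReal (Real.exp (-(r * c)))
      = ENNReal.ofReal (Real.exp (-c) / c) := by
  have h1 := integral_exp_mul_Ioi (a := -c) (by linarith) 1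
  have e : ∀ r : ℝ, Real.exp (-(r * c)) = Real.exp (-c * r) := fun r => by ring_nf
  have h2 : ∫ r in Set.Ioi (1 : ℝ), Real.exp (-(r * c)) = Real.exp (-c) / c := by
    simp only [e, h1, mul_one, neg_div_neg_eq]
  rw [← h2, ofReal_integral_eq_lintegral_ofReal]
  · exact integrable_of_integral_pos (by rw [h2]; positivity)
  · exact Eventually.of_forall fun r => (Real.exp_pos _).le

theorem volume_restrict_quadrant :
    (volume : Measure (ℝ × ℝ)).restrict (Set.Ioi (0 : ℝ) ×ˢ Set.Ioi (0 : ℝ))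
      = (volume.restrict (Set.Ioi (0 : ℝ))).prod (volume.restrict (Set.Ioi (0 : ℝ))) := by
  rw [Measure.prod_restrict, Measure.volume_eq_prod]

/-- The bimoments of the weight `e^{-(x+y)} / (x+y)`. -/
theorem bimoment {s t : ℝ} (hs : -1 < s) (ht : -1 < t) (hst : -1 < s + t) :
    IntegrableOn (fun w : ℝ × ℝ => Real.exp (-(w.1 + w.2)) / (w.1 + w.2) * w.1 ^ s * w.2 ^ t)
      (Set.Ioi (0 : ℝ) ×ˢ Set.Ioi (0 : ℝ)) ∧
    ∫ w in Set.Ioi (0 : ℝ) ×ˢ Set.Ioi (0 : ℝ),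
      Real.exp (-(w.1 + w.2)) / (w.1 + w.2) * w.1 ^ s * w.2 ^ t
      = Real.Gamma (s + 1) * Real.Gamma (t + 1) / (s + t + 1) := by
  have hG1 := Real.Gamma_pos_of_pos (s := s + 1) (by linarith)
  have hG2 := Real.Gamma_pos_of_pos (s := t + 1) (by linarith)
  have hst' : 0 < s + t + 1 := by linarith
  have hmem : ∀ᵐ w ∂(volume.restrict (Set.Ioi (0 : ℝ) ×ˢ Set.Ioi (0 : ℝ)) : Measure (ℝ × ℝ)),
      0 < w.1 ∧ 0 < w.2 := by
    filter_upwards [ae_restrict_mem (measurableSet_Ioi.prod measurableSet_Ioi)] with w hw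
    exact ⟨hw.1, hw.2⟩
  refine integrable_and_integral_eq_of_lintegral ?_ ?_ (by positivity) ?_
  · exact Measurable.aestronglyMeasurable (by fun_prop)
  · filter_upwards [hmem] with w ⟨h1, h2⟩
    positivity
  -- Replacing e^{-(x+y)}/(x+y) by ∫_1^∞ e^{-r(x+y)} dr separates the variables once r is outermost;
  -- each inner integral is then a Gamma integral.
  · have e1 : ∫⁻ w in Set.Ioi (0 : ℝ) ×ˢ Set.Ioi (0 : ℝ),
        ENNReal.ofReal (Real.exp (-(w.1 + w.2)) / (w.1 + w.2) * w.1 ^ s * w.2 ^ t)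
        = ∫⁻ w in Set.Ioi (0 : ℝ) ×ˢ Set.Ioi (0 : ℝ), ∫⁻ r in Set.Ioi (1 : ℝ),
            ENNReal.ofReal (w.1 ^ s * Real.exp (-(r * w.1)))
              * ENNReal.ofReal (w.2 ^ t * Real.exp (-(r * w.2))) := by
      refine lintegral_congr_ae ?_
      filter_upwards [hmem] with w ⟨h1, h2⟩
      have e2 : ∀ r, ENNReal.ofReal (w.1 ^ s * Real.exp (-(r * w.1)))
              * ENNReal.ofReal (w.2 ^ t * Real.exp (-(r * w.2)))
          = ENNReal.ofReal (w.1 ^ s * w.2 ^ t)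
            * ENNReal.ofReal (Real.exp (-(r * (w.1 + w.2)))) := by
        intro r
        rw [← ENNReal.ofReal_mul (by positivity), ← ENNReal.ofReal_mul (by positivity)]
        congr 1
        rw [mul_add, neg_add, Real.exp_add]; ring
      simp only [e2]
      rw [lintegral_const_mul _ (by fun_prop), lintegral_exp_Ioi_one (by linarith),
        ← ENNReal.ofReal_mul (by positivity)]
      congr 1; ring
    rw [e1, lintegral_lintegral_swap (Measurable.aemeasurable (by fun_prop)),
      volume_restrict_quadrant]
    have e3 : ∀ r ∈ Set.Ioi (1 : ℝ),
        ∫⁻ w, ENNReal.ofReal (w.1 ^ s * Real.exp (-(r * w.1)))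
              * ENNReal.ofReal (w.2 ^ t * Real.exp (-(r * w.2)))
          ∂((volume.restrict (Set.Ioi (0 : ℝ))).prod (volume.restrict (Set.Ioi (0 : ℝ))))
        = ENNReal.ofReal (Real.Gamma (s + 1) * Real.Gamma (t + 1) * r ^ (-(s + t + 2))) := by
      intro r hr
      have hr0 : 0 < r := one_pos.trans hr
      rw [lintegral_prod_mul (f := fun x => ENNReal.ofReal (x ^ s * Real.exp (-(r * x))))
        (g := fun x => ENNReal.ofReal (x ^ t * Real.exp (-(r * x))))
        (Measurable.aemeasurable (by fun_prop)) (Measurable.aemeasurable (by fun_prop)),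
        lintegral_rpow_mul_exp hs hr0, lintegral_rpow_mul_exp ht hr0,
        ← ENNReal.ofReal_mul (by positivity)]
      congr 1
      rw [show -(s + t + 2) = -(s + 1) + -(t + 1) by ring, Real.rpow_add hr0]; ring
    rw [setLIntegral_congr_fun measurableSet_Ioi e3, ← ofReal_integral_eq_lintegral_ofReal]
    · rw [integral_const_mul, integral_Ioi_rpow_of_lt (by linarith) one_pos]
      congr 1
      rw [Real.one_rpow, show -(s + t + 2) + 1 = -(s + t + 1) by ring, neg_div_neg_eq]
      ring
    · exact (integrableOn_Ioi_rpow_of_lt (by linarith) one_pos).const_mul _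
    · filter_upwards [ae_restrict_mem measurableSet_Ioi] with r hr
      have : (0 : ℝ) < r := one_pos.trans hr
      positivity

/-- The Cauchy transform of `y^σ e^{-y}`. -/
theorem cauchyTransform_weight {σ x : ℝ} (hσ : -1 < σ) (hx : 0 < x) :
    IntegrableOn (fun y : ℝ => y ^ σ * Real.exp (-y) / (x + y)) (Set.Ioi 0) ∧
    ∫ y in Set.Ioi (0 : ℝ), y ^ σ * Real.exp (-y) / (x + y)
      = Real.Gamma (σ + 1) * Real.exp x
        * ∫ r in Set.Ioi (1 : ℝ), r ^ (-(σ + 1)) * Real.exp (-(r * x)) := by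
  have hG := Real.Gamma_pos_of_pos (s := σ + 1) (by linarith)
  have hint : IntegrableOn (fun r : ℝ => r ^ (-(σ + 1)) * Real.exp (-(r * x))) (Set.Ioi 1) := by
    have h1 : IntegrableOn (fun r : ℝ => Real.exp (-(r * x))) (Set.Ioi 1) := by
      have := integrableOn_exp_mul_Ioi (a := -x) (by linarith) 1
      exact this.congr_fun (fun r _ => by ring_nf) measurableSet_Ioi
    refine h1.mono' (Measurable.aestronglyMeasurable (by fun_prop)) ?_
    filter_upwards [ae_restrict_mem measurableSet_Ioi] with r hr
    have hr1 : (1 : ℝ) < r := hr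
    have : (0 : ℝ) < r := one_pos.trans hr1
    rw [Real.norm_of_nonneg (by positivity)]
    exact mul_le_of_le_one_left (Real.exp_pos _).le
      (Real.rpow_le_one_of_one_le_of_nonpos hr1.le (by linarith))
  refine integrable_and_integral_eq_of_lintegral ?_ ?_ ?_ ?_
  · exact Measurable.aestronglyMeasurable (by fun_prop)
  · filter_upwards [ae_restrict_mem measurableSet_Ioi] with y hy
    have : (0 : ℝ) < y := hy
    positivity
  · refine mul_nonneg (by positivity) (setIntegral_nonneg measurableSet_Ioi fun r hr => ?_)
    have : (0 : ℝ) < r := one_pos.trans hr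
    positivity
  -- The same device in one variable: e^{-y}/(x+y) = e^x ∫_1^∞ e^{-r(x+y)} dr.
  · have e1 : ∫⁻ y in Set.Ioi (0 : ℝ), ENNReal.ofReal (y ^ σ * Real.exp (-y) / (x + y))
        = ∫⁻ y in Set.Ioi (0 : ℝ), ∫⁻ r in Set.Ioi (1 : ℝ),
            ENNReal.ofReal (Real.exp x * Real.exp (-(r * x)))
              * ENNReal.ofReal (y ^ σ * Real.exp (-(r * y))) := by
      refine setLIntegral_congr_fun measurableSet_Ioi fun y hy => ?_
      have hy : (0 : ℝ) < y := hy
      have e2 : ∀ r, ENNReal.ofReal (Real.exp x * Real.exp (-(r * x)))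
              * ENNReal.ofReal (y ^ σ * Real.exp (-(r * y)))
          = ENNReal.ofReal (y ^ σ * Real.exp x)
            * ENNReal.ofReal (Real.exp (-(r * (x + y)))) := by
        intro r
        rw [← ENNReal.ofReal_mul (by positivity), ← ENNReal.ofReal_mul (by positivity)]
        congr 1
        rw [mul_add, neg_add, Real.exp_add]; ring
      simp only [e2]
      rw [lintegral_const_mul _ (by fun_prop), lintegral_exp_Ioi_one (by linarith),
        ← ENNReal.ofReal_mul (by positivity)]
      congr 1
      rw [neg_add, Real.exp_add, Real.exp_neg x]
      have := (Real.exp_pos x).ne'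
      field_simp
    rw [e1, lintegral_lintegral_swap (Measurable.aemeasurable (by fun_prop))]
    have e3 : ∀ r ∈ Set.Ioi (1 : ℝ),
        ∫⁻ y in Set.Ioi (0 : ℝ), ENNReal.ofReal (Real.exp x * Real.exp (-(r * x)))
              * ENNReal.ofReal (y ^ σ * Real.exp (-(r * y)))
        = ENNReal.ofReal (Real.Gamma (σ + 1) * Real.exp x
            * (r ^ (-(σ + 1)) * Real.exp (-(r * x)))) := by
      intro r hr
      have hr0 : 0 < r := one_pos.trans hr
      rw [lintegral_const_mul _ (by fun_prop), lintegral_rpow_mul_exp hσ hr0,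
        ← ENNReal.ofReal_mul (by positivity)]
      congr 1; ring
    rw [setLIntegral_congr_fun measurableSet_Ioi e3, ← ofReal_integral_eq_lintegral_ofReal,
      integral_const_mul]
    · exact hint.const_mul _
    · filter_upwards [ae_restrict_mem measurableSet_Ioi] with r hr
      have : (0 : ℝ) < r := one_pos.trans hr
      positivity

/-! ### Biorthogonal systems and the Christoffel–Darboux kernel -/

theorem rpow_mul_rpow_pow {x : ℝ} (hx : 0 < x) (a θ : ℝ) (j : ℕ) :
    x ^ a * (x ^ θ) ^ j = x ^ (a + j * θ) := by
  rw [Real.rpow_add hx, mul_comm (j : ℝ) θ, Real.rpow_mul_natCast hx.le]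

/-- The ranges may exceed the degrees, so that one N × N Gram matrix serves all indices below N. -/
theorem pairing_eq_sum {θ a b : ℝ} (hθ : 0 < θ) (ha : -1 < a) (hb : -1 < b) (hab : -1 < a + b)
    (p q : Polynomial ℝ) {n m : ℕ} (hp : p.natDegree < n) (hq : q.natDegree < m) :
    pairing θ a b p q = ∑ j ∈ Finset.range n, ∑ k ∈ Finset.range m,
      p.coeff j * q.coeff k
        * (Real.Gamma (a + j * θ + 1) * Real.Gamma (b + k * θ + 1)
            / (a + j * θ + (b + k * θ) + 1)) := by
  have hj : ∀ j : ℕ, 0 ≤ j * θ := fun j => by positivity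
  have hm := fun j k : ℕ => bimoment (s := a + j * θ) (t := b + k * θ)
    (by linarith [hj j]) (by linarith [hj k]) (by linarith [hj j, hj k])
  have e : ∀ w ∈ Set.Ioi (0 : ℝ) ×ˢ Set.Ioi (0 : ℝ),
      Real.exp (-(w.1 + w.2)) / (w.1 + w.2) * w.1 ^ a * w.2 ^ b
        * p.eval (w.1 ^ θ) * q.eval (w.2 ^ θ)
      = ∑ j ∈ Finset.range n, ∑ k ∈ Finset.range m, p.coeff j * q.coeff k
        * (Real.exp (-(w.1 + w.2)) / (w.1 + w.2) * w.1 ^ (a + j * θ) * w.2 ^ (b + k * θ)) := by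
    rintro ⟨x, y⟩ ⟨hx, hy⟩
    simp only [Set.mem_Ioi] at hx hy
    simp only
    rw [Polynomial.eval_eq_sum_range' hp, Polynomial.eval_eq_sum_range' hq, mul_assoc,
      Finset.sum_mul_sum, Finset.mul_sum]
    refine Finset.sum_congr rfl fun j _ => ?_
    rw [Finset.mul_sum]
    refine Finset.sum_congr rfl fun k _ => ?_
    rw [← rpow_mul_rpow_pow hx, ← rpow_mul_rpow_pow hy]
    ring
  rw [pairing, setIntegral_congr_fun (measurableSet_Ioi.prod measurableSet_Ioi) e,
    integral_finsetSum _ fun j _ => integrable_finsetSum _ fun k _ => (hm j k).1.const_mul _]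
  refine Finset.sum_congr rfl fun j _ => ?_
  rw [integral_finsetSum _ fun k _ => (hm j k).1.const_mul _]
  refine Finset.sum_congr rfl fun k _ => ?_
  rw [integral_const_mul, (hm j k).2]

theorem exists_isBiorthogonal {θ a b : ℝ} (hθ : 0 < θ) (ha : -1 < a) (hb : -1 < b)
    (hab : -1 < a + b) : ∃ P Q : ℕ → Polynomial ℝ, IsBiorthogonal θ a b P Q := by
  set β : ℝ := (a + b + 1) / θ with hβ
  have hβ0 : 0 < β := div_pos (by linarith) hθ
  have hβi : ∀ i : ℕ, β + i ≠ 0 := fun i => by positivity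
  have hj : ∀ j : ℕ, 0 ≤ j * θ := fun j => by positivity
  have hΓ : ∀ c : ℝ, -1 < c → ∀ j : ℕ, 0 < Real.Gamma (c + j * θ + 1) := fun c hc j =>
    Real.Gamma_pos_of_pos (by linarith [hj j])
  -- Dividing by Γ(c + jθ + 1) cancels the Gamma factors of the bimoments and leaves the Cauchy
  -- matrix θ⁻¹/(β+j+k), which the Jacobi coefficients diagonalise.
  let R : ℝ → ℕ → Polynomial ℝ := fun c n => ∑ j ∈ Finset.range (n + 1),
    Polynomial.C (jacobiCoef β n j / Real.Gamma (c + j * θ + 1)) * Polynomial.X ^ j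
  have hcoeff : ∀ c n j, (R c n).coeff j
      = if j < n + 1 then jacobiCoef β n j / Real.Gamma (c + j * θ + 1) else 0 := by
    intro c n j
    simp only [R, Polynomial.finsetSum_coeff, Polynomial.coeff_C_mul_X_pow]
    rw [Finset.sum_ite_eq]
    simp only [Finset.mem_range]
  have hdeg : ∀ c, -1 < c → ∀ n, (R c n).natDegree = n := by
    intro c hc n
    refine le_antisymm ?_ (Polynomial.le_natDegree_of_ne_zero ?_)
    · rw [Polynomial.natDegree_le_iff_coeff_eq_zero]
      intro j hj
      rw [hcoeff, if_neg (by omega)]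
    · rw [hcoeff, if_pos (by omega)]
      exact div_ne_zero (jacobiCoef_self_ne_zero β n hβi) (hΓ c hc n).ne'
  refine ⟨R a, R b, hdeg a ha, hdeg b hb, fun n m => ?_⟩
  rw [pairing_eq_sum hθ ha hb hab (R a n) (R b m) (n := n + 1) (m := m + 1)
    (by rw [hdeg a ha]; omega) (by rw [hdeg b hb]; omega)]
  have e : ∀ j ∈ Finset.range (n + 1), ∀ k ∈ Finset.range (m + 1),
      (R a n).coeff j * (R b m).coeff k
        * (Real.Gamma (a + j * θ + 1) * Real.Gamma (b + k * θ + 1)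
            / (a + j * θ + (b + k * θ) + 1))
      = θ⁻¹ * (jacobiCoef β n j * jacobiCoef β m k / (β + j + k)) := by
    intro j hj' k hk'
    rw [hcoeff, hcoeff, if_pos (Finset.mem_range.1 hj'), if_pos (Finset.mem_range.1 hk')]
    have h1 := (hΓ a ha j).ne'
    have h2 := (hΓ b hb k).ne'
    have h3 : a + j * θ + (b + k * θ) + 1 = θ * (β + j + k) := by
      rw [hβ]; field_simp; ring
    have h4 : β + j + k ≠ 0 := by positivity
    rw [h3]
    generalize Real.Gamma (a + j * θ + 1) = g1 at *
    generalize Real.Gamma (b + k * θ + 1) = g2 at *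
    field_simp
  rw [Finset.sum_congr rfl fun j hj' => Finset.sum_congr rfl (e j hj')]
  simp only [← Finset.mul_sum]
  rw [sum_sum_jacobiCoef β n m hβi]
  split_ifs with hnm
  · have h5 : 2 * n * θ + a + b + 1 = θ * (β + 2 * n) := by rw [hβ]; field_simp; ring
    have h4 : β + 2 * n ≠ 0 := by positivity
    rw [h, h5]
    field_simp
  · simp

/-- Let P and Q be the coefficient matrices rescaled by the Gamma factors, D = diag(h_n), and H the
matrix 1/(β+j+k). Biorthogonality says D⁻¹PHQᵀ = 1, hence QᵀD⁻¹P = H⁻¹. The left side holds the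
coefficients of the kernel; the right side does not involve the chosen system. -/
theorem cdKernel_eq_sum {θ a b : ℝ} (hθ : 0 < θ) (ha : -1 < a) (hb : -1 < b) (hab : -1 < a + b)
    {P Q : ℕ → Polynomial ℝ} (hPQ : IsBiorthogonal θ a b P Q) (N : ℕ) (x y : ℝ) :
    cdKernel θ a b P Q N x y = ∑ j ∈ Finset.range N, ∑ k ∈ Finset.range N,
      θ * (coefA ((a + b + 1) / θ) N j * coefA ((a + b + 1) / θ) N k
          / ((a + b + 1) / θ + j + k))
        * ((x ^ θ) ^ j / Real.Gamma (a + j * θ + 1))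
        * ((y ^ θ) ^ k / Real.Gamma (b + k * θ + 1)) := by
  set β : ℝ := (a + b + 1) / θ with hβ
  have hβ0 : 0 < β := div_pos (by linarith) hθ
  have hβi : ∀ i : ℕ, β + i ≠ 0 := fun i => by positivity
  have hj : ∀ j : ℕ, 0 ≤ j * θ := fun j => by positivity
  have hΓ : ∀ c : ℝ, -1 < c → ∀ j : ℕ, Real.Gamma (c + j * θ + 1) ≠ 0 := fun c hc j =>
    (Real.Gamma_pos_of_pos (by linarith [hj j])).ne'
  have hh : ∀ n, h θ a b n ≠ 0 := fun n => by
    have : 2 * n * θ + a + b + 1 ≠ 0 := by nlinarith [hj n]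
    rw [h]; positivity
  let Pm : Matrix (Fin N) (Fin N) ℝ :=
    .of fun n j => (P n).coeff j * Real.Gamma (a + (j : ℕ) * θ + 1)
  let Qm : Matrix (Fin N) (Fin N) ℝ :=
    .of fun n j => (Q n).coeff j * Real.Gamma (b + (j : ℕ) * θ + 1)
  let Hm : Matrix (Fin N) (Fin N) ℝ := .of fun j k => 1 / (β + (j : ℕ) + (k : ℕ))
  let Cm : Matrix (Fin N) (Fin N) ℝ :=
    .of fun j k => coefA β N j * coefA β N k / (β + (j : ℕ) + (k : ℕ))
  let Di : Matrix (Fin N) (Fin N) ℝ := .diagonal fun n => (h θ a b n)⁻¹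
  have h1 : Di * Pm * Hm * Qm.transpose = 1 := by
    ext n m
    rw [Matrix.mul_assoc, Matrix.mul_assoc, Matrix.diagonal_mul, Matrix.mul_apply]
    have e := hPQ.pairing_eq n m
    rw [pairing_eq_sum hθ ha hb hab (P n) (Q m) (n := N) (m := N)
      (by rw [hPQ.natDegree_left]; exact n.2) (by rw [hPQ.natDegree_right]; exact m.2)] at e
    have e2 : ∑ j, Pm n j * (Hm * Qm.transpose) j m
        = θ * ∑ j ∈ Finset.range N, ∑ k ∈ Finset.range N, (P n).coeff j * (Q m).coeff k
        * (Real.Gamma (a + j * θ + 1) * Real.Gamma (b + k * θ + 1)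
            / (a + j * θ + (b + k * θ) + 1)) := by
      rw [Finset.mul_sum, Finset.sum_range]
      refine Finset.sum_congr rfl fun j _ => ?_
      rw [Matrix.mul_apply, Finset.mul_sum, Finset.sum_range, Finset.mul_sum]
      refine Finset.sum_congr rfl fun k _ => ?_
      simp only [Pm, Qm, Hm, Matrix.of_apply, Matrix.transpose_apply]
      have h3 : a + (j : ℕ) * θ + (b + (k : ℕ) * θ) + 1 = θ * (β + (j : ℕ) + (k : ℕ)) := by
        rw [hβ]; field_simp; ring
      have h4 : β + (j : ℕ) + (k : ℕ) ≠ 0 := by positivity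
      rw [h3]
      field_simp
    rw [e2, e, Matrix.one_apply]
    by_cases hnm : n = m
    · subst hnm
      simp only [if_true]
      have := hh n
      field_simp
    · have : (n : ℕ) ≠ m := fun hc => hnm (Fin.ext hc)
      simp [hnm, this]
  have h2 : Cm * Hm = 1 := by
    ext j l
    rw [Matrix.mul_apply, Matrix.one_apply]
    have := sum_coefA_mul_coefA β N j.2 l.2 hβi
    rw [Finset.sum_range] at this
    simp only [Cm, Hm, Matrix.of_apply, this, Fin.ext_iff]
  have h3 : Qm.transpose * Di * Pm = Cm := by
    -- For square matrices a left inverse is a right inverse, so the factors may be rotated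
    -- cyclically.
    have h4 : Qm.transpose * (Di * Pm * Hm) = 1 := mul_eq_one_comm.1 h1
    have h5 : Qm.transpose * Di * Pm * Hm = 1 := by rw [← h4]; simp only [Matrix.mul_assoc]
    calc Qm.transpose * Di * Pm = Qm.transpose * Di * Pm * (Hm * Cm) := by
          rw [mul_eq_one_comm.1 h2, Matrix.mul_one]
      _ = Cm := by rw [← Matrix.mul_assoc, h5, Matrix.one_mul]
  have h4 : ∀ j k : Fin N, ∑ n : Fin N, (h θ a b n)⁻¹ * (P n).coeff j * (Q n).coeff k
      = coefA β N j * coefA β N k / (β + (j : ℕ) + (k : ℕ))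
        / Real.Gamma (a + (j : ℕ) * θ + 1) / Real.Gamma (b + (k : ℕ) * θ + 1) := by
    intro j k
    have h5 : (Qm.transpose * Di * Pm) k j = Cm k j := by rw [h3]
    rw [Matrix.mul_assoc, Matrix.mul_apply] at h5
    simp only [Matrix.diagonal_mul, Qm, Pm, Cm, Di, Matrix.of_apply, Matrix.transpose_apply] at h5
    have h6 := hΓ a ha j
    have h7 := hΓ b hb k
    rw [eq_div_iff h7, eq_div_iff h6, add_right_comm β, mul_comm (coefA β N j), ← h5,
      Finset.sum_mul, Finset.sum_mul]
    exact Finset.sum_congr rfl fun n _ => by ring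
  have h5 : ∀ n ∈ Finset.range N, θ / h θ a b n * (P n).eval (x ^ θ) * (Q n).eval (y ^ θ)
      = ∑ j : Fin N, ∑ k : Fin N, θ * (x ^ θ) ^ (j : ℕ) * (y ^ θ) ^ (k : ℕ)
        * ((h θ a b n)⁻¹ * (P n).coeff j * (Q n).coeff k) := by
    intro n hn
    have hn := Finset.mem_range.1 hn
    rw [Polynomial.eval_eq_sum_range' (by rw [hPQ.natDegree_left]; exact hn),
      Polynomial.eval_eq_sum_range' (by rw [hPQ.natDegree_right]; exact hn), mul_assoc,
      Finset.sum_mul_sum, Finset.mul_sum, Finset.sum_range]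
    refine Finset.sum_congr rfl fun j _ => ?_
    rw [Finset.mul_sum, Finset.sum_range]
    exact Finset.sum_congr rfl fun k _ => by ring
  rw [cdKernel, Finset.sum_congr rfl h5, Finset.sum_range, Finset.sum_comm]
  conv_rhs => rw [Finset.sum_range]
  refine Finset.sum_congr rfl fun j _ => ?_
  rw [Finset.sum_comm]
  conv_rhs => rw [Finset.sum_range]
  refine Finset.sum_congr rfl fun k _ => ?_
  rw [← Finset.mul_sum, h4]
  ring

/-! ### Cauchy transforms of the monomials; the kernels as double sums -/

/-- `∫_1^∞ r^{-σ-1} e^{-r x} dr`. -/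
def expIntegral (σ x : ℝ) : ℝ := ∫ r in Set.Ioi (1 : ℝ), r ^ (-(σ + 1)) * Real.exp (-(r * x))

/-- The normalising Γ(b + kθ + 1) is exactly the Gamma factor produced by the Cauchy transform of
y^{b+kθ} e^{-y}. -/
theorem integral_pow_cauchy {θ b x : ℝ} (hθ : 0 < θ) (hb : -1 < b) (hx : 0 < x) (k : ℕ) :
    IntegrableOn (fun y : ℝ => (y ^ θ) ^ k / Real.Gamma (b + k * θ + 1) / (x + y) * y ^ b
      * Real.exp (-y)) (Set.Ioi 0) ∧
    ∫ y in Set.Ioi (0 : ℝ), (y ^ θ) ^ k / Real.Gamma (b + k * θ + 1) / (x + y) * y ^ b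
      * Real.exp (-y) = Real.exp x * expIntegral (b + k * θ) x := by
  have hk : 0 ≤ k * θ := by positivity
  have hG := (Real.Gamma_pos_of_pos (s := b + k * θ + 1) (by linarith)).ne'
  have h1 := cauchyTransform_weight (σ := b + k * θ) (by linarith) hx
  have e : ∀ y ∈ Set.Ioi (0 : ℝ), (Real.Gamma (b + k * θ + 1))⁻¹
        * (y ^ (b + k * θ) * Real.exp (-y) / (x + y))
      = (y ^ θ) ^ k / Real.Gamma (b + k * θ + 1) / (x + y) * y ^ b * Real.exp (-y) := by
    intro y hy
    rw [← rpow_mul_rpow_pow hy]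
    ring
  refine ⟨IntegrableOn.congr_fun (h1.1.const_mul _) e measurableSet_Ioi, ?_⟩
  rw [← setIntegral_congr_fun measurableSet_Ioi e, integral_const_mul, h1.2, expIntegral,
    mul_assoc, inv_mul_cancel_left₀ hG]

theorem integral_sum_sum_const_mul {X : Type*} [MeasurableSpace X] {μ : Measure X} (N : ℕ)
    (c : ℕ → ℕ → ℝ) {f : ℕ → ℕ → X → ℝ} (hf : ∀ j k, Integrable (f j k) μ) :
    ∫ x, ∑ j ∈ Finset.range N, ∑ k ∈ Finset.range N, c j k * f j k x ∂μ
      = ∑ j ∈ Finset.range N, ∑ k ∈ Finset.range N, c j k * ∫ x, f j k x ∂μ := by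
  rw [integral_finsetSum _ fun j _ => integrable_finsetSum _ fun k _ => (hf j k).const_mul _]
  refine Finset.sum_congr rfl fun j _ => ?_
  rw [integral_finsetSum _ fun k _ => (hf j k).const_mul _]
  exact Finset.sum_congr rfl fun k _ => integral_const_mul _ _

/-- The transform acts term by term on the double sum of `cdKernel_eq_sum`. It replaces normalised
monomials by exponential integrals in the second variable here, in the first for K₁₀, and in both
for K₁₁. -/
theorem K01_eq_sum {θ a b : ℝ} (hθ : 0 < θ) (ha : -1 < a) (hb : -1 < b) (hab : -1 < a + b)
    {P Q : ℕ → Polynomial ℝ} (hPQ : IsBiorthogonal θ a b P Q) (N : ℕ) (x : ℝ) {x' : ℝ}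
    (hx' : 0 < x') :
    K01 θ a b P Q N x x' = ∑ j ∈ Finset.range N, ∑ k ∈ Finset.range N,
      θ * (coefA ((a + b + 1) / θ) N j * coefA ((a + b + 1) / θ) N k
          / ((a + b + 1) / θ + j + k))
        * ((x ^ θ) ^ j / Real.Gamma (a + j * θ + 1))
        * (Real.exp x' * expIntegral (b + k * θ) x') := by
  have hk := fun k => integral_pow_cauchy hθ hb hx' k
  have h1 := integral_sum_sum_const_mul N (fun j k => θ * (coefA ((a + b + 1) / θ) N j
    * coefA ((a + b + 1) / θ) N k / ((a + b + 1) / θ + j + k))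
    * ((x ^ θ) ^ j / Real.Gamma (a + j * θ + 1))) fun _ k => (hk k).1
  simp only [fun k => (hk k).2] at h1
  rw [← h1, K01]
  congr 1 with y
  simp only [cdKernel_eq_sum hθ ha hb hab hPQ, Finset.sum_div, Finset.sum_mul]
  exact Finset.sum_congr rfl fun j _ => Finset.sum_congr rfl fun k _ => by ring

theorem K10_eq_sum {θ a b : ℝ} (hθ : 0 < θ) (ha : -1 < a) (hb : -1 < b) (hab : -1 < a + b)
    {P Q : ℕ → Polynomial ℝ} (hPQ : IsBiorthogonal θ a b P Q) (N : ℕ) {y : ℝ} (y' : ℝ)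
    (hy : 0 < y) :
    K10 θ a b P Q N y y' = ∑ j ∈ Finset.range N, ∑ k ∈ Finset.range N,
      θ * (coefA ((a + b + 1) / θ) N j * coefA ((a + b + 1) / θ) N k
          / ((a + b + 1) / θ + j + k))
        * (Real.exp y * expIntegral (a + j * θ) y)
        * ((y' ^ θ) ^ k / Real.Gamma (b + k * θ + 1)) := by
  have hk := fun k => integral_pow_cauchy hθ ha hy k
  have h1 := integral_sum_sum_const_mul N (fun j k => θ * (coefA ((a + b + 1) / θ) N j
    * coefA ((a + b + 1) / θ) N k / ((a + b + 1) / θ + j + k))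
    * ((y' ^ θ) ^ k / Real.Gamma (b + k * θ + 1))) fun j _ => (hk j).1
  simp only [fun k => (hk k).2] at h1
  trans
  swap
  · exact h1.trans (Finset.sum_congr rfl fun j _ => Finset.sum_congr rfl fun k _ => by ring)
  rw [K10]
  congr 1 with x
  simp only [cdKernel_eq_sum hθ ha hb hab hPQ, Finset.sum_div, Finset.sum_mul, add_comm x y]
  exact Finset.sum_congr rfl fun j _ => Finset.sum_congr rfl fun k _ => by ring

theorem K11_eq_sum {θ a b : ℝ} (hθ : 0 < θ) (ha : -1 < a) (hb : -1 < b) (hab : -1 < a + b)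
    {P Q : ℕ → Polynomial ℝ} (hPQ : IsBiorthogonal θ a b P Q) (N : ℕ) {y x : ℝ}
    (hy : 0 < y) (hx : 0 < x) :
    K11 θ a b P Q N y x = (∑ j ∈ Finset.range N, ∑ k ∈ Finset.range N,
      θ * (coefA ((a + b + 1) / θ) N j * coefA ((a + b + 1) / θ) N k
          / ((a + b + 1) / θ + j + k))
        * (Real.exp y * expIntegral (a + j * θ) y)
        * (Real.exp x * expIntegral (b + k * θ) x)) - 1 / (x + y) := by
  have hj := fun k => integral_pow_cauchy hθ ha hy k
  have hk := fun k => integral_pow_cauchy hθ hb hx k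
  have h2 : ∀ j k : ℕ, Integrable (fun w : ℝ × ℝ =>
      ((w.1 ^ θ) ^ j / Real.Gamma (a + j * θ + 1) / (y + w.1) * w.1 ^ a * Real.exp (-w.1))
      * ((w.2 ^ θ) ^ k / Real.Gamma (b + k * θ + 1) / (x + w.2) * w.2 ^ b * Real.exp (-w.2)))
      ((volume.restrict (Set.Ioi (0 : ℝ))).prod (volume.restrict (Set.Ioi (0 : ℝ)))) ∧
      ∫ w, ((w.1 ^ θ) ^ j / Real.Gamma (a + j * θ + 1) / (y + w.1) * w.1 ^ a * Real.exp (-w.1))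
      * ((w.2 ^ θ) ^ k / Real.Gamma (b + k * θ + 1) / (x + w.2) * w.2 ^ b * Real.exp (-w.2))
        ∂((volume.restrict (Set.Ioi (0 : ℝ))).prod (volume.restrict (Set.Ioi (0 : ℝ))))
      = (Real.exp y * expIntegral (a + j * θ) y) * (Real.exp x * expIntegral (b + k * θ) x) := by
    intro j k
    refine ⟨(hj j).1.mul_prod (hk k).1, ?_⟩
    rw [← (hj j).2, ← (hk k).2]
    exact integral_prod_mul (μ := volume.restrict (Set.Ioi (0 : ℝ)))
      (ν := volume.restrict (Set.Ioi (0 : ℝ)))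
      (fun x : ℝ => (x ^ θ) ^ j / Real.Gamma (a + j * θ + 1) / (y + x) * x ^ a * Real.exp (-x))
      (fun y : ℝ => (y ^ θ) ^ k / Real.Gamma (b + k * θ + 1) / (x + y) * y ^ b * Real.exp (-y))
  have h1 := integral_sum_sum_const_mul N (fun j k => θ * (coefA ((a + b + 1) / θ) N j
    * coefA ((a + b + 1) / θ) N k / ((a + b + 1) / θ + j + k))) fun j k => (h2 j k).1
  simp only [fun j k => (h2 j k).2] at h1
  rw [K11, volume_restrict_quadrant]
  congr 1
  trans
  swap
  · exact h1.trans (Finset.sum_congr rfl fun j _ => Finset.sum_congr rfl fun k _ => by ring)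
  congr 1 with w
  simp only [cdKernel_eq_sum hθ ha hb hab hPQ, Finset.sum_div, Finset.sum_mul, add_comm w.1 y,
    neg_add, Real.exp_add]
  refine Finset.sum_congr rfl fun j _ => Finset.sum_congr rfl fun k _ => ?_
  rw [← div_div]
  ring

/-! ### The functions with Mellin transforms `Γ(θu - κ)` and `Γ(θu - κ) / (u + k)` -/

/-- The function with Mellin transform `Γ(θu - κ)`. -/
def expFun (θ κ z : ℝ) : ℝ := θ⁻¹ * z ^ (-(κ / θ)) * Real.exp (-z ^ θ⁻¹)

/-- The function with Mellin transform `Γ(θu - κ) / (u + k)`. -/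
def tailFun (θ κ : ℝ) (k : ℕ) (z : ℝ) : ℝ :=
  z ^ k * ∫ v in Set.Ioi z, v ^ (-(k : ℝ) - 1) * expFun θ κ v

theorem expFun_nonneg {θ : ℝ} (hθ : 0 < θ) (κ : ℝ) {z : ℝ} (hz : 0 < z) : 0 ≤ expFun θ κ z := by
  unfold expFun; positivity

theorem continuousOn_expFun (θ κ : ℝ) : ContinuousOn (expFun θ κ) (Set.Ioi 0) := by
  intro z hz
  have hz : (0 : ℝ) < z := hz
  refine ContinuousAt.continuousWithinAt ?_
  have h1 := Real.continuousAt_rpow_const z (-(κ / θ)) (Or.inl hz.ne')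
  have h2 := Real.continuousAt_rpow_const z θ⁻¹ (Or.inl hz.ne')
  exact (continuousAt_const.mul h1).mul h2.neg.rexp

theorem rpow_mul_exp_neg_le {p : ℝ} (hp : 0 ≤ p) :
    ∃ C, 0 ≤ C ∧ ∀ w : ℝ, 0 < w → w ^ p * Real.exp (-w) ≤ C := by
  obtain ⟨n, hn⟩ := exists_nat_ge p
  refine ⟨1 + n.factorial, by positivity, fun w hw => ?_⟩
  have h1 : w ^ p ≤ 1 + w ^ n := by
    rcases le_total w 1 with h | h
    · have := Real.rpow_le_one hw.le h hp
      have : 0 ≤ w ^ n := by positivity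
      linarith
    · have := Real.rpow_le_rpow_of_exponent_le h hn
      rw [Real.rpow_natCast] at this
      linarith
  have h2 := Real.pow_div_factorial_le_exp w hw.le n
  have h3 : (0 : ℝ) < n.factorial := by positivity
  rw [div_le_iff₀ h3] at h2
  rw [Real.exp_neg, ← div_eq_mul_inv, div_le_iff₀ (Real.exp_pos w)]
  have h4 := Real.one_le_exp hw.le
  nlinarith

/-- With w = z^{1/θ}, z^c times the function is θ⁻¹ w^{θc-κ} e^{-w}, which is bounded. The bound
holds on all of (0, ∞) for every c > κ/θ, so varying c controls both ends of a Mellin integral. -/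
theorem expFun_le {θ κ c : ℝ} (hθ : 0 < θ) (hc : κ / θ < c) :
    ∃ C, 0 ≤ C ∧ ∀ z : ℝ, 0 < z → |expFun θ κ z| ≤ C * z ^ (-c) := by
  have hp : 0 ≤ θ * c - κ := by
    rw [div_lt_iff₀ hθ] at hc; linarith
  obtain ⟨C, hC0, hC⟩ := rpow_mul_exp_neg_le hp
  refine ⟨θ⁻¹ * C, by positivity, fun z hz => ?_⟩
  rw [abs_of_nonneg (expFun_nonneg hθ κ hz)]
  have h1 := hC (z ^ θ⁻¹) (by positivity)
  rw [← Real.rpow_mul hz.le, show θ⁻¹ * (θ * c - κ) = c + -(κ / θ) by field_simp; ring,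
    Real.rpow_add hz] at h1
  have h2 : z ^ (-c) * z ^ c = 1 := by rw [← Real.rpow_add hz]; simp
  calc expFun θ κ z = θ⁻¹ * (z ^ c * z ^ (-(κ / θ)) * Real.exp (-z ^ θ⁻¹)) * z ^ (-c) := by
        rw [expFun]; linear_combination -(θ⁻¹ * z ^ (-(κ / θ)) * Real.exp (-z ^ θ⁻¹)) * h2
    _ ≤ θ⁻¹ * C * z ^ (-c) := by gcongr

theorem integral_rpow_mul_expFun {θ κ c : ℝ} (hθ : 0 < θ) (hc : κ / θ < c) :
    IntegrableOn (fun v : ℝ => v ^ (c - 1) * expFun θ κ v) (Set.Ioi 0) ∧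
    ∫ v in Set.Ioi (0 : ℝ), v ^ (c - 1) * expFun θ κ v = Real.Gamma (θ * c - κ) := by
  have hp : 0 < θ * c - κ := by rw [div_lt_iff₀ hθ] at hc; linarith
  have h1 := integral_rpow_mul_exp_neg_rpow (p := θ⁻¹) (q := c - 1 - κ / θ) (by positivity)
    (by linarith)
  have h2 : ∫ v in Set.Ioi (0 : ℝ), v ^ (c - 1) * expFun θ κ v = Real.Gamma (θ * c - κ) := by
    have e : ∀ v ∈ Set.Ioi (0 : ℝ), v ^ (c - 1) * expFun θ κ v
        = θ⁻¹ * (v ^ (c - 1 - κ / θ) * Real.exp (-v ^ θ⁻¹)) := by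
      intro v hv
      rw [expFun, sub_eq_add_neg (c - 1) (κ / θ), Real.rpow_add hv]; ring
    rw [setIntegral_congr_fun measurableSet_Ioi e, integral_const_mul, h1]
    rw [show (c - 1 - κ / θ + 1) / θ⁻¹ = θ * c - κ by field_simp; ring]
    field_simp
  exact ⟨integrable_of_integral_pos (by rw [h2]; exact Real.Gamma_pos_of_pos hp), h2⟩

/-- This is (z/v)^{k+c} ≤ 1 rearranged. It trades the kernel depending on k for the Mellin kernel
v^{c-1}. -/
theorem rpow_tail_le {c z v : ℝ} (k : ℕ) (hc : 0 ≤ c) (hz : 0 < z) (hv : z < v) :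
    z ^ k * v ^ (-(k : ℝ) - 1) ≤ z ^ (-c) * v ^ (c - 1) := by
  have hv0 := hz.trans hv
  have h1 : z ^ (k + c) ≤ v ^ (k + c) := Real.rpow_le_rpow hz.le hv.le (by positivity)
  calc z ^ k * v ^ (-(k : ℝ) - 1) = z ^ (k + c) * (z ^ (-c) * v ^ (-(k : ℝ) - 1)) := by
        rw [← mul_assoc, ← Real.rpow_add hz, add_neg_cancel_right, Real.rpow_natCast]
    _ ≤ v ^ (k + c) * (z ^ (-c) * v ^ (-(k : ℝ) - 1)) := by gcongr
    _ = z ^ (-c) * (v ^ (k + c) * v ^ (-(k : ℝ) - 1)) := by ring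
    _ = z ^ (-c) * v ^ (c - 1) := by
        rw [← Real.rpow_add hv0]; congr 2; ring

theorem integrableOn_tail {θ κ z : ℝ} (hθ : 0 < θ) (k : ℕ) (hz : 0 < z) :
    IntegrableOn (fun v : ℝ => v ^ (-(k : ℝ) - 1) * expFun θ κ v) (Set.Ioi z) := by
  set c : ℝ := max 0 (κ / θ) + 1 with hc
  have hc0 : 0 ≤ c := by have := le_max_left 0 (κ / θ); linarith
  have hc1 : κ / θ < c := by have := le_max_right 0 (κ / θ); linarith
  have hsub : Set.Ioi z ⊆ Set.Ioi (0 : ℝ) := Set.Ioi_subset_Ioi hz.le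
  have h1 := ((integral_rpow_mul_expFun hθ hc1).1.mono_set hsub).const_mul
    ((z ^ k)⁻¹ * z ^ (-c))
  refine h1.mono' ?_ ?_
  · refine ContinuousOn.aestronglyMeasurable ?_ measurableSet_Ioi
    refine ContinuousOn.mul (fun v hv => ?_) ((continuousOn_expFun θ κ).mono hsub)
    exact (Real.continuousAt_rpow_const v _ (Or.inl (hz.trans hv).ne')).continuousWithinAt
  · filter_upwards [ae_restrict_mem measurableSet_Ioi] with v hv
    have hv : z < v := hv
    have hv0 := hz.trans hv
    have he := expFun_nonneg hθ κ hv0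
    rw [Real.norm_of_nonneg (by positivity)]
    have h2 := rpow_tail_le k hc0 hz hv
    have h3 : v ^ (-(k : ℝ) - 1) ≤ (z ^ k)⁻¹ * z ^ (-c) * v ^ (c - 1) := by
      rw [mul_assoc, ← div_eq_inv_mul, le_div_iff₀ (by positivity), mul_comm]; exact h2
    calc v ^ (-(k : ℝ) - 1) * expFun θ κ v
        ≤ (z ^ k)⁻¹ * z ^ (-c) * v ^ (c - 1) * expFun θ κ v := by gcongr
      _ = _ := by ring

theorem tailFun_nonneg {θ κ z : ℝ} (hθ : 0 < θ) (k : ℕ) (hz : 0 < z) : 0 ≤ tailFun θ κ k z := by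
  refine mul_nonneg (by positivity) (setIntegral_nonneg measurableSet_Ioi fun v hv => ?_)
  have hv0 : 0 < v := hz.trans hv
  have := expFun_nonneg hθ κ hv0
  positivity

/-- After `rpow_tail_le` the tail is at most z^{-c} times the full Mellin integral of `expFun` at c,
whatever k is. -/
theorem tailFun_le {θ κ c z : ℝ} (hθ : 0 < θ) (hc0 : 0 ≤ c) (hc : κ / θ < c) (k : ℕ)
    (hz : 0 < z) : |tailFun θ κ k z| ≤ Real.Gamma (θ * c - κ) * z ^ (-c) := by
  have hsub : Set.Ioi z ⊆ Set.Ioi (0 : ℝ) := Set.Ioi_subset_Ioi hz.le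
  have hI := integral_rpow_mul_expFun hθ hc
  rw [abs_of_nonneg (tailFun_nonneg hθ k hz), tailFun, ← integral_const_mul]
  calc ∫ v in Set.Ioi z, z ^ k * (v ^ (-(k : ℝ) - 1) * expFun θ κ v)
      ≤ ∫ v in Set.Ioi z, z ^ (-c) * (v ^ (c - 1) * expFun θ κ v) := by
        refine setIntegral_mono_on ((integrableOn_tail hθ k hz).const_mul _)
          ((hI.1.mono_set hsub).const_mul _) measurableSet_Ioi fun v hv => ?_
        have hv0 : 0 < v := hz.trans hv
        have he := expFun_nonneg hθ κ hv0
        rw [← mul_assoc, ← mul_assoc]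
        exact mul_le_mul_of_nonneg_right (rpow_tail_le k hc0 hz hv) he
    _ = z ^ (-c) * ∫ v in Set.Ioi z, v ^ (c - 1) * expFun θ κ v := integral_const_mul _ _
    _ ≤ z ^ (-c) * ∫ v in Set.Ioi 0, v ^ (c - 1) * expFun θ κ v := by
        refine mul_le_mul_of_nonneg_left (setIntegral_mono_set hI.1 ?_ hsub.eventuallyLE)
          (by positivity)
        filter_upwards [ae_restrict_mem measurableSet_Ioi] with v hv
        have hv0 : (0 : ℝ) < v := hv
        have he := expFun_nonneg hθ κ hv0
        positivity
    _ = _ := by rw [hI.2, mul_comm]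

/-- The relation z u' = k u - e, which z^k satisfies with e = 0. Through it the products of these
functions are integrated over [0, 1]. -/
theorem hasDerivAt_tailFun {θ κ z : ℝ} (hθ : 0 < θ) (k : ℕ) (hz : 0 < z) :
    HasDerivAt (tailFun θ κ k) ((k * tailFun θ κ k z - expFun θ κ z) / z) z := by
  set g : ℝ → ℝ := fun v => v ^ (-(k : ℝ) - 1) * expFun θ κ v with hg
  have hgc : ContinuousOn g (Set.Ioi 0) := by
    refine ContinuousOn.mul (fun v hv => ?_) (continuousOn_expFun θ κ)
    exact (Real.continuousAt_rpow_const v _ (Or.inl (ne_of_gt hv))).continuousWithinAt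
  -- Near z the tail integral is a constant minus the integral from the fixed base point z/2, to
  -- which the fundamental theorem of calculus applies.
  have h2 : (0 : ℝ) < z / 2 := by positivity
  have hint := integrableOn_tail (κ := κ) hθ k h2
  have hd : HasDerivAt (fun x => ∫ v in Set.Ioi x, g v) (-g z) z := by
    have h3 : HasDerivAt (fun x => ∫ v in (z / 2)..x, g v) (g z) z := by
      refine intervalIntegral.integral_hasDerivAt_right ?_ ?_ ?_
      · rw [intervalIntegrable_iff_integrableOn_Ioc_of_le (by linarith)]
        exact hint.mono_set Set.Ioc_subset_Ioi_self
      · exact hgc.stronglyMeasurableAtFilter isOpen_Ioi z hz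
      · exact hgc.continuousAt (Ioi_mem_nhds hz)
    have h4 := h3.const_sub (∫ v in Set.Ioi (z / 2), g v)
    refine h4.congr_of_eventuallyEq ?_
    filter_upwards [Ioi_mem_nhds (show z / 2 < z by linarith)] with x hx
    rw [← intervalIntegral.integral_Ioi_sub_Ioi hint (le_of_lt hx)]
    simp only [sub_sub_cancel, hg]
  have h5 := (hasDerivAt_pow k z).mul hd
  refine h5.congr_deriv ?_
  rw [tailFun]
  have hgz : z ^ k * g z = expFun θ κ z / z := by
    simp only [hg]
    rw [← Real.rpow_natCast, ← mul_assoc, ← Real.rpow_add hz,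
      show (k : ℝ) + (-(k : ℝ) - 1) = -1 by ring, Real.rpow_neg_one]
    field_simp
  have hk : (k : ℝ) * z ^ (k - 1) = k * z ^ k / z := by
    rcases k with _ | k
    · simp
    · rw [Nat.add_sub_cancel, pow_succ]; field_simp
  rw [mul_neg, hgz, hk]
  ring

/-- The substitutions v = s^θ and s = x r. This identifies the functions coming from the loop
integrals with the Cauchy transforms in the kernels. -/
theorem tailFun_rpow {θ κ x : ℝ} (hθ : 0 < θ) (k : ℕ) (hx : 0 < x) :
    tailFun θ κ k (x ^ θ) = x ^ (-κ) * expIntegral (κ + k * θ) x := by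
  have hxθ : 0 < x ^ θ := by positivity
  have h1 : ∫ v in Set.Ioi (x ^ θ), v ^ (-(k : ℝ) - 1) * expFun θ κ v
      = ∫ s in Set.Ioi x, s ^ (-(κ + k * θ + 1)) * Real.exp (-s) := by
    have h2 := integral_comp_rpow_Ioi (fun v => (Set.Ioi (x ^ θ)).indicator
      (fun v => v ^ (-(k : ℝ) - 1) * expFun θ κ v) v) hθ.ne'
    rw [setIntegral_indicator measurableSet_Ioi, Set.inter_eq_self_of_subset_right
      (Set.Ioi_subset_Ioi hxθ.le)] at h2
    rw [← h2]
    have h3 : ∀ s ∈ Set.Ioi (0 : ℝ), (|θ| * s ^ (θ - 1)) • (Set.Ioi (x ^ θ)).indicator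
        (fun v => v ^ (-(k : ℝ) - 1) * expFun θ κ v) (s ^ θ)
        = (Set.Ioi x).indicator (fun s => s ^ (-(κ + k * θ + 1)) * Real.exp (-s)) s := by
      intro s hs
      have hs : (0 : ℝ) < s := hs
      by_cases hxs : x < s
      · rw [Set.indicator_of_mem (Set.mem_Ioi.2 hxs), Set.indicator_of_mem
          (Set.mem_Ioi.2 (Real.rpow_lt_rpow hx.le hxs hθ)), abs_of_pos hθ, smul_eq_mul, expFun,
          ← Real.rpow_mul hs.le, ← Real.rpow_mul hs.le, ← Real.rpow_mul hs.le,
          mul_inv_cancel₀ hθ.ne', Real.rpow_one,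
          show -(κ + k * θ + 1) = (θ - 1) + θ * (-(k : ℝ) - 1) + θ * -(κ / θ) by
            field_simp; ring, Real.rpow_add hs, Real.rpow_add hs]
        field_simp
      · rw [not_lt] at hxs
        rw [Set.indicator_of_notMem, Set.indicator_of_notMem, smul_zero]
        · exact not_lt.2 hxs
        · exact not_lt.2 (Real.rpow_le_rpow hs.le hxs hθ.le)
    rw [setIntegral_congr_fun measurableSet_Ioi h3, setIntegral_indicator measurableSet_Ioi,
      Set.inter_eq_self_of_subset_right (Set.Ioi_subset_Ioi hx.le)]
  have h4 := integral_comp_mul_left_Ioi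
    (fun s => s ^ (-(κ + k * θ + 1)) * Real.exp (-s)) 1 hx
  rw [mul_one] at h4
  have h5 : ∀ r ∈ Set.Ioi (1 : ℝ), (x * r) ^ (-(κ + k * θ + 1)) * Real.exp (-(x * r))
      = x ^ (-(κ + k * θ + 1)) * (r ^ (-(κ + k * θ + 1)) * Real.exp (-(r * x))) := by
    intro r hr
    have : (0 : ℝ) < r := one_pos.trans hr
    rw [Real.mul_rpow hx.le this.le, mul_comm x r]; ring
  rw [setIntegral_congr_fun measurableSet_Ioi h5, integral_const_mul, smul_eq_mul] at h4
  rw [tailFun, h1, expIntegral, ← Real.rpow_mul_natCast hx.le]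
  rw [eq_inv_mul_iff_mul_eq₀ hx.ne'] at h4
  rw [← h4, show -κ = θ * k + 1 + -(κ + k * θ + 1) by ring, Real.rpow_add hx, Real.rpow_add hx,
    Real.rpow_one]
  ring

/-! ### Mellin transforms -/

/-- An exponent between c₀ and Re u controls the origin, and Re u + 1 controls infinity. -/
theorem mellinConvergent_of_forall_le {f : ℝ → ℂ} {c₀ : ℝ} (hf : ContinuousOn f (Set.Ioi 0))
    (hb : ∀ c, c₀ < c → ∃ C, ∀ z : ℝ, 0 < z → ‖f z‖ ≤ C * z ^ (-c)) {u : ℂ} (hu : c₀ < u.re) :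
    MellinConvergent f u := by
  obtain ⟨c, hc1, hc2⟩ := exists_between hu
  obtain ⟨C1, h1⟩ := hb c hc1
  obtain ⟨C2, h2⟩ := hb (u.re + 1) (by linarith)
  refine mellinConvergent_of_isBigO_rpow (hf.locallyIntegrableOn measurableSet_Ioi)
    (a := u.re + 1) (b := c) ?_ (by linarith) ?_ hc2
  · refine Asymptotics.IsBigO.of_bound C2 ?_
    filter_upwards [eventually_gt_atTop 0] with z hz
    rw [Real.norm_of_nonneg (by positivity)]
    exact h2 z hz
  · refine Asymptotics.IsBigO.of_bound C1 ?_
    filter_upwards [self_mem_nhdsWithin] with z hz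
    have hz : (0 : ℝ) < z := hz
    rw [Real.norm_of_nonneg (by positivity)]
    exact h1 z hz

theorem mellinConvergent_expFun {θ κ : ℝ} (hθ : 0 < θ) {u : ℂ} (hu : κ / θ < u.re) :
    MellinConvergent (fun z => (expFun θ κ z : ℂ)) u := by
  refine mellinConvergent_of_forall_le
    (Complex.continuous_ofReal.comp_continuousOn (continuousOn_expFun θ κ)) (fun c hc => ?_) hu
  obtain ⟨C, -, hC⟩ := expFun_le hθ hc
  exact ⟨C, fun z hz => by simpa using hC z hz⟩

/-- In the variable w = z^{1/θ} the function is θ⁻¹ w^{-κ} e^{-w}, so this is Euler's integral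
rescaled and shifted. -/
theorem mellin_expFun {θ κ : ℝ} (hθ : 0 < θ) {u : ℂ} (hu : κ / θ < u.re) :
    mellin (fun z => (expFun θ κ z : ℂ)) u = Complex.Gamma (θ * u - κ) := by
  have h1 : mellin (fun z => (expFun θ κ z : ℂ)) u
      = mellin (fun z : ℝ => (fun w : ℝ => (θ⁻¹ : ℂ) • ((w : ℂ) ^ (-κ : ℂ) • (Real.exp (-w) : ℂ)))
          (z ^ θ⁻¹)) u := by
    refine setIntegral_congr_fun measurableSet_Ioi fun z hz => ?_
    have hz : (0 : ℝ) < z := hz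
    simp only [smul_eq_mul]
    congr 1
    have h2 : ((z ^ θ⁻¹ : ℝ) : ℂ) ^ (-κ : ℂ) = ((z ^ (-(κ / θ)) : ℝ) : ℂ) := by
      rw [← Complex.ofReal_neg, ← Complex.ofReal_cpow (by positivity), ← Real.rpow_mul hz.le]
      congr 2; field_simp
    rw [h2, expFun]
    push_cast
    ring
  rw [h1, mellin_comp_rpow (fun w : ℝ => (θ⁻¹ : ℂ) • ((w : ℂ) ^ (-κ : ℂ) • (Real.exp (-w) : ℂ))),
    mellin_const_smul, mellin_cpow_smul, abs_of_pos (by positivity),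
    inv_inv, Complex.Gamma_eq_integral, Complex.GammaIntegral_eq_mellin]
  · rw [Complex.real_smul, smul_eq_mul, ← mul_assoc, mul_inv_cancel₀ (by exact_mod_cast hθ.ne'),
      one_mul]
    congr 1
    push_cast
    rw [div_inv_eq_mul]; ring
  · rw [div_lt_iff₀ hθ] at hu
    simp only [Complex.sub_re, Complex.mul_re, Complex.ofReal_re, Complex.ofReal_im, zero_mul,
      sub_zero]
    linarith

theorem continuousOn_tailFun {θ κ : ℝ} (hθ : 0 < θ) (k : ℕ) :
    ContinuousOn (tailFun θ κ k) (Set.Ioi 0) := fun _ hz =>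
  (hasDerivAt_tailFun hθ k hz).continuousAt.continuousWithinAt

theorem mellinConvergent_tailFun {θ κ : ℝ} (hθ : 0 < θ) (k : ℕ) {u : ℂ}
    (hu : max 0 (κ / θ) < u.re) :
    MellinConvergent (fun z => (tailFun θ κ k z : ℂ)) u := by
  refine mellinConvergent_of_forall_le
    (Complex.continuous_ofReal.comp_continuousOn (continuousOn_tailFun hθ k)) (fun c hc => ?_) hu
  exact ⟨_, fun z hz => by
    simpa using tailFun_le hθ ((le_max_left _ _).trans hc.le) ((le_max_right _ _).trans_lt hc) k hz⟩

/-- The derivative of z^u u_k(z) is (u+k) z^{u-1} u_k - z^{u-1} e. Integrating it over (0, ∞) gives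
the formula, the boundary terms vanishing by `tailFun_le` with exponents on the two sides of Re u.
-/
theorem mellin_tailFun {θ κ : ℝ} (hθ : 0 < θ) (k : ℕ) {u : ℂ} (hu : max 0 (κ / θ) < u.re) :
    mellin (fun z => (tailFun θ κ k z : ℂ)) u = Complex.Gamma (θ * u - κ) / (u + k) := by
  have hu0 : 0 < u.re := (le_max_left _ _).trans_lt hu
  have huκ : κ / θ < u.re := (le_max_right _ _).trans_lt hu
  have hune : u ≠ 0 := fun h => by simp [h] at hu0
  have hbound : ∀ c, max 0 (κ / θ) < c → ∀ z : ℝ, 0 < z →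
      ‖(z : ℂ) ^ u * tailFun θ κ k z‖ ≤ Real.Gamma (θ * c - κ) * z ^ (u.re - c) := by
    intro c hc z hz
    rw [norm_mul, Complex.norm_cpow_eq_rpow_re_of_pos hz, Complex.norm_real, Real.norm_eq_abs,
      sub_eq_add_neg u.re, Real.rpow_add hz]
    have := tailFun_le (κ := κ) hθ ((le_max_left _ _).trans hc.le)
      ((le_max_right _ _).trans_lt hc) k hz
    calc z ^ u.re * |tailFun θ κ k z| ≤ z ^ u.re * (Real.Gamma (θ * c - κ) * z ^ (-c)) := by gcongr
      _ = _ := by ring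
  have h1 := integral_Ioi_of_hasDerivAt_of_tendsto
    (f := fun z : ℝ => (z : ℂ) ^ u * tailFun θ κ k z)
    (f' := fun z : ℝ => (u + k) * ((z : ℂ) ^ (u - 1) • (tailFun θ κ k z : ℂ))
      - (z : ℂ) ^ (u - 1) • (expFun θ κ z : ℂ)) (a := 0) (m := 0) ?_ ?_ ?_ ?_
  · rw [integral_sub ((mellinConvergent_tailFun hθ k hu).const_mul _)
      (mellinConvergent_expFun hθ huκ), integral_const_mul] at h1
    have h2 : (u + k) * mellin (fun z => (tailFun θ κ k z : ℂ)) u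
        - mellin (fun z => (expFun θ κ z : ℂ)) u = 0 := by
      rw [mellin, mellin, h1]; simp [Complex.zero_cpow hune]
    rw [mellin_expFun hθ huκ] at h2
    have h3 : u + k ≠ 0 := fun h => by
      have := congrArg Complex.re h
      simp at this
      have : (0 : ℝ) ≤ k := by positivity
      linarith
    rw [eq_div_iff h3]; linear_combination h2
  · obtain ⟨c, hc1, hc2⟩ := exists_between hu
    rw [ContinuousWithinAt, Complex.ofReal_zero, Complex.zero_cpow hune, zero_mul]
    rw [tendsto_zero_iff_norm_tendsto_zero]
    have h4 : Tendsto (fun z : ℝ => Real.Gamma (θ * c - κ) * z ^ (u.re - c))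
        (𝓝[Set.Ici 0] 0) (𝓝 0) := by
      have := (Real.continuousAt_rpow_const 0 (u.re - c) (Or.inr (by linarith))).const_mul
        (Real.Gamma (θ * c - κ))
      rw [ContinuousAt, Real.zero_rpow (by linarith), mul_zero] at this
      exact this.mono_left nhdsWithin_le_nhds
    refine squeeze_zero' (Eventually.of_forall fun _ => norm_nonneg _) ?_ h4
    filter_upwards [self_mem_nhdsWithin] with z hz
    rcases eq_or_lt_of_le (show (0 : ℝ) ≤ z from hz) with h0 | h0
    · rw [← h0, Complex.ofReal_zero, Complex.zero_cpow hune, zero_mul, norm_zero,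
        Real.zero_rpow (by linarith), mul_zero]
    · exact hbound c hc1 z h0
  · intro z hz
    have hz : (0 : ℝ) < z := hz
    have h4 := hasDerivAt_ofReal_cpow_const hz.ne' hune
    have h5 := h4.mul (hasDerivAt_tailFun (κ := κ) hθ k hz).ofReal_comp
    refine h5.congr_deriv ?_
    have hzc : (z : ℂ) ≠ 0 := by exact_mod_cast hz.ne'
    rw [Complex.cpow_sub _ _ hzc, Complex.cpow_one]
    push_cast
    simp only [smul_eq_mul]
    field_simp
    ring
  · exact ((mellinConvergent_tailFun hθ k hu).const_mul _).sub (mellinConvergent_expFun hθ huκ)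
  · rw [tendsto_zero_iff_norm_tendsto_zero]
    have h4 : Tendsto (fun z : ℝ => Real.Gamma (θ * (u.re + 1) - κ) * z ^ (u.re - (u.re + 1)))
        atTop (𝓝 0) := by
      have := (tendsto_rpow_neg_atTop (y := 1) one_pos).const_mul
        (Real.Gamma (θ * (u.re + 1) - κ))
      rw [mul_zero] at this
      simpa using this
    refine squeeze_zero' (Eventually.of_forall fun _ => norm_nonneg _) ?_ h4
    filter_upwards [eventually_gt_atTop 0] with z hz
    exact hbound _ (by linarith) z hz

/-! ### Integration over `[0, 1]` -/

theorem intervalIntegrable_of_norm_le_rpow {p C : ℝ} (hp : -1 < p) {g : ℝ → ℂ}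
    (hg : AEStronglyMeasurable g (volume.restrict (Set.Ioc 0 1)))
    (h : ∀ t ∈ Set.Ioc (0 : ℝ) 1, ‖g t‖ ≤ C * t ^ p) :
    IntervalIntegrable g volume 0 1 := by
  have h1 := (intervalIntegral.intervalIntegrable_rpow' (a := 0) (b := 1) hp).const_mul C
  rw [intervalIntegrable_iff_integrableOn_Ioc_of_le zero_le_one] at h1 ⊢
  refine h1.mono' hg ?_
  filter_upwards [ae_restrict_mem measurableSet_Ioc] with t ht using h t ht

theorem norm_rpow_mul_mul_le {β c d C D t : ℝ} (ht : 0 < t) {u v : ℂ}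
    (hu : ‖u‖ ≤ C * t ^ (-c)) (hv : ‖v‖ ≤ D * t ^ (-d)) :
    ‖((t ^ (β - 1) : ℝ) : ℂ) * u * v‖ ≤ C * D * t ^ (β - 1 - c - d) := by
  have hC : 0 ≤ C * t ^ (-c) := (norm_nonneg _).trans hu
  rw [norm_mul, norm_mul, Complex.norm_real, Real.norm_of_nonneg (by positivity)]
  calc t ^ (β - 1) * ‖u‖ * ‖v‖ ≤ t ^ (β - 1) * (C * t ^ (-c)) * (D * t ^ (-d)) := by gcongr
    _ = C * D * (t ^ (β - 1) * t ^ (-c) * t ^ (-d)) := by ring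
    _ = _ := by rw [← Real.rpow_add ht, ← Real.rpow_add ht]; congr 2

theorem intervalIntegrable_rpow_mul_mul {β c d : ℝ} (hcd : c + d < β) {u v : ℝ → ℝ}
    (hu : ContinuousOn u (Set.Ioi 0)) (hv : ContinuousOn v (Set.Ioi 0))
    (bu : ∃ C, ∀ t ∈ Set.Ioc (0 : ℝ) 1, |u t| ≤ C * t ^ (-c))
    (bv : ∃ C, ∀ t ∈ Set.Ioc (0 : ℝ) 1, |v t| ≤ C * t ^ (-d)) :
    IntervalIntegrable (fun t => t ^ (β - 1) * u t * v t) volume 0 1 := by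
  obtain ⟨C, hC⟩ := bu
  obtain ⟨D, hD⟩ := bv
  have h1 := (intervalIntegral.intervalIntegrable_rpow' (a := 0) (b := 1)
    (show -1 < β - 1 - c - d by linarith)).const_mul (C * D)
  rw [intervalIntegrable_iff_integrableOn_Ioc_of_le zero_le_one] at h1 ⊢
  have hsub : Set.Ioc (0 : ℝ) 1 ⊆ Set.Ioi 0 := fun _ ht => ht.1
  refine h1.mono' ?_ ?_
  · refine ContinuousOn.aestronglyMeasurable ?_ measurableSet_Ioc
    refine ContinuousOn.mul (ContinuousOn.mul (fun t ht => ?_) (hu.mono hsub)) (hv.mono hsub)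
    exact (Real.continuousAt_rpow_const t _ (Or.inl ht.1.ne')).continuousWithinAt
  · filter_upwards [ae_restrict_mem measurableSet_Ioc] with t ht
    have := norm_rpow_mul_mul_le (β := β) ht.1 (u := u t) (v := v t)
      (by simpa using hC t ht) (by simpa using hD t ht)
    rw [← Complex.ofReal_mul, ← Complex.ofReal_mul, Complex.norm_real] at this
    exact this

/-- Integrate the derivative of t^β u v over [0, 1]. The boundary term at 0 is O(t^{β-c-d}) and
vanishes. -/
theorem integral_rpow_mul_mul_of_hasDerivAt {β c d : ℝ} (hβ : 0 < β) (hcd : c + d < β)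
    {u v e f : ℝ → ℝ} {j k : ℕ}
    (hu : ∀ t, 0 < t → HasDerivAt u ((j * u t - e t) / t) t)
    (hv : ∀ t, 0 < t → HasDerivAt v ((k * v t - f t) / t) t)
    (he : ContinuousOn e (Set.Ioi 0)) (hf : ContinuousOn f (Set.Ioi 0))
    (bu : ∃ C, ∀ t ∈ Set.Ioc (0 : ℝ) 1, |u t| ≤ C * t ^ (-c))
    (bv : ∃ C, ∀ t ∈ Set.Ioc (0 : ℝ) 1, |v t| ≤ C * t ^ (-d))
    (be : ∃ C, ∀ t ∈ Set.Ioc (0 : ℝ) 1, |e t| ≤ C * t ^ (-c))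
    (bf : ∃ C, ∀ t ∈ Set.Ioc (0 : ℝ) 1, |f t| ≤ C * t ^ (-d)) :
    (β + j + k) * ∫ t in (0 : ℝ)..1, t ^ (β - 1) * u t * v t
      = u 1 * v 1 + (∫ t in (0 : ℝ)..1, t ^ (β - 1) * e t * v t)
        + ∫ t in (0 : ℝ)..1, t ^ (β - 1) * u t * f t := by
  have cu : ContinuousOn u (Set.Ioi 0) := fun t ht => (hu t ht).continuousAt.continuousWithinAt
  have cv : ContinuousOn v (Set.Ioi 0) := fun t ht => (hv t ht).continuousAt.continuousWithinAt
  have i1 := (intervalIntegrable_rpow_mul_mul hcd cu cv bu bv).const_mul (β + j + k)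
  have i2 := intervalIntegrable_rpow_mul_mul hcd he cv be bv
  have i3 := intervalIntegrable_rpow_mul_mul hcd cu hf bu bf
  have key := intervalIntegral.integral_eq_sub_of_hasDerivAt_of_le (a := 0) (b := 1)
    (f := fun t => t ^ β * u t * v t)
    (f' := fun t => (β + j + k) * (t ^ (β - 1) * u t * v t)
      - t ^ (β - 1) * e t * v t - t ^ (β - 1) * u t * f t) zero_le_one ?_ ?_ ((i1.sub i2).sub i3)
  · rw [intervalIntegral.integral_sub (i1.sub i2) i3, intervalIntegral.integral_sub i1 i2,
      intervalIntegral.integral_const_mul, Real.zero_rpow hβ.ne', Real.one_rpow] at key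
    linear_combination key
  · intro t ht
    rcases eq_or_lt_of_le ht.1 with h0 | h0
    · subst h0
      obtain ⟨C, hC⟩ := bu
      obtain ⟨D, hD⟩ := bv
      rw [ContinuousWithinAt, Real.zero_rpow hβ.ne', zero_mul, zero_mul,
        tendsto_zero_iff_norm_tendsto_zero]
      have h4 : Tendsto (fun z : ℝ => C * D * z ^ (β - c - d)) (𝓝[Set.Icc 0 1] 0) (𝓝 0) := by
        have := (Real.continuousAt_rpow_const 0 (β - c - d) (Or.inr (by linarith))).const_mul
          (C * D)
        rw [ContinuousAt, Real.zero_rpow (by linarith), mul_zero] at this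
        exact this.mono_left nhdsWithin_le_nhds
      refine squeeze_zero' (Eventually.of_forall fun _ => norm_nonneg _) ?_ h4
      filter_upwards [self_mem_nhdsWithin] with z hz
      rcases eq_or_lt_of_le hz.1 with h0 | h0
      · rw [← h0, Real.zero_rpow hβ.ne', zero_mul, zero_mul, norm_zero,
          Real.zero_rpow (by linarith), mul_zero]
      -- The auxiliary bound carries the power β - 1; shifting β by one gives t^β.
      · have := norm_rpow_mul_mul_le (β := β + 1) h0 (u := u z) (v := v z)
          (by simpa using hC z ⟨h0, hz.2⟩) (by simpa using hD z ⟨h0, hz.2⟩)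
        rw [← Complex.ofReal_mul, ← Complex.ofReal_mul, Complex.norm_real,
          add_sub_cancel_right] at this
        exact this
    · refine ContinuousAt.continuousWithinAt ?_
      exact ((Real.continuousAt_rpow_const t _ (Or.inl h0.ne')).mul (hu t h0).continuousAt).mul
        (hv t h0).continuousAt
  · intro t ht
    have h0 : 0 < t := ht.1
    refine (((Real.hasDerivAt_rpow_const (Or.inl h0.ne')).mul (hu t h0)).mul
      (hv t h0)).congr_deriv ?_
    have : t ^ β = t ^ (β - 1) * t := by
      rw [Real.rpow_sub_one h0.ne']; field_simp
    simp only [Pi.mul_apply, this]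
    field_simp
    ring

theorem intervalIntegrable_finsetSum {ι : Type*} (s : Finset ι) {f : ι → ℝ → ℝ} {x y : ℝ}
    (hf : ∀ i ∈ s, IntervalIntegrable (f i) volume x y) :
    IntervalIntegrable (fun t => ∑ i ∈ s, f i t) volume x y := by
  have := IntervalIntegrable.sum s hf
  rwa [Finset.sum_fn] at this

/-- Expand the product and integrate each u_j v_k by parts. Summing A_j/(β+j+k) over j turns the
resulting integrals of e v_k into minus those already present in the expansion, and likewise for u_j
f. Only the e f integral and the boundary values survive. -/
theorem integral_sum_mul_sum {β c d : ℝ} (hβ : 0 < β) (hcd : c + d < β) (N : ℕ)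
    {u v : ℕ → ℝ → ℝ} {e f : ℝ → ℝ}
    (hu : ∀ j : ℕ, ∀ t, 0 < t → HasDerivAt (u j) ((j * u j t - e t) / t) t)
    (hv : ∀ j : ℕ, ∀ t, 0 < t → HasDerivAt (v j) ((j * v j t - f t) / t) t)
    (he : ContinuousOn e (Set.Ioi 0)) (hf : ContinuousOn f (Set.Ioi 0))
    (bu : ∀ j, ∃ C, ∀ t ∈ Set.Ioc (0 : ℝ) 1, |u j t| ≤ C * t ^ (-c))
    (bv : ∀ j, ∃ C, ∀ t ∈ Set.Ioc (0 : ℝ) 1, |v j t| ≤ C * t ^ (-d))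
    (be : ∃ C, ∀ t ∈ Set.Ioc (0 : ℝ) 1, |e t| ≤ C * t ^ (-c))
    (bf : ∃ C, ∀ t ∈ Set.Ioc (0 : ℝ) 1, |f t| ≤ C * t ^ (-d)) :
    ∫ t in (0 : ℝ)..1, t ^ (β - 1)
        * ((-1) ^ N * e t + ∑ j ∈ Finset.range N, coefA β N j * u j t)
        * ((-1) ^ N * f t + ∑ k ∈ Finset.range N, coefA β N k * v k t)
      = (∫ t in (0 : ℝ)..1, t ^ (β - 1) * e t * f t)
        + ∑ j ∈ Finset.range N, ∑ k ∈ Finset.range N,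
          coefA β N j * coefA β N k / (β + j + k) * (u j 1 * v k 1) := by
  have hβi : ∀ i : ℕ, β + i ≠ 0 := fun i => by positivity
  have cu : ∀ j, ContinuousOn (u j) (Set.Ioi 0) := fun j t ht =>
    (hu j t ht).continuousAt.continuousWithinAt
  have cv : ∀ j, ContinuousOn (v j) (Set.Ioi 0) := fun j t ht =>
    (hv j t ht).continuousAt.continuousWithinAt
  have i0 := intervalIntegrable_rpow_mul_mul hcd he hf be bf
  have i1 := fun k => intervalIntegrable_rpow_mul_mul hcd he (cv k) be (bv k)
  have i2 := fun j => intervalIntegrable_rpow_mul_mul hcd (cu j) hf (bu j) bf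
  have i3 := fun j k => intervalIntegrable_rpow_mul_mul hcd (cu j) (cv k) (bu j) (bv k)
  have hexp : ∀ t : ℝ, t ^ (β - 1)
        * ((-1) ^ N * e t + ∑ j ∈ Finset.range N, coefA β N j * u j t)
        * ((-1) ^ N * f t + ∑ k ∈ Finset.range N, coefA β N k * v k t)
      = t ^ (β - 1) * e t * f t
        + (∑ k ∈ Finset.range N, (-1) ^ N * coefA β N k * (t ^ (β - 1) * e t * v k t))
        + (∑ j ∈ Finset.range N, (-1) ^ N * coefA β N j * (t ^ (β - 1) * u j t * f t))
        + ∑ j ∈ Finset.range N, ∑ k ∈ Finset.range N,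
          coefA β N j * coefA β N k * (t ^ (β - 1) * u j t * v k t) := by
    intro t
    have h1 : ((-1 : ℝ) ^ N) * (-1) ^ N = 1 := by rw [← mul_pow]; simp
    have h2 : (∑ j ∈ Finset.range N, ∑ k ∈ Finset.range N,
          coefA β N j * coefA β N k * (t ^ (β - 1) * u j t * v k t))
        = t ^ (β - 1) * ((∑ j ∈ Finset.range N, coefA β N j * u j t)
          * ∑ k ∈ Finset.range N, coefA β N k * v k t) := by
      rw [Finset.sum_mul_sum, Finset.mul_sum]
      refine Finset.sum_congr rfl fun j _ => ?_
      rw [Finset.mul_sum]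
      exact Finset.sum_congr rfl fun k _ => by ring
    have h3 : (∑ k ∈ Finset.range N, (-1) ^ N * coefA β N k * (t ^ (β - 1) * e t * v k t))
        = (-1) ^ N * t ^ (β - 1) * e t * ∑ k ∈ Finset.range N, coefA β N k * v k t := by
      rw [Finset.mul_sum]
      exact Finset.sum_congr rfl fun k _ => by ring
    have h4 : (∑ j ∈ Finset.range N, (-1) ^ N * coefA β N j * (t ^ (β - 1) * u j t * f t))
        = (-1) ^ N * t ^ (β - 1) * f t * ∑ j ∈ Finset.range N, coefA β N j * u j t := by
      rw [Finset.mul_sum]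
      exact Finset.sum_congr rfl fun k _ => by ring
    rw [h2, h3, h4]
    linear_combination t ^ (β - 1) * e t * f t * h1
  simp only [hexp]
  have s1 : IntervalIntegrable (fun t => ∑ k ∈ Finset.range N,
      (-1) ^ N * coefA β N k * (t ^ (β - 1) * e t * v k t)) volume 0 1 :=
    intervalIntegrable_finsetSum _ fun k _ => (i1 k).const_mul _
  have s2 : IntervalIntegrable (fun t => ∑ j ∈ Finset.range N,
      (-1) ^ N * coefA β N j * (t ^ (β - 1) * u j t * f t)) volume 0 1 :=
    intervalIntegrable_finsetSum _ fun k _ => (i2 k).const_mul _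
  have s3' : ∀ j, IntervalIntegrable (fun t => ∑ k ∈ Finset.range N,
      coefA β N j * coefA β N k * (t ^ (β - 1) * u j t * v k t)) volume 0 1 := fun j =>
    intervalIntegrable_finsetSum _ fun k _ => (i3 j k).const_mul _
  have s3 : IntervalIntegrable (fun t => ∑ j ∈ Finset.range N, ∑ k ∈ Finset.range N,
      coefA β N j * coefA β N k * (t ^ (β - 1) * u j t * v k t)) volume 0 1 :=
    intervalIntegrable_finsetSum _ fun j _ => s3' j
  rw [intervalIntegral.integral_add ((i0.add s1).add s2) s3,
    intervalIntegral.integral_add (i0.add s1) s2, intervalIntegral.integral_add i0 s1,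
    intervalIntegral.integral_finsetSum fun k _ => (i1 k).const_mul _,
    intervalIntegral.integral_finsetSum fun k _ => (i2 k).const_mul _,
    intervalIntegral.integral_finsetSum fun j _ => s3' j]
  have h5 : ∀ j ∈ Finset.range N, (∫ t in (0 : ℝ)..1, ∑ k ∈ Finset.range N,
      coefA β N j * coefA β N k * (t ^ (β - 1) * u j t * v k t))
      = ∑ k ∈ Finset.range N, (coefA β N j * coefA β N k / (β + j + k) * (u j 1 * v k 1)
        + coefA β N k * (∫ t in (0 : ℝ)..1, t ^ (β - 1) * e t * v k t)
          * (coefA β N j / (β + j + k))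
        + coefA β N j * (∫ t in (0 : ℝ)..1, t ^ (β - 1) * u j t * f t)
          * (coefA β N k / (β + k + j))) := by
    intro j _
    rw [intervalIntegral.integral_finsetSum fun k _ => (i3 j k).const_mul _]
    refine Finset.sum_congr rfl fun k _ => ?_
    have h6 := integral_rpow_mul_mul_of_hasDerivAt hβ hcd (hu j) (hv k) he hf (bu j) (bv k) be bf
    have h7 : β + j + k ≠ 0 := by positivity
    rw [intervalIntegral.integral_const_mul, add_right_comm β (k : ℝ) j]
    field_simp
    linear_combination coefA β N j * coefA β N k * h6
  rw [Finset.sum_congr rfl h5]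
  simp only [Finset.sum_add_distrib, intervalIntegral.integral_const_mul]
  have h8 : ∑ j ∈ Finset.range N, ∑ k ∈ Finset.range N,
      coefA β N k * (∫ t in (0 : ℝ)..1, t ^ (β - 1) * e t * v k t) * (coefA β N j / (β + j + k))
      = ∑ k ∈ Finset.range N,
        -((-1) ^ N * coefA β N k * ∫ t in (0 : ℝ)..1, t ^ (β - 1) * e t * v k t) := by
    rw [Finset.sum_comm]
    refine Finset.sum_congr rfl fun k hk => ?_
    rw [← Finset.mul_sum, sum_coefA_div β N (Finset.mem_range.1 hk) hβi]
    ring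
  have h9 : ∑ j ∈ Finset.range N, ∑ k ∈ Finset.range N,
      coefA β N j * (∫ t in (0 : ℝ)..1, t ^ (β - 1) * u j t * f t) * (coefA β N k / (β + k + j))
      = ∑ j ∈ Finset.range N,
        -((-1) ^ N * coefA β N j * ∫ t in (0 : ℝ)..1, t ^ (β - 1) * u j t * f t) := by
    refine Finset.sum_congr rfl fun k hk => ?_
    rw [← Finset.mul_sum, sum_coefA_div β N (Finset.mem_range.1 hk) hβi]
    ring
  rw [h8, h9, Finset.sum_neg_distrib, Finset.sum_neg_distrib]
  ring

/-! ### Bounds for the Gamma function -/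

theorem norm_Gamma_le_Gamma_re {s : ℂ} (hs : 0 < s.re) :
    ‖Complex.Gamma s‖ ≤ Real.Gamma s.re := by
  rw [Complex.Gamma_eq_integral hs, Complex.GammaIntegral, Real.Gamma_eq_integral hs]
  refine (norm_integral_le_integral_norm _).trans (le_of_eq ?_)
  refine setIntegral_congr_fun measurableSet_Ioi fun x hx => ?_
  have hx : (0 : ℝ) < x := hx
  simp only [norm_mul, Complex.norm_real, Complex.norm_cpow_eq_rpow_re_of_pos hx, Complex.sub_re,
    Complex.one_re, Real.norm_of_nonneg (Real.exp_pos _).le]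

theorem ne_zero_of_im_ne_zero {s : ℂ} (hs : s.im ≠ 0) : s ≠ 0 := fun h => hs (by simp [h])

/-- From Γ(s+2) = (s+1) s Γ(s) with |s|, |s+1| ≥ |Im s|. The gain of (Im s)^{-2} makes Γ integrable
along vertical lines. -/
theorem norm_Gamma_mul_im_sq_le {s : ℂ} (hs : 0 < s.re) :
    ‖Complex.Gamma s‖ * s.im ^ 2 ≤ Real.Gamma (s.re + 2) := by
  have h0 : s ≠ 0 := fun h => by simp [h] at hs
  have h1 : s + 1 ≠ 0 := fun h => by
    have := congrArg Complex.re h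
    simp at this; linarith
  have h2 : Complex.Gamma (s + 2) = (s + 1) * (s * Complex.Gamma s) := by
    rw [show s + 2 = s + 1 + 1 by ring, Complex.Gamma_add_one _ h1, Complex.Gamma_add_one _ h0]
  have h3 := norm_Gamma_le_Gamma_re (s := s + 2) (by simp; linarith)
  rw [h2, norm_mul, norm_mul] at h3
  have h4 : |s.im| ≤ ‖s‖ := Complex.abs_im_le_norm s
  have h5 : |s.im| ≤ ‖s + 1‖ := by simpa using Complex.abs_im_le_norm (s + 1)
  have h6 : (s + 2).re = s.re + 2 := by simp
  rw [h6] at h3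
  calc ‖Complex.Gamma s‖ * s.im ^ 2 = |s.im| * (|s.im| * ‖Complex.Gamma s‖) := by
        rw [← sq_abs]; ring
    _ ≤ ‖s + 1‖ * (‖s‖ * ‖Complex.Gamma s‖) := by gcongr
    _ ≤ _ := h3

/-- In a left half-plane, away from the real axis, the Gamma function decays faster than any
exponential. -/
theorem exists_norm_Gamma_le_exp (A L : ℝ) {δ : ℝ} (hδ : 0 < δ) :
    ∃ C, 0 ≤ C ∧ ∀ s : ℂ, s.re ≤ A → δ ≤ |s.im| →
      ‖Complex.Gamma s‖ * s.im ^ 2 ≤ C * Real.exp (L * s.re) := by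
  have hrec : ∀ s : ℂ, s ≠ 0 → ‖Complex.Gamma s‖ * s.im ^ 2
      = ‖Complex.Gamma (s + 1)‖ * (s + 1).im ^ 2 / ‖s‖ := by
    intro s hs
    have : ‖s‖ ≠ 0 := norm_ne_zero_iff.2 hs
    rw [Complex.Gamma_add_one s hs, norm_mul]
    simp only [Complex.add_im, Complex.one_im, add_zero]
    field_simp
  -- A bound on each strip, by descending with Γ(s) = Γ(s+1)/s. The cap `max A 1` ensures that s + 1
  -- stays in the region when Re s ≤ -n.
  have h1 : ∀ n : ℕ, ∃ C, 0 ≤ C ∧ ∀ s : ℂ, -(n : ℝ) < s.re → s.re ≤ max A 1 → δ ≤ |s.im| →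
      ‖Complex.Gamma s‖ * s.im ^ 2 ≤ C := by
    intro n
    induction n with
    | zero =>
      refine ⟨Real.Gamma (max A 1 + 2), Real.Gamma_nonneg_of_nonneg (by positivity),
        fun s h1 h2 _ => ?_⟩
      simp only [Nat.cast_zero, neg_zero] at h1
      refine (norm_Gamma_mul_im_sq_le h1).trans ?_
      refine Real.Gamma_strictMonoOn_Ici.monotoneOn ?_ ?_ (by linarith)
      · simp only [Set.mem_Ici]; linarith
      · simp only [Set.mem_Ici]; linarith
    | succ n ih =>
      obtain ⟨C, hC0, hC⟩ := ih
      refine ⟨max C (C / δ), le_max_of_le_left hC0, fun s h1 h2 h3 => ?_⟩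
      by_cases h4 : -(n : ℝ) < s.re
      · exact (hC s h4 h2 h3).trans (le_max_left _ _)
      · rw [not_lt] at h4
        have hs : s ≠ 0 := ne_zero_of_im_ne_zero fun h => by simp [h] at h3; linarith
        rw [hrec s hs]
        have hn : (0 : ℝ) ≤ n := by positivity
        push_cast at h1
        have h5 := hC (s + 1) (by simp; linarith)
          (by simp only [Complex.add_re, Complex.one_re]; exact le_max_of_le_right (by linarith))
          (by simpa using h3)
        have h6 : δ ≤ ‖s‖ := h3.trans (Complex.abs_im_le_norm s)
        refine le_trans ?_ (le_max_right _ _)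
        gcongr
  -- Once Re s ≤ -n₀ we have |s| ≥ e^L, so every further unit step to the left gains at least
  -- e^{-L}.
  obtain ⟨n₀, hn₀⟩ := exists_nat_ge (Real.exp L)
  obtain ⟨C₁, hC₁0, hC₁⟩ := h1 (n₀ + 1)
  set A' := max A 1 with hA'
  have hA1 : 1 ≤ A' := le_max_right _ _
  -- On the initial strip |Re s| ≤ n₀ + 1 + A', and the extra factor compensates the smallest value
  -- of exp(L Re s).
  set C₂ := C₁ * Real.exp (|L| * (n₀ + 1 + A')) with hC₂
  have hC₂0 : 0 ≤ C₂ := by positivity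
  have h2 : ∀ m : ℕ, ∀ s : ℂ, -((n₀ : ℝ) + 1) - m < s.re → s.re ≤ A' → δ ≤ |s.im| →
      ‖Complex.Gamma s‖ * s.im ^ 2 ≤ C₂ * Real.exp (L * s.re) := by
    intro m
    induction m with
    | zero =>
      intro s h1 h2 h3
      push_cast at h1
      have hn : (0 : ℝ) ≤ n₀ := by positivity
      have h4 := hC₁ s (by push_cast; linarith) h2 h3
      refine h4.trans ?_
      rw [hC₂, mul_assoc, ← Real.exp_add]
      refine le_mul_of_one_le_right hC₁0 (Real.one_le_exp ?_)
      have h5 : |s.re| ≤ n₀ + 1 + A' := by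
        rw [abs_le]
        constructor <;> linarith
      have h6 : |L * s.re| ≤ |L| * (n₀ + 1 + A') := by rw [abs_mul]; gcongr
      have := neg_abs_le (L * s.re)
      linarith
    | succ m ih =>
      intro s h1 h2 h3
      by_cases h4 : -((n₀ : ℝ) + 1) - m < s.re
      · exact ih s h4 h2 h3
      · rw [not_lt] at h4
        have hs : s ≠ 0 := ne_zero_of_im_ne_zero fun h => by simp [h] at h3; linarith
        have hm : (0 : ℝ) ≤ m := by positivity
        have hn : (0 : ℝ) ≤ n₀ := by positivity
        push_cast at h1
        have h5 := ih (s + 1) (by simp; linarith) (by simp; linarith) (by simpa using h3)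
        have h6 : Real.exp L ≤ ‖s‖ := by
          have := Complex.abs_re_le_norm s
          have := neg_abs_le s.re
          linarith
        rw [hrec s hs, div_le_iff₀ (norm_pos_iff.2 hs)]
        refine h5.trans ?_
        rw [mul_assoc C₂]
        refine mul_le_mul_of_nonneg_left ?_ hC₂0
        rw [Complex.add_re, Complex.one_re, mul_add, mul_one, Real.exp_add]
        gcongr
  refine ⟨C₂, hC₂0, fun s hs1 hs2 => ?_⟩
  obtain ⟨m, hm⟩ := exists_nat_gt (-s.re)
  exact h2 m s (by have : (0 : ℝ) ≤ n₀ := by positivity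
                   linarith) (hs1.trans (le_max_left _ _)) hs2

/-- In horizontal strips `1 / Γ` decays to the right faster than any exponential. -/
theorem exists_norm_Gamma_inv_le_exp (A L D : ℝ) :
    ∃ C, 0 ≤ C ∧ ∀ s : ℂ, A ≤ s.re → |s.im| ≤ D →
      ‖(Complex.Gamma s)⁻¹‖ ≤ C * Real.exp (-(L * s.re)) := by
  obtain ⟨n₀, hn₀⟩ := exists_nat_ge (Real.exp L)
  have hn : (0 : ℝ) ≤ n₀ := by positivity
  set A' := min A 0 with hA'
  have hA0 : A' ≤ 0 := min_le_right _ _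
  -- On this rectangle the entire function 1/Γ is bounded; to its right 1/Γ(s) = 1/((s-1) Γ(s-1))
  -- with |s-1| ≥ e^L.
  have hcomp : IsCompact (Set.Icc A' ((n₀ : ℝ) + 1) ×ℂ Set.Icc (-D) D) :=
    isCompact_Icc.reProdIm isCompact_Icc
  obtain ⟨C₀, hC₀⟩ := hcomp.exists_bound_of_continuousOn (f := fun s => (Complex.Gamma s)⁻¹)
    Complex.differentiable_one_div_Gamma.continuous.continuousOn
  have hC₁ : ∀ s ∈ Set.Icc A' ((n₀ : ℝ) + 1) ×ℂ Set.Icc (-D) D,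
      ‖(Complex.Gamma s)⁻¹‖ ≤ max C₀ 0 := fun s hs => (hC₀ s hs).trans (le_max_left _ _)
  set C₁ := max C₀ 0
  have hC₁0 : 0 ≤ C₁ := le_max_right _ _
  set C₂ := C₁ * Real.exp (|L| * (n₀ + 1 - A')) with hC₂
  have hC₂0 : 0 ≤ C₂ := by positivity
  have h2 : ∀ m : ℕ, ∀ s : ℂ, s.re ≤ (n₀ : ℝ) + 1 + m → A' ≤ s.re → |s.im| ≤ D →
      ‖(Complex.Gamma s)⁻¹‖ ≤ C₂ * Real.exp (-(L * s.re)) := by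
    intro m
    induction m with
    | zero =>
      intro s h1 h2 h3
      simp only [Nat.cast_zero, add_zero] at h1
      refine (hC₁ s ⟨⟨h2, h1⟩, abs_le.1 h3⟩).trans ?_
      rw [hC₂, mul_assoc, ← Real.exp_add]
      refine le_mul_of_one_le_right hC₁0 (Real.one_le_exp ?_)
      have h5 : |s.re| ≤ n₀ + 1 - A' := by
        rw [abs_le]
        constructor <;> linarith
      have h6 : |L * s.re| ≤ |L| * (n₀ + 1 - A') := by rw [abs_mul]; gcongr
      have := le_abs_self (L * s.re)
      linarith
    | succ m ih =>
      intro s h1 h2 h3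
      by_cases h4 : s.re ≤ (n₀ : ℝ) + 1 + m
      · exact ih s h4 h2 h3
      · rw [not_le] at h4
        have hm : (0 : ℝ) ≤ m := by positivity
        push_cast at h1
        have hs : s - 1 ≠ 0 := fun h => by
          have := congrArg Complex.re h
          simp at this
          linarith
        have h5 := ih (s - 1) (by simp; linarith) (by simp; linarith) (by simpa using h3)
        have h6 : Real.exp L ≤ ‖s - 1‖ := by
          have := Complex.re_le_norm (s - 1)
          simp only [Complex.sub_re, Complex.one_re] at this
          linarith
        have h7 : Complex.Gamma s = (s - 1) * Complex.Gamma (s - 1) := by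
          rw [← Complex.Gamma_add_one _ hs, sub_add_cancel]
        rw [h7, mul_inv, norm_mul, norm_inv, inv_mul_le_iff₀ (norm_pos_iff.2 hs)]
        refine h5.trans ?_
        rw [mul_left_comm]
        refine mul_le_mul_of_nonneg_left ?_ hC₂0
        rw [Complex.sub_re, Complex.one_re,
          show -(L * (s.re - 1)) = L + -(L * s.re) by ring, Real.exp_add]
        gcongr
  refine ⟨C₂, hC₂0, fun s hs1 hs2 => ?_⟩
  obtain ⟨m, hm⟩ := exists_nat_gt s.re
  exact h2 m s (by linarith) ((min_le_left _ _).trans hs1) hs2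

theorem Gamma_add_natCast_eq (N : ℕ) {u : ℂ} (hu : ∀ i < N, u + i ≠ 0) :
    Complex.Gamma (u + N) = (∏ i ∈ Finset.range N, (u + i)) * Complex.Gamma u := by
  induction N with
  | zero => simp
  | succ N ih =>
    rw [Nat.cast_succ, ← add_assoc, Complex.Gamma_add_one _ (hu N (by omega)),
      ih fun i hi => hu i (by omega), Finset.prod_range_succ]
    ring

theorem Gamma_ne_zero_of_im_ne_zero {u : ℂ} (hu : u.im ≠ 0) : Complex.Gamma u ≠ 0 :=
  Complex.Gamma_ne_zero fun m h => hu (by simp [h])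

theorem add_natCast_ne_zero_of_im_ne_zero {u : ℂ} (hu : u.im ≠ 0) (i : ℕ) : u + i ≠ 0 :=
  ne_zero_of_im_ne_zero (by simpa using hu)

/-! ### Integrals along loops -/

/-- The points of a loop. -/
def HankelLoop.carrier (γ : HankelLoop) : Set ℂ :=
  {u | (u.re ≤ γ.vertex ∧ |u.im| = γ.width) ∨ (u.re = γ.vertex ∧ |u.im| ≤ γ.width)}

theorem HankelLoop.lower_mem (γ : HankelLoop) {s : ℝ} (hs : s ≤ γ.vertex) :
    (s - γ.width * Complex.I : ℂ) ∈ γ.carrier :=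
  Or.inl ⟨by simpa using hs, by simp [abs_of_pos γ.width_pos]⟩

theorem HankelLoop.upper_mem (γ : HankelLoop) {s : ℝ} (hs : s ≤ γ.vertex) :
    (s + γ.width * Complex.I : ℂ) ∈ γ.carrier :=
  Or.inl ⟨by simpa using hs, by simp [abs_of_pos γ.width_pos]⟩

theorem HankelLoop.right_mem (γ : HankelLoop) {s : ℝ} (hs : s ∈ Set.uIcc (-γ.width) γ.width) :
    (γ.vertex + s * Complex.I : ℂ) ∈ γ.carrier := by
  rw [Set.uIcc_of_le (by linarith [γ.width_pos])] at hs
  exact Or.inr ⟨by simp, by simpa using abs_le.2 hs⟩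

theorem HankelLoop.re_le (γ : HankelLoop) {u : ℂ} (hu : u ∈ γ.carrier) : u.re ≤ γ.vertex :=
  hu.elim (fun h => h.1) fun h => h.1.le

theorem HankelLoop.abs_im_le (γ : HankelLoop) {u : ℂ} (hu : u ∈ γ.carrier) : |u.im| ≤ γ.width :=
  hu.elim (fun h => h.2.le) fun h => h.2

section Loop

variable {γ : HankelLoop} {f g : ℂ → ℂ} {C : ℝ}

theorem continuousOn_lower (hf : ContinuousOn f γ.carrier) :
    ContinuousOn (fun s : ℝ => f (s - γ.width * Complex.I)) (Set.Iic γ.vertex) :=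
  hf.comp (by fun_prop) fun _ hs => γ.lower_mem hs

theorem continuousOn_upper (hf : ContinuousOn f γ.carrier) :
    ContinuousOn (fun s : ℝ => f (s + γ.width * Complex.I)) (Set.Iic γ.vertex) :=
  hf.comp (by fun_prop) fun _ hs => γ.upper_mem hs

theorem continuousOn_right (hf : ContinuousOn f γ.carrier) :
    ContinuousOn (fun s : ℝ => f (γ.vertex + s * Complex.I)) (Set.uIcc (-γ.width) γ.width) :=
  hf.comp (by fun_prop) fun _ hs => γ.right_mem hs

theorem loopIntegrable_of_norm_le (hf : ContinuousOn f γ.carrier)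
    (hb : ∀ u ∈ γ.carrier, u.im ≠ 0 → ‖f u‖ ≤ C * Real.exp u.re) : LoopIntegrable γ f := by
  have hw := γ.width_pos.ne'
  have hC := (integrableOn_exp_Iic γ.vertex).const_mul C
  refine ⟨hC.mono' ((continuousOn_lower hf).aestronglyMeasurable measurableSet_Iic) ?_,
    (continuousOn_right hf).intervalIntegrable,
    hC.mono' ((continuousOn_upper hf).aestronglyMeasurable measurableSet_Iic) ?_⟩
  · filter_upwards [ae_restrict_mem measurableSet_Iic] with s hs
    simpa using hb _ (γ.lower_mem hs) (by simpa using hw)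
  · filter_upwards [ae_restrict_mem measurableSet_Iic] with s hs
    simpa using hb _ (γ.upper_mem hs) (by simpa using hw)

/-- The vertical edge meets the real axis in one point. Integrands may thus be compared off the real
axis only, away from poles, where `Complex.Gamma` takes the default value 0 and the functional
equations may fail. -/
theorem ae_right_eq (h : ∀ u : ℂ, u.im ≠ 0 → f u = g u) :
    (fun s : ℝ => f (γ.vertex + s * Complex.I)) =ᵐ[volume]
      fun s : ℝ => g (γ.vertex + s * Complex.I) := by
  have h0 : ∀ᵐ s : ℝ, s ≠ 0 := by simp [ae_iff]
  filter_upwards [h0] with s hs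
  exact h _ (by simpa using hs)

theorem loopIntegral_congr (h : ∀ u : ℂ, u.im ≠ 0 → f u = g u) :
    loopIntegral γ f = loopIntegral γ g := by
  have hw := γ.width_pos.ne'
  have h1 : ∀ s : ℝ, f (s - γ.width * Complex.I) = g (s - γ.width * Complex.I) :=
    fun s => h _ (by simpa using hw)
  have h2 : ∀ s : ℝ, f (s + γ.width * Complex.I) = g (s + γ.width * Complex.I) :=
    fun s => h _ (by simpa using hw)
  have h3 : ∫ s in (-γ.width)..γ.width, f (γ.vertex + s * Complex.I)
      = ∫ s in (-γ.width)..γ.width, g (γ.vertex + s * Complex.I) :=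
    intervalIntegral.integral_congr_ae ((ae_right_eq h).mono fun _ hs _ => hs)
  simp only [loopIntegral, h1, h2, h3]

theorem LoopIntegrable.congr (hf : LoopIntegrable γ f) (h : ∀ u : ℂ, u.im ≠ 0 → f u = g u) :
    LoopIntegrable γ g := by
  have hw := γ.width_pos.ne'
  have h1 : ∀ s : ℝ, f (s - γ.width * Complex.I) = g (s - γ.width * Complex.I) :=
    fun s => h _ (by simpa using hw)
  have h2 : ∀ s : ℝ, f (s + γ.width * Complex.I) = g (s + γ.width * Complex.I) :=
    fun s => h _ (by simpa using hw)
  refine ⟨?_, ?_, ?_⟩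
  · simpa only [h1] using hf.1
  · exact hf.2.1.congr_ae (ae_restrict_of_ae (ae_right_eq h))
  · simpa only [h2] using hf.2.2

theorem loopIntegral_add (hf : LoopIntegrable γ f) (hg : LoopIntegrable γ g) :
    loopIntegral γ (fun u => f u + g u) = loopIntegral γ f + loopIntegral γ g := by
  simp only [loopIntegral]
  rw [integral_add hf.1 hg.1, integral_add hf.2.2 hg.2.2,
    intervalIntegral.integral_add hf.2.1 hg.2.1]
  ring

theorem loopIntegral_const_mul (c : ℂ) :
    loopIntegral γ (fun u => c * f u) = c * loopIntegral γ f := by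
  simp only [loopIntegral]
  rw [integral_const_mul, integral_const_mul, intervalIntegral.integral_const_mul]
  ring

theorem LoopIntegrable.add (hf : LoopIntegrable γ f) (hg : LoopIntegrable γ g) :
    LoopIntegrable γ (fun u => f u + g u) :=
  ⟨hf.1.add hg.1, hf.2.1.add hg.2.1, hf.2.2.add hg.2.2⟩

theorem LoopIntegrable.const_mul (hf : LoopIntegrable γ f) (c : ℂ) :
    LoopIntegrable γ (fun u => c * f u) :=
  ⟨hf.1.const_mul c, hf.2.1.const_mul c, hf.2.2.const_mul c⟩

theorem LoopIntegrable.zero : LoopIntegrable γ (fun _ => 0) :=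
  ⟨by simp, by simp, by simp⟩

theorem loopIntegral_sum {ι : Type*} (s : Finset ι) {F : ι → ℂ → ℂ}
    (hF : ∀ i ∈ s, LoopIntegrable γ (F i)) :
    LoopIntegrable γ (fun u => ∑ i ∈ s, F i u) ∧
    loopIntegral γ (fun u => ∑ i ∈ s, F i u) = ∑ i ∈ s, loopIntegral γ (F i) := by
  classical
  induction s using Finset.induction_on with
  | empty => simpa [loopIntegral] using LoopIntegrable.zero
  | insert i s hi ih =>
    have ih := ih fun j hj => hF j (Finset.mem_insert_of_mem hj)
    have h1 := hF i (Finset.mem_insert_self i s)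
    simp only [Finset.sum_insert hi]
    exact ⟨h1.add ih.1, by rw [loopIntegral_add h1 ih.1, ih.2]⟩

/-- The constant K depends on the loop alone, so bounds uniform in N and z survive integration. -/
theorem norm_loopIntegral_le (γ : HankelLoop) : ∃ K, 0 ≤ K ∧ ∀ (f : ℂ → ℂ) (C : ℝ), 0 ≤ C →
    (∀ u ∈ γ.carrier, ‖f u‖ ≤ C * Real.exp u.re) → ‖loopIntegral γ f‖ ≤ K * C := by
  refine ⟨‖(2 * Real.pi * Complex.I : ℂ)⁻¹‖ * (Real.exp γ.vertex
    + Real.exp γ.vertex * |γ.width - -γ.width| + Real.exp γ.vertex), by positivity,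
    fun f C hC hb => ?_⟩
  have hI := (integrableOn_exp_Iic γ.vertex).const_mul C
  have hv : ∫ s in Set.Iic γ.vertex, C * Real.exp s = C * Real.exp γ.vertex := by
    rw [integral_const_mul, integral_exp_Iic]
  have h1 : ‖∫ s in Set.Iic γ.vertex, f (s - γ.width * Complex.I)‖ ≤ C * Real.exp γ.vertex := by
    rw [← hv]
    refine norm_integral_le_of_norm_le hI ?_
    filter_upwards [ae_restrict_mem measurableSet_Iic] with s hs
    simpa using hb _ (γ.lower_mem hs)
  have h2 : ‖∫ s in Set.Iic γ.vertex, f (s + γ.width * Complex.I)‖ ≤ C * Real.exp γ.vertex := by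
    rw [← hv]
    refine norm_integral_le_of_norm_le hI ?_
    filter_upwards [ae_restrict_mem measurableSet_Iic] with s hs
    simpa using hb _ (γ.upper_mem hs)
  have h3 : ‖∫ s in (-γ.width)..γ.width, f (γ.vertex + s * Complex.I)‖
      ≤ C * Real.exp γ.vertex * |γ.width - -γ.width| := by
    refine intervalIntegral.norm_integral_le_of_norm_le_const fun s hs => ?_
    simpa using hb _ (γ.right_mem (Set.uIoc_subset_uIcc hs))
  have h4 : ∀ X Y Z : ℂ, ‖X + Y * Complex.I - Z‖ ≤ ‖X‖ + ‖Y‖ + ‖Z‖ := fun X Y Z => by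
    have e1 := norm_sub_le (X + Y * Complex.I) Z
    have e2 := norm_add_le X (Y * Complex.I)
    rw [norm_mul, Complex.norm_I, mul_one] at e2
    linarith
  have h5 := (h4 _ _ _).trans (add_le_add (add_le_add h1 h3) h2)
  calc ‖loopIntegral γ f‖ ≤ ‖(2 * Real.pi * Complex.I : ℂ)⁻¹‖ * (C * Real.exp γ.vertex
        + C * Real.exp γ.vertex * |γ.width - -γ.width| + C * Real.exp γ.vertex) := by
        rw [loopIntegral, norm_mul]
        gcongr
    _ = _ := by ring

/-- Dominated convergence on the three edges with majorant C e^{Re u}. Convergence at the vertex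
itself is not needed. -/
theorem tendsto_loopIntegral {F : ℕ → ℂ → ℂ} (hF : ∀ᶠ n in atTop, ContinuousOn (F n) γ.carrier)
    (hb : ∀ᶠ n in atTop, ∀ u ∈ γ.carrier, ‖F n u‖ ≤ C * Real.exp u.re)
    (hlim : ∀ u ∈ γ.carrier, u.im ≠ 0 → Tendsto (fun n => F n u) atTop (𝓝 (f u))) :
    Tendsto (fun n => loopIntegral γ (F n)) atTop (𝓝 (loopIntegral γ f)) := by
  have hw := γ.width_pos.ne'
  have hI := (integrableOn_exp_Iic γ.vertex).const_mul C
  refine Tendsto.const_mul _ (Tendsto.sub (Tendsto.add ?_ (Tendsto.mul_const _ ?_)) ?_)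
  · refine tendsto_integral_filter_of_dominated_convergence (fun s => C * Real.exp s) ?_ ?_ hI ?_
    · filter_upwards [hF] with n hn
      exact (continuousOn_lower hn).aestronglyMeasurable measurableSet_Iic
    · filter_upwards [hb] with n hn
      filter_upwards [ae_restrict_mem measurableSet_Iic] with s hs
      simpa using hn _ (γ.lower_mem hs)
    · filter_upwards [ae_restrict_mem measurableSet_Iic] with s hs
      exact hlim _ (γ.lower_mem hs) (by simpa using hw)
  · refine intervalIntegral.tendsto_integral_filter_of_dominated_convergence
      (fun _ => C * Real.exp γ.vertex) ?_ ?_ (by simp) ?_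
    · filter_upwards [hF] with n hn
      exact ((continuousOn_right hn).mono Set.uIoc_subset_uIcc).aestronglyMeasurable
        measurableSet_uIoc
    · filter_upwards [hb] with n hn
      refine Eventually.of_forall fun s hs => ?_
      simpa using hn _ (γ.right_mem (Set.uIoc_subset_uIcc hs))
    · have h0 : ∀ᵐ s : ℝ, s ≠ 0 := by simp [ae_iff]
      filter_upwards [h0] with s hs hs'
      exact hlim _ (γ.right_mem (Set.uIoc_subset_uIcc hs')) (by simpa using hs)
  · refine tendsto_integral_filter_of_dominated_convergence (fun s => C * Real.exp s) ?_ ?_ hI ?_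
    · filter_upwards [hF] with n hn
      exact (continuousOn_upper hn).aestronglyMeasurable measurableSet_Iic
    · filter_upwards [hb] with n hn
      filter_upwards [ae_restrict_mem measurableSet_Iic] with s hs
      simpa using hn _ (γ.upper_mem hs)
    · filter_upwards [ae_restrict_mem measurableSet_Iic] with s hs
      exact hlim _ (γ.upper_mem hs) (by simpa using hw)

/-! ### Residues -/

/-- The integral along the part of the loop with real part at least `-R`. -/
def truncatedLoop (γ : HankelLoop) (f : ℂ → ℂ) (R : ℝ) : ℂ :=
  (∫ s in (-R)..γ.vertex, f (s - γ.width * Complex.I))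
    + (∫ s in (-γ.width)..γ.width, f (γ.vertex + s * Complex.I)) * Complex.I
    - ∫ s in (-R)..γ.vertex, f (s + γ.width * Complex.I)

theorem loopIntegral_eq_of_tendsto (hf : LoopIntegrable γ f) {L : ℂ}
    (h : Tendsto (truncatedLoop γ f) atTop (𝓝 L)) :
    loopIntegral γ f = (2 * Real.pi * Complex.I)⁻¹ * L := by
  have h1 : Tendsto (truncatedLoop γ f) atTop (𝓝 ((∫ s in Set.Iic γ.vertex,
      f (s - γ.width * Complex.I))
      + (∫ s in (-γ.width)..γ.width, f (γ.vertex + s * Complex.I)) * Complex.I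
      - ∫ s in Set.Iic γ.vertex, f (s + γ.width * Complex.I))) :=
    ((intervalIntegral_tendsto_integral_Iic _ hf.1 tendsto_neg_atTop_atBot).add
      tendsto_const_nhds).sub
      (intervalIntegral_tendsto_integral_Iic _ hf.2.2 tendsto_neg_atTop_atBot)
  rw [loopIntegral, tendsto_nhds_unique h1 h]

/-- Cauchy's theorem on the rectangle closed by the edge Re u = -R. -/
theorem truncatedLoop_of_differentiable (hf : Differentiable ℂ f) (R : ℝ) :
    truncatedLoop γ f R
      = Complex.I * ∫ y in (-γ.width)..γ.width, f (((-R : ℝ) : ℂ) + y * Complex.I) := by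
  have h := Complex.integral_boundary_rect_eq_zero_of_differentiableOn f
    (⟨-R, -γ.width⟩ : ℂ) (⟨γ.vertex, γ.width⟩ : ℂ) hf.differentiableOn
  simp only [smul_eq_mul, Complex.ofReal_neg, neg_mul, ← sub_eq_add_neg] at h
  rw [truncatedLoop]
  push_cast
  linear_combination h

theorem tendsto_truncatedLoop_zero (hf : Differentiable ℂ f) {b : ℝ → ℝ}
    (hb : Tendsto b atTop (𝓝 0))
    (h : ∀ᶠ R in atTop, ∀ u : ℂ, u.re = -R → |u.im| ≤ γ.width → ‖f u‖ ≤ b R) :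
    Tendsto (truncatedLoop γ f) atTop (𝓝 0) := by
  rw [tendsto_zero_iff_norm_tendsto_zero]
  have h1 : Tendsto (fun R => b R * |γ.width - -γ.width|) atTop (𝓝 0) := by
    simpa using hb.mul_const (|γ.width - -γ.width|)
  refine squeeze_zero' (Eventually.of_forall fun _ => norm_nonneg _) ?_ h1
  filter_upwards [h] with R hR
  rw [truncatedLoop_of_differentiable hf, norm_mul, Complex.norm_I, one_mul]
  refine intervalIntegral.norm_integral_le_of_norm_le_const fun y hy => ?_
  refine hR _ (by simp) ?_
  have := Set.uIoc_subset_uIcc hy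
  rw [Set.uIcc_of_le (by linarith [γ.width_pos])] at this
  simpa using abs_le.2 this

theorem loopIntegral_eq_zero (hf : Differentiable ℂ f)
    (hb : ∀ u : ℂ, u.re ≤ γ.vertex → |u.im| ≤ γ.width → ‖f u‖ ≤ C * Real.exp u.re) :
    loopIntegral γ f = 0 := by
  have hint : LoopIntegrable γ f := loopIntegrable_of_norm_le hf.continuous.continuousOn
    fun u hu _ => hb u (γ.re_le hu) (γ.abs_im_le hu)
  rw [loopIntegral_eq_of_tendsto hint (L := 0), mul_zero]
  refine tendsto_truncatedLoop_zero hf (b := fun R => C * Real.exp (-R)) ?_ ?_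
  · simpa using Real.tendsto_exp_neg_atTop_nhds_zero.const_mul C
  · filter_upwards [eventually_ge_atTop (-γ.vertex)] with R hR u h1 h2
    rw [← h1]
    exact hb u (by linarith) h2

theorem integral_inv_line {a b : ℂ} {p q : ℝ}
    (h : ∀ x ∈ Set.uIcc p q, a + x * b ∈ Complex.slitPlane) :
    IntervalIntegrable (fun x : ℝ => b / (a + x * b)) volume p q ∧
    ∫ x in p..q, b / (a + x * b) = Complex.log (a + q * b) - Complex.log (a + p * b) := by
  have hi : IntervalIntegrable (fun x : ℝ => b / (a + x * b)) volume p q := by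
    refine ContinuousOn.intervalIntegrable (ContinuousOn.div (by fun_prop) (by fun_prop) ?_)
    exact fun x hx => Complex.slitPlane_ne_zero (h x hx)
  refine ⟨hi, intervalIntegral.integral_eq_sub_of_hasDerivAt
    (f := fun x : ℝ => Complex.log (a + x * b)) (fun x hx => ?_) hi⟩
  have h1 : HasDerivAt (fun z : ℂ => a + z * b) b (x : ℂ) := by
    simpa using ((hasDerivAt_id (x : ℂ)).mul_const b).const_add a
  exact (h1.clog (h x hx)).comp_ofReal

/-- Dividing by R - j > 0 keeps the argument and moves the point to -1 from the upper half-plane,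
where `arg` is continuous with value π. -/
theorem tendsto_arg_left {δ : ℝ} (hδ : 0 < δ) (j : ℝ) :
    Tendsto (fun R : ℝ => Complex.arg (((j - R : ℝ) : ℂ) + δ * Complex.I)) atTop
      (𝓝 Real.pi) := by
  have h1 := Complex.continuousWithinAt_arg_of_re_neg_of_im_zero (z := -1) (by simp) (by simp)
  rw [ContinuousWithinAt, Complex.arg_neg_one] at h1
  have h3 : Tendsto (fun R : ℝ => (R - j)⁻¹) atTop (𝓝 0) :=
    tendsto_inv_atTop_zero.comp (tendsto_atTop_add_const_right atTop (-j) tendsto_id)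
  have h2 : Tendsto (fun R : ℝ => (-1 : ℂ) + (δ * (R - j)⁻¹ : ℝ) * Complex.I) atTop
      (𝓝[{z : ℂ | 0 ≤ z.im}] (-1)) := by
    refine tendsto_nhdsWithin_iff.2 ⟨?_, ?_⟩
    · have h4 := (Complex.continuous_ofReal.tendsto _).comp (h3.const_mul δ)
      simpa using (h4.mul_const Complex.I).const_add (-1)
    · filter_upwards [eventually_gt_atTop j] with R hR
      have : 0 < R - j := by linarith
      simp only [Complex.add_im, Complex.neg_im, Complex.one_im, neg_zero,
        Complex.mul_im, Complex.ofReal_re, Complex.I_im, mul_one, Complex.ofReal_im, Complex.I_re,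
        mul_zero, add_zero, zero_add]
      positivity
  refine (h1.comp h2).congr' ?_
  filter_upwards [eventually_gt_atTop j] with R hR
  have h5 : 0 < R - j := by linarith
  rw [Function.comp_apply, ← Complex.arg_real_mul _ h5]
  congr 1
  have : ((R - j : ℝ) : ℂ) ≠ 0 := by exact_mod_cast h5.ne'
  push_cast at this ⊢
  field_simp
  ring

/-- Along the truncated loop u + j avoids the branch cut, so log is a primitive. The corner values
cancel, and the conjugate end points leave log w minus its conjugate, which is 2i arg w with w = j -
R + iδ. -/
theorem tendsto_truncatedLoop_inv (γ : HankelLoop) (j : ℕ) (hj : -(j : ℝ) < γ.vertex) :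
    Tendsto (truncatedLoop γ fun u => 1 / (u + j)) atTop (𝓝 (2 * Real.pi * Complex.I)) := by
  have hw := γ.width_pos
  have h1 : ∀ R : ℝ, truncatedLoop γ (fun u => 1 / (u + j)) R
      = 2 * (Complex.arg (((j - R : ℝ) : ℂ) + γ.width * Complex.I) : ℂ) * Complex.I := by
    intro R
    have e1 := (integral_inv_line (a := j - γ.width * Complex.I) (b := 1) (p := -R)
      (q := γ.vertex) fun x _ => Complex.mem_slitPlane_iff.2 (Or.inr (by simpa using hw.ne'))).2
    have e2 := (integral_inv_line (a := j + γ.width * Complex.I) (b := 1) (p := -R)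
      (q := γ.vertex) fun x _ => Complex.mem_slitPlane_iff.2 (Or.inr (by simpa using hw.ne'))).2
    have e3 := (integral_inv_line (a := (γ.vertex + j : ℝ)) (b := Complex.I) (p := -γ.width)
      (q := γ.width) fun x _ => Complex.mem_slitPlane_iff.2 (Or.inl (by simp; linarith))).2
    simp only [mul_one] at e1 e2
    have d1 : ∫ s in (-R)..γ.vertex, 1 / ((s : ℂ) - γ.width * Complex.I + j)
        = ∫ s in (-R)..γ.vertex, 1 / (j - γ.width * Complex.I + (s : ℂ)) := by
      congr 1 with s; congr 1; ring
    have d2 : ∫ s in (-R)..γ.vertex, 1 / ((s : ℂ) + γ.width * Complex.I + j)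
        = ∫ s in (-R)..γ.vertex, 1 / (j + γ.width * Complex.I + (s : ℂ)) := by
      congr 1 with s; congr 1; ring
    have d3 : (∫ s in (-γ.width)..γ.width, 1 / ((γ.vertex : ℂ) + s * Complex.I + j)) * Complex.I
        = ∫ s in (-γ.width)..γ.width,
          Complex.I / (((γ.vertex + j : ℝ) : ℂ) + s * Complex.I) := by
      rw [← intervalIntegral.integral_mul_const]
      congr 1 with s
      rw [div_mul_eq_mul_div, one_mul]; congr 1; push_cast; ring
    set w : ℂ := ((j - R : ℝ) : ℂ) + γ.width * Complex.I with hw'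
    have harg : w.arg ≠ Real.pi := fun h => by
      have := (Complex.arg_eq_pi_iff.1 h).2
      simp [hw'] at this
      linarith
    have hconj : Complex.log ((j : ℂ) - γ.width * Complex.I + ((-R : ℝ) : ℂ))
        = (starRingEnd ℂ) (Complex.log w) := by
      rw [← Complex.log_conj w harg]
      congr 1
      simp [hw']; ring
    have hlog : (j : ℂ) + γ.width * Complex.I + ((-R : ℝ) : ℂ) = w := by
      simp [hw']; ring
    have hsub := Complex.sub_conj (Complex.log w)
    rw [Complex.log_im] at hsub
    have q1 : (j : ℂ) - γ.width * Complex.I + (γ.vertex : ℂ)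
        = ((γ.vertex + j : ℝ) : ℂ) + ((-γ.width : ℝ) : ℂ) * Complex.I := by push_cast; ring
    have q2 : (j : ℂ) + γ.width * Complex.I + (γ.vertex : ℂ)
        = ((γ.vertex + j : ℝ) : ℂ) + (γ.width : ℂ) * Complex.I := by push_cast; ring
    rw [truncatedLoop, d1, d2, d3, e1, e2, e3, hconj, hlog, q1, q2]
    push_cast at hsub
    linear_combination hsub
  rw [show truncatedLoop γ (fun u => 1 / (u + j)) = _ from funext h1]
  have := (((Complex.continuous_ofReal.tendsto _).comp (tendsto_arg_left hw j)).const_mul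
    2).mul_const Complex.I
  exact this

/-- The residue theorem for a simple pole at `-j`. -/
theorem loopIntegral_div_add (hg : Differentiable ℂ g) (hC : 0 ≤ C)
    (hb : ∀ u : ℂ, u.re ≤ γ.vertex → |u.im| ≤ γ.width → ‖g u‖ ≤ C * Real.exp u.re) (j : ℕ)
    (hj : -(j : ℝ) < γ.vertex) (hint : LoopIntegrable γ fun u => g u / (u + j)) :
    loopIntegral γ (fun u => g u / (u + j)) = g (-j) := by
  have hw := γ.width_pos.ne'
  -- Subtracting g(-j)/(u+j) leaves an entire function of size O(1/R) on the closing edge, so only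
  -- the explicit pole contributes.
  set q := dslope g (-(j : ℂ)) with hq
  have hqd : Differentiable ℂ q := by
    rw [← differentiableOn_univ] at hg ⊢
    exact (Complex.differentiableOn_dslope univ_mem).2 hg
  have hq1 : ∀ u : ℂ, u + j ≠ 0 → q u = (g u - g (-j)) / (u + j) := by
    intro u hu
    rw [hq, dslope_of_ne _ (fun h => hu (by rw [h]; ring)), slope_def_field, sub_neg_eq_add]
  have h1 : Tendsto (truncatedLoop γ q) atTop (𝓝 0) := by
    refine tendsto_truncatedLoop_zero hqd
      (b := fun R => (C * Real.exp γ.vertex + ‖g (-j)‖) * (R - j)⁻¹) ?_ ?_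
    · have h3 : Tendsto (fun R : ℝ => (R - j)⁻¹) atTop (𝓝 0) :=
        tendsto_inv_atTop_zero.comp (tendsto_atTop_add_const_right atTop (-(j : ℝ)) tendsto_id)
      simpa using h3.const_mul (C * Real.exp γ.vertex + ‖g (-j)‖)
    · filter_upwards [eventually_gt_atTop (j : ℝ), eventually_ge_atTop (-γ.vertex)]
        with R hR hR' u hu1 hu2
      have h4 : R - j ≤ ‖u + j‖ := by
        have := Complex.abs_re_le_norm (u + j)
        simp only [Complex.add_re, Complex.natCast_re, hu1] at this
        have := neg_abs_le (-R + j)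
        linarith
      have h5 : 0 < R - j := by linarith
      have h6 : u + j ≠ 0 := norm_pos_iff.1 (h5.trans_le h4)
      rw [hq1 u h6, norm_div, div_eq_mul_inv]
      have h7 : ‖g u‖ ≤ C * Real.exp γ.vertex := by
        refine (hb u (by linarith) hu2).trans ?_
        gcongr
        linarith
      have h8 := norm_sub_le (g u) (g (-j))
      gcongr
      linarith
  have h2 : ∀ R, truncatedLoop γ (fun u => g u / (u + j)) R
      = truncatedLoop γ q R + g (-j) * truncatedLoop γ (fun u => 1 / (u + j)) R := by
    intro R
    have hne : ∀ u : ℂ, u ∈ γ.carrier → u + j ≠ 0 := by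
      intro u hu h
      have hre := congrArg Complex.re h
      have him := congrArg Complex.im h
      simp only [Complex.add_re, Complex.natCast_re, Complex.zero_re, Complex.add_im,
        Complex.natCast_im, add_zero, Complex.zero_im] at hre him
      rcases hu with hu | hu
      · rw [him, abs_zero] at hu
        exact hw hu.2.symm
      · linarith [hu.1]
    have hlow : ∀ s : ℝ, (s - γ.width * Complex.I : ℂ) + j ≠ 0 := fun s =>
      add_natCast_ne_zero_of_im_ne_zero (by simpa using hw) j
    have hupp : ∀ s : ℝ, (s + γ.width * Complex.I : ℂ) + j ≠ 0 := fun s =>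
      add_natCast_ne_zero_of_im_ne_zero (by simpa using hw) j
    have hright : ∀ s ∈ Set.uIcc (-γ.width) γ.width,
        (γ.vertex + s * Complex.I : ℂ) + j ≠ 0 := fun s hs => hne _ (γ.right_mem hs)
    have hsplit : ∀ u : ℂ, u + j ≠ 0 → g u / (u + j) = q u + g (-j) * (1 / (u + j)) := by
      intro u hu
      rw [hq1 u hu]; ring
    have hqc := hqd.continuous
    have i1 : ∀ a b : ℝ, IntervalIntegrable
        (fun s : ℝ => 1 / ((s - γ.width * Complex.I : ℂ) + j)) volume a b := fun a b =>
      ContinuousOn.intervalIntegrable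
        (ContinuousOn.div (by fun_prop) (by fun_prop) fun s _ => hlow s)
    have i2 : ∀ a b : ℝ, IntervalIntegrable
        (fun s : ℝ => 1 / ((s + γ.width * Complex.I : ℂ) + j)) volume a b := fun a b =>
      ContinuousOn.intervalIntegrable
        (ContinuousOn.div (by fun_prop) (by fun_prop) fun s _ => hupp s)
    have i3 : IntervalIntegrable (fun s : ℝ => 1 / ((γ.vertex + s * Complex.I : ℂ) + j))
        volume (-γ.width) γ.width :=
      ContinuousOn.intervalIntegrable (ContinuousOn.div (by fun_prop) (by fun_prop) hright)
    simp only [truncatedLoop]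
    rw [intervalIntegral.integral_congr fun s hs => hsplit _ (hright s hs)]
    simp only [hsplit _ (hlow _), hsplit _ (hupp _)]
    rw [intervalIntegral.integral_add (Continuous.intervalIntegrable (by fun_prop) _ _)
        ((i1 _ _).const_mul _),
      intervalIntegral.integral_add (Continuous.intervalIntegrable (by fun_prop) _ _)
        ((i2 _ _).const_mul _),
      intervalIntegral.integral_add (Continuous.intervalIntegrable (by fun_prop) _ _)
        (i3.const_mul _)]
    simp only [intervalIntegral.integral_const_mul]
    ring
  have h3 : Tendsto (truncatedLoop γ fun u => g u / (u + j)) atTop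
      (𝓝 (0 + g (-j) * (2 * Real.pi * Complex.I))) := by
    rw [show truncatedLoop γ (fun u => g u / (u + j)) = _ from funext h2]
    exact h1.add ((tendsto_truncatedLoop_inv γ j hj).const_mul _)
  rw [loopIntegral_eq_of_tendsto hint h3, zero_add]
  have : (2 * Real.pi * Complex.I : ℂ) ≠ 0 := Complex.two_pi_I_ne_zero
  field_simp

/-! ### From loops to vertical lines -/

/-- Here ε = 1 treats the upper ray and ε = -1 the lower one. By Cauchy's theorem on a rectangle the
two near edges equal the two far edges. The horizontal far edge is O(R^{-2}) over length O(R), the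
left one O(e^{-R}) over length O(R). -/
theorem tendsto_horizontal {ε : ℝ} (hε : ε = 1 ∨ ε = -1) (hC : 0 ≤ C)
    (hd : ∀ u : ℂ, u.im ≠ 0 → DifferentiableAt ℂ f u)
    (hb : ∀ u : ℂ, u.re ≤ γ.vertex → γ.width ≤ |u.im| → ‖f u‖ * u.im ^ 2 ≤ C * Real.exp u.re) :
    Tendsto (fun R : ℝ => (∫ s in (-R)..γ.vertex, f (s + (ε * γ.width : ℝ) * Complex.I))
      + Complex.I * ∫ y in (ε * γ.width)..(ε * R), f (γ.vertex + y * Complex.I)) atTop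
      (𝓝 0) := by
  have hw := γ.width_pos
  have habs : |ε| = 1 := by rcases hε with rfl | rfl <;> simp
  have hεε : ε * ε = 1 := by rcases hε with rfl | rfl <;> norm_num
  have key : ∀ R, γ.width ≤ R → (∫ s in (-R)..γ.vertex, f (s + (ε * γ.width : ℝ) * Complex.I))
      + Complex.I * ∫ y in (ε * γ.width)..(ε * R), f (γ.vertex + y * Complex.I)
      = (∫ s in (-R)..γ.vertex, f (s + (ε * R : ℝ) * Complex.I))
      + Complex.I * ∫ y in (ε * γ.width)..(ε * R), f (((-R : ℝ) : ℂ) + y * Complex.I) := by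
    intro R hR
    have h := Complex.integral_boundary_rect_eq_zero_of_differentiableOn f
      (⟨-R, ε * γ.width⟩ : ℂ) (⟨γ.vertex, ε * R⟩ : ℂ) (fun u hu => by
        refine (hd u fun h0 => ?_).differentiableWithinAt
        have := hu.2
        simp only [Set.mem_preimage, h0] at this
        rcases hε with rfl | rfl
        · rw [one_mul, one_mul, Set.uIcc_of_le hR] at this
          linarith [this.1]
        · rw [Set.uIcc_of_ge (by linarith)] at this
          linarith [this.2])
    simp only [smul_eq_mul] at h
    linear_combination h
  have hedge : ∀ R y, y ∈ Set.uIoc (ε * γ.width) (ε * R) → γ.width ≤ R → γ.width ≤ |y| := by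
    intro R y hy hR
    rcases hε with rfl | rfl
    · rw [one_mul, one_mul, Set.uIoc_of_le hR] at hy
      exact hy.1.le.trans (le_abs_self y)
    · rw [Set.uIoc_of_ge (by linarith)] at hy
      have := neg_abs_le y
      linarith [hy.2]
  rw [tendsto_zero_iff_norm_tendsto_zero]
  have hlim : Tendsto (fun R : ℝ => C * Real.exp γ.vertex * (R⁻¹ * R⁻¹ * (γ.vertex + R))
      + C / γ.width ^ 2 * (Real.exp (-R) * (R - γ.width))) atTop (𝓝 0) := by
    have t1 : Tendsto (fun R : ℝ => R⁻¹ * R⁻¹ * (γ.vertex + R)) atTop (𝓝 0) := by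
      have t2 : Tendsto (fun R : ℝ => R⁻¹ * R⁻¹ * γ.vertex + R⁻¹) atTop (𝓝 0) := by
        simpa using ((tendsto_inv_atTop_zero (𝕜 := ℝ)).mul tendsto_inv_atTop_zero).mul_const
          γ.vertex |>.add tendsto_inv_atTop_zero
      refine t2.congr' ?_
      filter_upwards [eventually_gt_atTop 0] with R hR
      field_simp
    have t3 : Tendsto (fun R : ℝ => Real.exp (-R) * (R - γ.width)) atTop (𝓝 0) := by
      have t4 := Real.tendsto_pow_mul_exp_neg_atTop_nhds_zero 1
      have t5 := Real.tendsto_exp_neg_atTop_nhds_zero.const_mul γ.width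
      have := t4.sub t5
      simp only [mul_zero, sub_zero, pow_one] at this
      refine this.congr fun R => by ring
    simpa using (t1.const_mul (C * Real.exp γ.vertex)).add (t3.const_mul (C / γ.width ^ 2))
  refine squeeze_zero' (Eventually.of_forall fun _ => norm_nonneg _) ?_ hlim
  filter_upwards [eventually_ge_atTop γ.width, eventually_ge_atTop (-γ.vertex)] with R hR hR'
  have hR0 : 0 < R := hw.trans_le hR
  rw [key R hR]
  refine (norm_add_le _ _).trans (add_le_add ?_ ?_)
  · have h1 : ‖∫ s in (-R)..γ.vertex, f (s + (ε * R : ℝ) * Complex.I)‖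
        ≤ C * Real.exp γ.vertex * (R⁻¹ * R⁻¹) * |γ.vertex - -R| := by
      refine intervalIntegral.norm_integral_le_of_norm_le_const fun s hs => ?_
      rw [Set.uIoc_of_le (by linarith)] at hs
      have him : (s + (ε * R : ℝ) * Complex.I : ℂ).im = ε * R := by simp
      have hre : (s + (ε * R : ℝ) * Complex.I : ℂ).re = s := by simp
      have h2 := hb (s + (ε * R : ℝ) * Complex.I) (by rw [hre]; exact hs.2)
        (by rw [him, abs_mul, habs, one_mul, abs_of_pos hR0]; exact hR)
      rw [him, hre, mul_pow, pow_two ε, hεε, one_mul] at h2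
      have h3 : C * Real.exp s ≤ C * Real.exp γ.vertex := by
        gcongr
        exact hs.2
      rw [← mul_inv, ← div_eq_mul_inv, le_div_iff₀ (by positivity), ← pow_two]
      exact h2.trans h3
    rw [sub_neg_eq_add, abs_of_nonneg (by linarith), mul_assoc] at h1
    exact h1
  · rw [norm_mul, Complex.norm_I, one_mul]
    have h1 : ‖∫ y in (ε * γ.width)..(ε * R), f (((-R : ℝ) : ℂ) + y * Complex.I)‖
        ≤ C / γ.width ^ 2 * Real.exp (-R) * |ε * R - ε * γ.width| := by
      refine intervalIntegral.norm_integral_le_of_norm_le_const fun y hy => ?_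
      have hy' := hedge R y hy hR
      have him : (((-R : ℝ) : ℂ) + y * Complex.I).im = y := by simp
      have hre : (((-R : ℝ) : ℂ) + y * Complex.I).re = -R := by simp
      have h2 := hb (((-R : ℝ) : ℂ) + y * Complex.I) (by rw [hre]; linarith) (by rwa [him])
      rw [him, hre] at h2
      rw [div_mul_eq_mul_div, le_div_iff₀ (by positivity)]
      refine le_trans ?_ h2
      rw [← sq_abs y]
      gcongr
    rw [← mul_sub, abs_mul, habs, one_mul, abs_of_nonneg (by linarith), mul_assoc] at h1
    exact h1

/-- Each horizontal ray is swung onto the vertical ray from the same corner; together with the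
vertical edge these form the whole line. -/
theorem loopIntegral_eq_vertical (hC : 0 ≤ C) (hf : LoopIntegrable γ f)
    (hd : ∀ u : ℂ, u.im ≠ 0 → DifferentiableAt ℂ f u)
    (hb : ∀ u : ℂ, u.re ≤ γ.vertex → γ.width ≤ |u.im| → ‖f u‖ * u.im ^ 2 ≤ C * Real.exp u.re)
    (hv : Integrable fun y : ℝ => f (γ.vertex + y * Complex.I)) :
    loopIntegral γ f = (2 * Real.pi : ℂ)⁻¹ * ∫ y : ℝ, f (γ.vertex + y * Complex.I) := by
  have hw := γ.width_pos
  set F : ℝ → ℂ := fun y => f (γ.vertex + y * Complex.I) with hF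
  have up := tendsto_horizontal (Or.inl rfl) hC hd hb
  have lo := tendsto_horizontal (Or.inr rfl) hC hd hb
  have up' : (∫ s in Set.Iic γ.vertex, f (s + γ.width * Complex.I))
      + Complex.I * ∫ y in Set.Ioi γ.width, F y = 0 := by
    refine tendsto_nhds_unique (Tendsto.add ?_ (Tendsto.const_mul _ ?_)) up
    · have := intervalIntegral_tendsto_integral_Iic _ hf.2.2 tendsto_neg_atTop_atBot
      simpa using this
    · have := intervalIntegral_tendsto_integral_Ioi γ.width hv.integrableOn tendsto_id
      simpa using this
  have lo' : (∫ s in Set.Iic γ.vertex, f (s - γ.width * Complex.I))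
      + Complex.I * (-∫ y in Set.Iic (-γ.width), F y) = 0 := by
    refine tendsto_nhds_unique (Tendsto.add ?_ (Tendsto.const_mul _ ?_)) lo
    · have := intervalIntegral_tendsto_integral_Iic _ hf.1 tendsto_neg_atTop_atBot
      simpa [sub_eq_add_neg] using this
    · have := (intervalIntegral_tendsto_integral_Iic (-γ.width) hv.integrableOn
        tendsto_neg_atTop_atBot).neg
      refine this.congr fun R => ?_
      rw [← intervalIntegral.integral_symm]
      simp [hF]
  have htot : (∫ y : ℝ, F y) = (∫ y in Set.Iic (-γ.width), F y)
      + (∫ y in (-γ.width)..γ.width, F y) + ∫ y in Set.Ioi γ.width, F y := by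
    rw [← intervalIntegral.integral_Iic_add_Ioi (b := γ.width) hv.integrableOn hv.integrableOn,
      ← intervalIntegral.integral_Iic_sub_Iic hv.integrableOn hv.integrableOn]
    ring
  have hsum : (∫ s in Set.Iic γ.vertex, f (s - γ.width * Complex.I))
      + (∫ y in (-γ.width)..γ.width, F y) * Complex.I
      - (∫ s in Set.Iic γ.vertex, f (s + γ.width * Complex.I)) = Complex.I * ∫ y : ℝ, F y := by
    rw [htot]; linear_combination lo' - up'
  have hI : Complex.I ≠ 0 := Complex.I_ne_zero
  rw [loopIntegral, hsum, mul_inv, mul_assoc, inv_mul_cancel_left₀ hI]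

end Loop

/-! ### Uniform bounds for `(β - u)_N / (u)_N` on loops -/

/-- The rescaled rational function `(β - u)_N / (u)_N N^{2u - β}`. -/
def scaledRatF (β : ℝ) (N : ℕ) (u : ℂ) : ℂ := ratF (β : ℂ) N u * (N : ℂ) ^ (2 * u - β)

/-- Keeping Re ζ rather than |ζ| at first order is essential: the first-order terms must cancel
against N^{2u-β}. -/
theorem norm_one_add_le_exp (ζ : ℂ) : ‖1 + ζ‖ ≤ Real.exp (ζ.re + ‖ζ‖ ^ 2 / 2) := by
  have h1 : ‖1 + ζ‖ ^ 2 ≤ Real.exp (ζ.re + ‖ζ‖ ^ 2 / 2) ^ 2 := by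
    rw [← Real.exp_nat_mul]
    have h2 : ‖1 + ζ‖ ^ 2 = 1 + (2 * ζ.re + ‖ζ‖ ^ 2) := by
      rw [Complex.sq_norm, Complex.sq_norm, Complex.normSq_apply, Complex.normSq_apply]
      simp; ring
    have h3 := Real.add_one_le_exp (2 * ζ.re + ‖ζ‖ ^ 2)
    rw [h2]
    refine le_trans (by linarith) (h3.trans (le_of_eq ?_))
    congr 1; push_cast; ring
  exact le_of_sq_le_sq h1 (Real.exp_pos _).le

theorem sum_inv_sq_le (N : ℕ) : ∑ i ∈ Finset.range N, 1 / ((i : ℝ) + 1) ^ 2 ≤ 2 := by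
  have h : ∀ N : ℕ, ∑ i ∈ Finset.range (N + 1), 1 / ((i : ℝ) + 1) ^ 2 ≤ 2 - 1 / ((N : ℝ) + 1) := by
    intro N
    induction N with
    | zero => norm_num
    | succ n ih =>
      rw [Finset.sum_range_succ]
      have h1 : 1 / (((n + 1 : ℕ) : ℝ) + 1) ^ 2
          ≤ 1 / ((n : ℝ) + 1) - 1 / (((n + 1 : ℕ) : ℝ) + 1) := by
        push_cast
        rw [div_sub_div _ _ (by positivity) (by positivity),
          div_le_div_iff₀ (by positivity) (by positivity)]
        have : (0 : ℝ) ≤ n := by positivity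
        nlinarith
      linarith
  refine le_trans ?_ ((h N).trans (sub_le_self _ (by positivity)))
  rw [Finset.sum_range_succ]
  exact le_add_of_nonneg_right (by positivity)

theorem abs_sum_inv_sub_log_le {N : ℕ} (hN : 1 ≤ N) :
    |∑ i ∈ Finset.range N, 1 / ((i : ℝ) + 1) - Real.log N| ≤ 1 := by
  have h1 := log_add_one_le_harmonic N
  have h2 := harmonic_le_one_add_log N
  have h3 : ((harmonic N : ℚ) : ℝ) = ∑ i ∈ Finset.range N, 1 / ((i : ℝ) + 1) := by
    simp [harmonic]
  rw [h3] at h1 h2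
  have hN' : (0 : ℝ) < N := by exact_mod_cast hN
  have h4 : Real.log N ≤ Real.log (N + 1) := Real.log_le_log hN' (by linarith)
  push_cast at h1
  rw [abs_le]
  constructor <;> linarith

/-- Each factor is 1 + ζ_i with ζ_i = (β-2v)/(v+i) = (β-2v)/(i+1) + O((i+1)^{-2}). The product is at
most exp((β - 2 Re v) H_N + O(1)), H_N the harmonic number, and the power of N removes the growth
since H_N - log N is bounded. -/
theorem norm_scaledRatF_le_of_compact (β K : ℝ) {η : ℝ} (hη : 0 < η) :
    ∃ C, 0 ≤ C ∧ ∀ N : ℕ, 1 ≤ N → ∀ v : ℂ, ‖v‖ ≤ K → (∀ i : ℕ, η * (i + 1) ≤ ‖v + i‖) →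
      ‖scaledRatF β N v‖ ≤ C := by
  set E : ℝ := |β| + 2 * K + 1 with hE
  set D : ℝ := E * E / η + E ^ 2 / (2 * η ^ 2) with hD
  refine ⟨Real.exp (E + D * 2), (Real.exp_pos _).le, fun N hN v hv hvi => ?_⟩
  have hK : 0 ≤ K := (norm_nonneg v).trans hv
  have hE0 : 0 ≤ E := by positivity
  have hD0 : 0 ≤ D := by positivity
  have hN' : (0 : ℝ) < N := by exact_mod_cast hN
  have e1 : ‖(β : ℂ) - 2 * v‖ ≤ E := by
    refine (norm_sub_le _ _).trans ?_
    rw [norm_mul, Complex.norm_real, Real.norm_eq_abs, Complex.norm_ofNat]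
    linarith
  have e2 : ‖1 - v‖ ≤ E := by
    refine (norm_sub_le _ _).trans ?_
    rw [norm_one]
    linarith [abs_nonneg β]
  have hfac : ∀ i ∈ Finset.range N, ‖((β : ℂ) - v + i) / (v + i)‖
      ≤ Real.exp ((β - 2 * v.re) * (1 / ((i : ℝ) + 1)) + D * (1 / ((i : ℝ) + 1) ^ 2)) := by
    intro i _
    have hi1 : (0 : ℝ) < (i : ℝ) + 1 := by positivity
    have hpos : 0 < ‖v + i‖ := lt_of_lt_of_le (by positivity) (hvi i)
    have hne : v + i ≠ 0 := norm_pos_iff.1 hpos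
    have hi1c : (i : ℂ) + 1 ≠ 0 := by exact_mod_cast hi1.ne'
    set ζ : ℂ := ((β : ℂ) - 2 * v) / (v + i) with hζ
    have h1 : ((β : ℂ) - v + i) / (v + i) = 1 + ζ := by rw [hζ]; field_simp; ring
    have h2 : ζ = ((β - 2 * v) * ((1 / ((i : ℝ) + 1) : ℝ) : ℂ))
        + (β - 2 * v) * (1 - v) / ((v + i) * ((i : ℂ) + 1)) := by
      rw [hζ]; push_cast; field_simp; ring
    have h3 : ‖ζ‖ ≤ E / (η * (i + 1)) := by
      rw [hζ, norm_div]
      have := hvi i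
      gcongr
    have h4 : ‖((β : ℂ) - 2 * v) * (1 - v) / ((v + i) * ((i : ℂ) + 1))‖
        ≤ E * E / (η * (i + 1) * (i + 1)) := by
      have h5 : ‖(i : ℂ) + 1‖ = (i : ℝ) + 1 := by
        rw [← Nat.cast_succ, Complex.norm_natCast]; push_cast; rfl
      rw [norm_div, norm_mul, norm_mul, h5]
      have := hvi i
      gcongr
    have h5 : ζ.re ≤ (β - 2 * v.re) * (1 / ((i : ℝ) + 1)) + E * E / (η * (i + 1) * (i + 1)) := by
      have h6 := (Complex.re_le_norm _).trans h4
      rw [h2, Complex.add_re, Complex.re_mul_ofReal]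
      simp only [Complex.sub_re, Complex.ofReal_re, Complex.mul_re, Complex.re_ofNat,
        Complex.im_ofNat, zero_mul, sub_zero] at h6 ⊢
      linarith
    have h7 : ‖ζ‖ ^ 2 ≤ (E / (η * (i + 1))) ^ 2 := by gcongr
    rw [h1]
    refine (norm_one_add_le_exp ζ).trans (Real.exp_le_exp.2 ?_)
    refine (add_le_add h5 (div_le_div_of_nonneg_right h7 two_pos.le)).trans (le_of_eq ?_)
    rw [hD]
    field_simp
    ring
  have hprod : ‖ratF (β : ℂ) N v‖ ≤ Real.exp ((β - 2 * v.re)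
      * (∑ i ∈ Finset.range N, 1 / ((i : ℝ) + 1))
      + D * ∑ i ∈ Finset.range N, 1 / ((i : ℝ) + 1) ^ 2) := by
    rw [ratF, ← Finset.prod_div_distrib, norm_prod, Finset.mul_sum, Finset.mul_sum,
      ← Finset.sum_add_distrib, Real.exp_sum]
    exact Finset.prod_le_prod (fun _ _ => norm_nonneg _) hfac
  have hpow : ‖(N : ℂ) ^ (2 * v - β)‖ = Real.exp (-((β - 2 * v.re) * Real.log N)) := by
    rw [Complex.norm_natCast_cpow_of_pos (by omega), Real.rpow_def_of_pos hN']
    congr 1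
    simp; ring
  rw [scaledRatF, norm_mul, hpow]
  refine (mul_le_mul_of_nonneg_right hprod (Real.exp_pos _).le).trans ?_
  rw [← Real.exp_add]
  refine Real.exp_le_exp.2 ?_
  have h8 : (β - 2 * v.re) * (∑ i ∈ Finset.range N, 1 / ((i : ℝ) + 1) - Real.log N) ≤ E := by
    refine (le_abs_self _).trans ?_
    rw [abs_mul]
    have h9 : |β - 2 * v.re| ≤ E := by
      have := (Complex.abs_re_le_norm ((β : ℂ) - 2 * v)).trans e1
      simpa using this
    calc _ ≤ E * 1 := mul_le_mul h9 (abs_sum_inv_sub_log_le hN) (abs_nonneg _) hE0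
      _ = E := mul_one E
  have h10 := mul_le_mul_of_nonneg_left (sum_inv_sq_le N) hD0
  linarith

theorem ratF_sub_one {β : ℂ} {N : ℕ} {v : ℂ} (h1 : v - 1 ≠ 0) (h2 : β - v ≠ 0)
    (h3 : ∀ i : ℕ, v + i ≠ 0) (h4 : ∀ i : ℕ, v - 1 + i ≠ 0) :
    ratF β N (v - 1) = ratF β N v * ((1 + N / (β - v)) * (1 + N / (v - 1))) := by
  have e1 : (∏ i ∈ Finset.range N, (β - v + ((i + 1 : ℕ) : ℂ))) * (β - v)
      = (∏ i ∈ Finset.range N, (β - v + i)) * (β - v + N) := by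
    rw [← Finset.prod_range_succ (fun i : ℕ => β - v + i), Finset.prod_range_succ']
    simp
  have e2 : (∏ i ∈ Finset.range N, (v - 1 + i)) * (v - 1 + N)
      = (∏ i ∈ Finset.range N, (v + i)) * (v - 1) := by
    rw [← Finset.prod_range_succ (fun i : ℕ => v - 1 + i), Finset.prod_range_succ']
    simp only [Nat.cast_zero, add_zero]
    congr 1
    refine Finset.prod_congr rfl fun i _ => ?_
    push_cast; ring
  have e3 : ∏ i ∈ Finset.range N, (β - (v - 1) + i)
      = ∏ i ∈ Finset.range N, (β - v + ((i + 1 : ℕ) : ℂ)) :=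
    Finset.prod_congr rfl fun i _ => by push_cast; ring
  have n1 : ∏ i ∈ Finset.range N, (v + i) ≠ 0 := Finset.prod_ne_zero_iff.2 fun i _ => h3 i
  have n2 : ∏ i ∈ Finset.range N, (v - 1 + i) ≠ 0 := Finset.prod_ne_zero_iff.2 fun i _ => h4 i
  rw [ratF, ratF, e3]
  generalize (∏ i ∈ Finset.range N, (β - v + ((i + 1 : ℕ) : ℂ))) = p1 at *
  generalize (∏ i ∈ Finset.range N, (β - v + i)) = p2 at *
  generalize (∏ i ∈ Finset.range N, (v - 1 + i)) = p3 at *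
  generalize (∏ i ∈ Finset.range N, (v + i)) = p4 at *
  rw [← sub_eq_zero] at e2 e1
  field_simp
  have e1' : p2 * (β - v + N) = p1 * (β - v) := by linear_combination -e1
  have e2' : p4 * (v - 1) = p3 * (v - 1 + N) := by linear_combination -e2
  calc _ = (p1 * (β - v)) * (p4 * (v - 1)) := by ring
    _ = _ := by rw [← e1', e2']; ring

/-- The shift multiplies `ratF` by two factors of size at most N(1 + 1/δ), and N^{2u-β} returns
N^{-2}. A unit step to the left thus costs a constant independent of N. -/
theorem norm_scaledRatF_sub_one_le {β δ : ℝ} (hδ : 0 < δ) {N : ℕ} (hN : 1 ≤ N) {v : ℂ}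
    (hv : |v.im| = δ) :
    ‖scaledRatF β N (v - 1)‖ ≤ (1 + 1 / δ) ^ 2 * ‖scaledRatF β N v‖ := by
  have him : v.im ≠ 0 := fun h => by rw [h, abs_zero] at hv; linarith
  have hN' : (1 : ℝ) ≤ N := by exact_mod_cast hN
  have hN0 : (N : ℂ) ≠ 0 := by exact_mod_cast (by omega : N ≠ 0)
  have n1 : δ ≤ ‖v - 1‖ := by
    have := Complex.abs_im_le_norm (v - 1)
    simpa [hv] using this
  have n2 : δ ≤ ‖(β : ℂ) - v‖ := by
    have := Complex.abs_im_le_norm ((β : ℂ) - v)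
    simpa [hv] using this
  have hb : ∀ w : ℂ, δ ≤ ‖w‖ → ‖1 + N / w‖ ≤ N * (1 + 1 / δ) := by
    intro w hw
    refine (norm_add_le _ _).trans ?_
    rw [norm_one, norm_div, Complex.norm_natCast, mul_add, mul_one, mul_one_div]
    gcongr
  rw [scaledRatF, scaledRatF, ratF_sub_one (norm_pos_iff.1 (hδ.trans_le n1))
    (norm_pos_iff.1 (hδ.trans_le n2)) (add_natCast_ne_zero_of_im_ne_zero him)
    (add_natCast_ne_zero_of_im_ne_zero (by simpa using him)),
    show 2 * (v - 1) - (β : ℂ) = 2 * v - β - (2 : ℕ) by push_cast; ring,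
    Complex.cpow_sub _ _ hN0, Complex.cpow_natCast]
  simp only [norm_mul, norm_div, norm_pow, Complex.norm_natCast]
  have h1 := hb _ n1
  have h2 := hb _ n2
  have hN2 : (0 : ℝ) < N := by linarith
  calc ‖ratF (β : ℂ) N v‖ * (‖1 + N / ((β : ℂ) - v)‖ * ‖1 + N / (v - 1)‖)
        * (‖(N : ℂ) ^ (2 * v - (β : ℂ))‖ / N ^ 2)
      ≤ ‖ratF (β : ℂ) N v‖ * ((N * (1 + 1 / δ)) * (N * (1 + 1 / δ)))
        * (‖(N : ℂ) ^ (2 * v - (β : ℂ))‖ / N ^ 2) := by gcongr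
    _ = _ := by field_simp

/-- Near the vertex the compact bound applies; further left it is propagated by unit steps along the
horizontal rays, each costing e^M. -/
theorem norm_scaledRatF_le (β : ℝ) {γ : HankelLoop} (hγ : 0 < γ.vertex) :
    ∃ C M, 0 ≤ C ∧ 0 ≤ M ∧ ∀ N : ℕ, 1 ≤ N → ∀ u ∈ γ.carrier,
      ‖scaledRatF β N u‖ ≤ C * Real.exp (M * (γ.vertex - u.re)) := by
  have hw := γ.width_pos
  -- This gives |u+i| ≥ η(i+1): for i = 0 on the rays by the imaginary part, otherwise by the real
  -- part, where Re u + i > vertex - 1 + i.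
  set η : ℝ := min γ.width (min γ.vertex 1 / 2) with hη
  have hη0 : 0 < η := lt_min hw (by positivity)
  have hη1 : η ≤ γ.width := min_le_left _ _
  have hη2 : η ≤ min γ.vertex 1 / 2 := min_le_right _ _
  have hη3 : η ≤ γ.vertex / 2 := hη2.trans (by have := min_le_left γ.vertex 1; linarith)
  have hη4 : η ≤ 1 / 2 := hη2.trans (by have := min_le_right γ.vertex 1; linarith)
  obtain ⟨C, hC0, hC⟩ := norm_scaledRatF_le_of_compact β (γ.vertex + 1 + γ.width) hη0
  set M : ℝ := Real.log ((1 + 1 / γ.width) ^ 2) with hM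
  have h1 : 1 ≤ (1 + 1 / γ.width) ^ 2 := by
    have : 0 < 1 / γ.width := by positivity
    nlinarith
  have hM0 : 0 ≤ M := Real.log_nonneg h1
  have hMe : Real.exp M = (1 + 1 / γ.width) ^ 2 := Real.exp_log (by positivity)
  have hbase : ∀ N : ℕ, 1 ≤ N → ∀ u ∈ γ.carrier, γ.vertex - 1 < u.re →
      ‖scaledRatF β N u‖ ≤ C := by
    intro N hN u hu hre
    have hu1 := γ.re_le hu
    have hu2 := γ.abs_im_le hu
    refine hC N hN u ?_ fun i => ?_
    · refine (Complex.norm_le_abs_re_add_abs_im u).trans (add_le_add ?_ hu2)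
      rw [abs_le]; constructor <;> linarith
    · have hre' : u.re + i ≤ ‖u + i‖ := by simpa using Complex.re_le_norm (u + i)
      have him' : |u.im| ≤ ‖u + i‖ := by simpa using Complex.abs_im_le_norm (u + i)
      rcases hu with hu | hu
      · rcases i with _ | i
        · rw [hu.2] at him'
          push_cast at him' ⊢
          linarith
        · refine le_trans ?_ hre'
          push_cast
          have : (0 : ℝ) ≤ i := by positivity
          nlinarith
      · refine le_trans ?_ hre'
        rw [hu.1]
        have : (0 : ℝ) ≤ i := by positivity
        nlinarith
  have hind : ∀ n : ℕ, ∀ N : ℕ, 1 ≤ N → ∀ u : ℂ, u.re ≤ γ.vertex → |u.im| = γ.width →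
      γ.vertex - 1 - n < u.re → ‖scaledRatF β N u‖ ≤ C * Real.exp (M * (γ.vertex - u.re)) := by
    intro n
    induction n with
    | zero =>
      intro N hN u h1 h2 h3
      refine (hbase N hN u (Or.inl ⟨h1, h2⟩) (by simpa using h3)).trans ?_
      exact le_mul_of_one_le_right hC0 (Real.one_le_exp (mul_nonneg hM0 (by linarith)))
    | succ n ih =>
      intro N hN u h1 h2 h3
      by_cases h4 : γ.vertex - 1 - n < u.re
      · exact ih N hN u h1 h2 h4
      · rw [not_lt] at h4
        have hn : (0 : ℝ) ≤ n := by positivity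
        push_cast at h3
        have h5 := ih N hN (u + 1) (by simp; linarith) (by simpa using h2) (by simp; linarith)
        have h6 := norm_scaledRatF_sub_one_le (β := β) hw hN (v := u + 1) (by simpa using h2)
        rw [add_sub_cancel_right, ← hMe] at h6
        refine h6.trans ((mul_le_mul_of_nonneg_left h5 (Real.exp_pos _).le).trans (le_of_eq ?_))
        rw [mul_left_comm, ← Real.exp_add]
        congr 2
        simp; ring
  refine ⟨C, M, hC0, hM0, fun N hN u hu => ?_⟩
  rcases id hu with hu' | hu'
  · obtain ⟨n, hn⟩ := exists_nat_gt (γ.vertex - 1 - u.re)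
    exact hind n N hN u hu'.1 hu'.2 (by linarith)
  · refine (hbase N hN u hu (by linarith [hu'.1])).trans ?_
    exact le_mul_of_one_le_right hC0
      (Real.one_le_exp (mul_nonneg hM0 (by linarith [hu'.1])))

/-- A quotient of Gauss products for Γ(u) and Γ(β-u). Those run over i ≤ N, one factor more than
`ratF`; the surplus (u+N)/(β-u+N) tends to 1. -/
theorem tendsto_scaledRatF (β : ℝ) {u : ℂ} (hu : u.im ≠ 0) :
    Tendsto (fun N : ℕ => scaledRatF β N u) atTop
      (𝓝 (Complex.Gamma u / Complex.Gamma (β - u))) := by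
  have hβu : ((β : ℂ) - u).im ≠ 0 := by simpa using hu
  have h1 := (Complex.GammaSeq_tendsto_Gamma u).div (Complex.GammaSeq_tendsto_Gamma (β - u))
    (Gamma_ne_zero_of_im_ne_zero hβu)
  have h2 : Tendsto (fun N : ℕ => (u + N) / (β - u + N)) atTop (𝓝 1) := by
    have h4 : ∀ w : ℂ, Tendsto (fun N : ℕ => w / N + 1) atTop (𝓝 1) := fun w => by
      simpa using (tendsto_const_div_atTop_nhds_zero_nat w).add_const 1
    have h5 := (h4 u).div (h4 (β - u)) one_ne_zero
    rw [div_one] at h5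
    refine h5.congr' ?_
    filter_upwards [eventually_gt_atTop 0] with N hN
    have hN0 : (N : ℂ) ≠ 0 := by exact_mod_cast hN.ne'
    have n4 := add_natCast_ne_zero_of_im_ne_zero hβu N
    rw [Pi.div_apply]
    field_simp
  have h3 := h1.mul h2
  rw [mul_one] at h3
  refine h3.congr' ?_
  filter_upwards [eventually_gt_atTop 0] with N hN
  have hN0 : (N : ℂ) ≠ 0 := by exact_mod_cast hN.ne'
  simp only [Pi.div_apply, Complex.GammaSeq, scaledRatF, ratF, Finset.prod_range_succ]
  have n1 : ∏ i ∈ Finset.range N, (u + i) ≠ 0 :=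
    Finset.prod_ne_zero_iff.2 fun i _ => add_natCast_ne_zero_of_im_ne_zero hu i
  have n2 : ∏ i ∈ Finset.range N, (β - u + i) ≠ 0 :=
    Finset.prod_ne_zero_iff.2 fun i _ => add_natCast_ne_zero_of_im_ne_zero hβu i
  have n3 := add_natCast_ne_zero_of_im_ne_zero hu N
  have n4 := add_natCast_ne_zero_of_im_ne_zero hβu N
  have n5 : (N.factorial : ℂ) ≠ 0 := by exact_mod_cast N.factorial_ne_zero
  have n6 : (N : ℂ) ^ ((β : ℂ) - u) ≠ 0 := by simp [Complex.cpow_eq_zero_iff, hN0]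
  rw [show 2 * u - (β : ℂ) = u - (β - u) by ring, Complex.cpow_sub u _ hN0]
  generalize (N : ℂ) ^ ((β : ℂ) - u) = y at *
  generalize (N : ℂ) ^ u = x at *
  field_simp

/-! ### Loop integrals of `(β - u)_N / (u)_N H(u) z^{-u}` and their limits -/

/-- `H` is continuous on the loop and decays to the left faster than any exponential. -/
structure LoopDecay (γ : HankelLoop) (H : ℂ → ℂ) : Prop where
  continuousOn : ContinuousOn H γ.carrier
  norm_le : ∀ L : ℝ, ∃ C, 0 ≤ C ∧ ∀ u ∈ γ.carrier, ‖H u‖ ≤ C * Real.exp (L * u.re)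

theorem add_natCast_ne_zero_of_mem {γ : HankelLoop} (hγ : 0 < γ.vertex) {u : ℂ}
    (hu : u ∈ γ.carrier) (i : ℕ) : u + i ≠ 0 := by
  rcases hu with hu | hu
  · refine add_natCast_ne_zero_of_im_ne_zero (fun h => ?_) i
    rw [h, abs_zero] at hu
    exact γ.width_pos.ne hu.2
  · intro h
    have := congrArg Complex.re h
    simp only [Complex.add_re, hu.1, Complex.natCast_re, Complex.zero_re] at this
    have : (0 : ℝ) ≤ i := by positivity
    linarith

theorem continuousOn_ratF {γ : HankelLoop} (hγ : 0 < γ.vertex) (β : ℂ) (N : ℕ) :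
    ContinuousOn (ratF β N) γ.carrier := by
  refine ContinuousOn.div (by fun_prop) (by fun_prop) fun u hu => ?_
  exact Finset.prod_ne_zero_iff.2 fun i _ => add_natCast_ne_zero_of_mem hγ hu i

theorem continuous_cpow_neg {z : ℝ} (hz : 0 < z) : Continuous fun u : ℂ => (z : ℂ) ^ (-u) :=
  Continuous.const_cpow (by fun_prop) (Or.inl (by exact_mod_cast hz.ne'))

theorem norm_cpow_neg {z : ℝ} (hz : 0 < z) (u : ℂ) : ‖(z : ℂ) ^ (-u)‖ = z ^ (-u.re) := by
  rw [Complex.norm_cpow_eq_rpow_re_of_pos hz, Complex.neg_re]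

theorem rpow_neg_le {z Z c s : ℝ} (hz : 0 < z) (hzZ : z ≤ Z) (hs : s ≤ c) :
    z ^ (-s) ≤ z ^ (-c) * Real.exp (Real.log Z * (c - s)) := by
  have hZ := hz.trans_le hzZ
  rw [← Real.rpow_def_of_pos hZ, show -s = -c + (c - s) by ring, Real.rpow_add hz]
  have := Real.rpow_le_rpow hz.le hzZ (sub_nonneg.2 hs)
  gcongr

section LoopDecay

variable {γ : HankelLoop} {H : ℂ → ℂ}

theorem LoopDecay.norm_scaled_le (hH : LoopDecay γ H) (hγ : 0 < γ.vertex) (β Z : ℝ) :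
    ∃ C, 0 ≤ C ∧ ∀ N : ℕ, 1 ≤ N → ∀ z : ℝ, 0 < z → z ≤ Z → ∀ u ∈ γ.carrier,
      ‖scaledRatF β N u * H u * (z : ℂ) ^ (-u)‖ ≤ C * z ^ (-γ.vertex) * Real.exp u.re := by
  obtain ⟨C₁, M, hC₁, hM, h1⟩ := norm_scaledRatF_le β hγ
  obtain ⟨C₂, hC₂, h2⟩ := hH.norm_le (M + Real.log Z + 1)
  refine ⟨C₁ * C₂ * Real.exp ((M + Real.log Z) * γ.vertex), by positivity,
    fun N hN z hz hzZ u hu => ?_⟩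
  rw [norm_mul, norm_mul, norm_cpow_neg hz]
  have h3 := rpow_neg_le hz hzZ (γ.re_le hu)
  calc ‖scaledRatF β N u‖ * ‖H u‖ * z ^ (-u.re)
      ≤ (C₁ * Real.exp (M * (γ.vertex - u.re))) * (C₂ * Real.exp ((M + Real.log Z + 1) * u.re))
        * (z ^ (-γ.vertex) * Real.exp (Real.log Z * (γ.vertex - u.re))) := by
        gcongr
        · exact h1 N hN u hu
        · exact h2 u hu
    _ = C₁ * C₂ * z ^ (-γ.vertex) * (Real.exp (M * (γ.vertex - u.re))
        * Real.exp ((M + Real.log Z + 1) * u.re)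
        * Real.exp (Real.log Z * (γ.vertex - u.re))) := by ring
    _ = C₁ * C₂ * z ^ (-γ.vertex) * (Real.exp ((M + Real.log Z) * γ.vertex)
        * Real.exp u.re) := by
        rw [← Real.exp_add, ← Real.exp_add, ← Real.exp_add]; congr 2; ring
    _ = _ := by ring

theorem continuousOn_scaled (hH : LoopDecay γ H) (hγ : 0 < γ.vertex) (β : ℝ) {N : ℕ} (hN : 1 ≤ N)
    {z : ℝ} (hz : 0 < z) :
    ContinuousOn (fun u => scaledRatF β N u * H u * (z : ℂ) ^ (-u)) γ.carrier := by
  have hN0 : (N : ℂ) ≠ 0 := by exact_mod_cast (by omega : N ≠ 0)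
  refine ((((continuousOn_ratF hγ _ N).mul ?_).mul hH.continuousOn).mul
    (continuous_cpow_neg hz).continuousOn)
  exact (Continuous.const_cpow (by fun_prop) (Or.inl hN0)).continuousOn

theorem ratF_mul_cpow (β : ℝ) {N : ℕ} (hN : 1 ≤ N) {z : ℝ} (hz : 0 < z) (u : ℂ) :
    ratF (β : ℂ) N u * H u * ((z / N ^ 2 : ℝ) : ℂ) ^ (-u)
      = ((N : ℝ) ^ β : ℝ) * (scaledRatF β N u * H u * (z : ℂ) ^ (-u)) := by
  have hN' : (0 : ℝ) < N := by exact_mod_cast hN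
  have hN0 : (N : ℂ) ≠ 0 := by exact_mod_cast hN'.ne'
  have h1 : ((z / N ^ 2 : ℝ) : ℂ) ^ (-u) = (z : ℂ) ^ (-u) * (N : ℂ) ^ (2 * u) := by
    rw [div_eq_mul_inv, Complex.ofReal_mul, Complex.mul_cpow_ofReal_nonneg hz.le (by positivity)]
    congr 1
    rw [Complex.ofReal_inv, Complex.inv_cpow _ _ (by
      rw [Complex.arg_ofReal_of_nonneg (by positivity)]; exact Real.pi_ne_zero.symm),
      Complex.cpow_neg, inv_inv]
    push_cast
    rw [two_mul, Complex.cpow_add _ _ hN0, pow_two, Complex.natCast_mul_natCast_cpow]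
  have h2 : (((N : ℝ) ^ β : ℝ) : ℂ) = (N : ℂ) ^ (β : ℂ) := by
    rw [Complex.ofReal_cpow hN'.le]; simp
  rw [h1, h2, scaledRatF, Complex.cpow_sub _ _ hN0]
  have h3 : (N : ℂ) ^ (β : ℂ) ≠ 0 := by simp [Complex.cpow_eq_zero_iff, hN0]
  generalize (N : ℂ) ^ (β : ℂ) = x at *
  field_simp

/-- The loop integral of `(β - u)_N / (u)_N H(u) z^{-u}`. -/
def loopN (γ : HankelLoop) (β : ℝ) (H : ℂ → ℂ) (N : ℕ) (z : ℝ) : ℂ :=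
  loopIntegral γ fun u => ratF (β : ℂ) N u * H u * (z : ℂ) ^ (-u)

/-- The loop integral of `Γ(u) / Γ(β - u) H(u) z^{-u}`. -/
def loopInf (γ : HankelLoop) (β : ℝ) (H : ℂ → ℂ) (z : ℝ) : ℂ :=
  loopIntegral γ fun u => Complex.Gamma u / Complex.Gamma (β - u) * H u * (z : ℂ) ^ (-u)

theorem LoopDecay.loopIntegrable_ratF (hH : LoopDecay γ H) (hγ : 0 < γ.vertex) (β : ℝ) {N : ℕ}
    (hN : 1 ≤ N) {z : ℝ} (hz : 0 < z) :
    LoopIntegrable γ fun u => ratF (β : ℂ) N u * H u * (z : ℂ) ^ (-u) := by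
  have hN' : (0 : ℝ) < N := by exact_mod_cast hN
  have hz' : 0 < z * N ^ 2 := by positivity
  -- The bound is stated for argument z/N² in the unscaled integrand, so it is used at z N².
  obtain ⟨C, -, hC⟩ := hH.norm_scaled_le hγ β (z * N ^ 2)
  have h1 : LoopIntegrable γ fun u => scaledRatF β N u * H u * ((z * N ^ 2 : ℝ) : ℂ) ^ (-u) :=
    loopIntegrable_of_norm_le (continuousOn_scaled hH hγ β hN hz')
      fun u hu _ => hC N hN _ hz' le_rfl u hu
  refine (h1.const_mul (((N : ℝ) ^ β : ℝ) : ℂ)).congr fun u _ => ?_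
  rw [← ratF_mul_cpow β hN hz', mul_div_cancel_right₀ _ (by positivity)]

theorem loopN_scaled (β : ℝ) {N : ℕ} (hN : 1 ≤ N) {z : ℝ} (hz : 0 < z) :
    (((N : ℝ) ^ (-β) : ℝ) : ℂ) * loopN γ β H N (z / N ^ 2)
      = loopIntegral γ fun u => scaledRatF β N u * H u * (z : ℂ) ^ (-u) := by
  have hN' : (0 : ℝ) < N := by exact_mod_cast hN
  rw [loopN, funext (ratF_mul_cpow (H := H) β hN hz), loopIntegral_const_mul, ← mul_assoc,
    ← Complex.ofReal_mul, ← Real.rpow_add hN', neg_add_cancel, Real.rpow_zero,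
    Complex.ofReal_one, one_mul]

theorem LoopDecay.norm_loopN_le (hH : LoopDecay γ H) (hγ : 0 < γ.vertex) (β Z : ℝ) :
    ∃ C, 0 ≤ C ∧ ∀ N : ℕ, 1 ≤ N → ∀ z : ℝ, 0 < z → z ≤ Z →
      ‖(((N : ℝ) ^ (-β) : ℝ) : ℂ) * loopN γ β H N (z / N ^ 2)‖ ≤ C * z ^ (-γ.vertex) := by
  obtain ⟨C, hC0, hC⟩ := hH.norm_scaled_le hγ β Z
  obtain ⟨K, hK0, hK⟩ := norm_loopIntegral_le γ
  refine ⟨K * C, by positivity, fun N hN z hz hzZ => ?_⟩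
  rw [loopN_scaled β hN hz, mul_assoc]
  exact hK _ _ (by positivity) (hC N hN z hz hzZ)

theorem LoopDecay.tendsto_loopN (hH : LoopDecay γ H) (hγ : 0 < γ.vertex) (β : ℝ) {z : ℝ}
    (hz : 0 < z) :
    Tendsto (fun N : ℕ => (((N : ℝ) ^ (-β) : ℝ) : ℂ) * loopN γ β H N (z / N ^ 2)) atTop
      (𝓝 (loopInf γ β H z)) := by
  obtain ⟨C, hC0, hC⟩ := hH.norm_scaled_le hγ β z
  have h1 : Tendsto (fun N : ℕ => loopIntegral γ
      fun u => scaledRatF β N u * H u * (z : ℂ) ^ (-u)) atTop (𝓝 (loopInf γ β H z)) := by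
    refine tendsto_loopIntegral (C := C * z ^ (-γ.vertex)) ?_ ?_ ?_
    · filter_upwards [eventually_ge_atTop 1] with N hN using continuousOn_scaled hH hγ β hN hz
    · filter_upwards [eventually_ge_atTop 1] with N hN using hC N hN z hz le_rfl
    · intro u _ hu
      exact ((tendsto_scaledRatF β hu).mul_const _).mul_const _
  refine h1.congr' ?_
  filter_upwards [eventually_ge_atTop 1] with N hN
  rw [loopN_scaled β hN hz]

theorem LoopDecay.loopIntegrable_inf (hH : LoopDecay γ H) (hγ : 0 < γ.vertex) (β : ℝ) {z : ℝ}
    (hz : 0 < z) :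
    LoopIntegrable γ
      fun u => Complex.Gamma u / Complex.Gamma (β - u) * H u * (z : ℂ) ^ (-u) := by
  obtain ⟨C, hC0, hC⟩ := hH.norm_scaled_le hγ β z
  refine loopIntegrable_of_norm_le (C := C * z ^ (-γ.vertex)) ?_ fun u hu him => ?_
  · refine ((ContinuousOn.mul (fun u hu => ?_) ?_).mul hH.continuousOn).mul
      (continuous_cpow_neg hz).continuousOn
    · refine (Complex.differentiableAt_Gamma u fun m h => ?_).continuousAt.continuousWithinAt
      exact add_natCast_ne_zero_of_mem hγ hu m (by rw [h]; ring)
    · exact (Complex.differentiable_one_div_Gamma.continuous.comp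
        (continuous_const.sub continuous_id)).continuousOn
  -- The bound is uniform in N and passes to the pointwise limit.
  · refine le_of_tendsto (((tendsto_scaledRatF β him).mul_const _).mul_const _).norm ?_
    filter_upwards [eventually_ge_atTop 1] with N hN using hC N hN z hz le_rfl u hu

end LoopDecay

/-! ### The two families of integrands -/

theorem norm_invGamma_le {θ : ℝ} (hθ : 0 < θ) (κ L c δ : ℝ) :
    ∃ C, 0 ≤ C ∧ ∀ u : ℂ, u.re ≤ c → |u.im| ≤ δ →
      ‖(Complex.Gamma (κ - θ * u + 1))⁻¹‖ ≤ C * Real.exp (L * u.re) := by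
  obtain ⟨C, hC0, hC⟩ := exists_norm_Gamma_inv_le_exp (κ - θ * c + 1) (L / θ) (θ * δ)
  refine ⟨C * Real.exp (-(L / θ * (κ + 1))), by positivity, fun u h1 h2 => ?_⟩
  have hre : ((κ : ℂ) - θ * u + 1).re = κ - θ * u.re + 1 := by simp
  have him : ((κ : ℂ) - θ * u + 1).im = -(θ * u.im) := by simp
  have h3 := hC ((κ : ℂ) - θ * u + 1) (by rw [hre]; nlinarith)
    (by rw [him, abs_neg, abs_mul, abs_of_pos hθ]; gcongr)
  rw [hre] at h3
  refine h3.trans (le_of_eq ?_)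
  rw [mul_assoc, ← Real.exp_add]
  congr 2
  field_simp
  ring

theorem loopDecay_invGamma {θ : ℝ} (hθ : 0 < θ) (κ : ℝ) (γ : HankelLoop) :
    LoopDecay γ fun u => (Complex.Gamma (κ - θ * u + 1))⁻¹ := by
  refine ⟨(Complex.differentiable_one_div_Gamma.continuous.comp
    (by fun_prop : Continuous fun u : ℂ => (κ : ℂ) - θ * u + 1)).continuousOn, fun L => ?_⟩
  obtain ⟨C, hC0, hC⟩ := norm_invGamma_le hθ κ L γ.vertex γ.width
  exact ⟨C, hC0, fun u hu => hC u (γ.re_le hu) (γ.abs_im_le hu)⟩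

theorem norm_Gamma_linear_le {θ : ℝ} (hθ : 0 < θ) (κ L c : ℝ) {δ : ℝ} (hδ : 0 < δ) :
    ∃ C, 0 ≤ C ∧ ∀ u : ℂ, u.re ≤ c → δ ≤ |u.im| →
      ‖Complex.Gamma (θ * u - κ)‖ * u.im ^ 2 ≤ C * Real.exp (L * u.re) := by
  obtain ⟨C, hC0, hC⟩ := exists_norm_Gamma_le_exp (θ * c - κ) (L / θ) (mul_pos hθ hδ)
  refine ⟨C * Real.exp (-(L / θ * κ)) / θ ^ 2, by positivity, fun u h1 h2 => ?_⟩
  have hre : ((θ : ℂ) * u - κ).re = θ * u.re - κ := by simp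
  have him : ((θ : ℂ) * u - κ).im = θ * u.im := by simp
  have h3 := hC ((θ : ℂ) * u - κ) (by rw [hre]; nlinarith)
    (by rw [him, abs_mul, abs_of_pos hθ]; gcongr)
  rw [hre, him] at h3
  rw [div_mul_eq_mul_div, le_div_iff₀ (by positivity), mul_assoc C, ← Real.exp_add]
  have h4 : -(L / θ * κ) + L * u.re = L / θ * (θ * u.re - κ) := by field_simp; ring
  rw [h4]
  linarith

theorem Gamma_linear_arg_ne {θ κ : ℝ} (hθ : 0 < θ) {u : ℂ}
    (hu : u.im ≠ 0 ∨ κ / θ < u.re) (m : ℕ) : (θ : ℂ) * u - κ ≠ -m := by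
  intro h
  rcases hu with hu | hu
  · have := congrArg Complex.im h
    simp [hθ.ne', hu] at this
  · have := congrArg Complex.re h
    simp only [Complex.sub_re, Complex.re_ofReal_mul, Complex.ofReal_re, Complex.neg_re,
      Complex.natCast_re] at this
    rw [div_lt_iff₀ hθ] at hu
    have : (0 : ℝ) ≤ m := by positivity
    linarith

theorem differentiableAt_Gamma_linear {θ κ : ℝ} (hθ : 0 < θ) {u : ℂ}
    (hu : u.im ≠ 0 ∨ κ / θ < u.re) :
    DifferentiableAt ℂ (fun u : ℂ => Complex.Gamma (θ * u - κ)) u :=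
  (Complex.differentiableAt_Gamma _ (Gamma_linear_arg_ne hθ hu)).comp u (by fun_prop)

theorem HankelLoop.im_ne_zero_or (γ : HankelLoop) {u : ℂ} (hu : u ∈ γ.carrier) :
    u.im ≠ 0 ∨ u.re = γ.vertex := by
  rcases hu with hu | hu
  · left
    intro h
    rw [h, abs_zero] at hu
    exact γ.width_pos.ne hu.2
  · exact Or.inr hu.1

theorem norm_Gamma_linear_le_const {θ κ : ℝ} (hθ : 0 < θ) {u : ℂ} (hu : κ / θ < u.re) :
    ‖Complex.Gamma (θ * u - κ)‖ ≤ Real.Gamma (θ * u.re - κ) := by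
  rw [div_lt_iff₀ hθ] at hu
  have hre : ((θ : ℂ) * u - κ).re = θ * u.re - κ := by simp
  have := norm_Gamma_le_Gamma_re (s := (θ : ℂ) * u - κ) (by rw [hre]; linarith)
  rwa [hre] at this

theorem loopDecay_Gamma {θ : ℝ} (hθ : 0 < θ) {κ : ℝ} {γ : HankelLoop} (hγ : κ / θ < γ.vertex) :
    LoopDecay γ fun u => Complex.Gamma (θ * u - κ) := by
  have hw := γ.width_pos
  refine ⟨fun u hu => (differentiableAt_Gamma_linear hθ ?_).continuousAt.continuousWithinAt,
    fun L => ?_⟩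
  · exact (γ.im_ne_zero_or hu).imp_right fun h => by rwa [h]
  obtain ⟨C, hC0, hC⟩ := norm_Gamma_linear_le hθ κ L γ.vertex hw
  have hA : 0 < Real.Gamma (θ * γ.vertex - κ) := by
    rw [div_lt_iff₀ hθ] at hγ
    exact Real.Gamma_pos_of_pos (by linarith)
  -- The first summand serves the horizontal rays, the second the vertical edge, where Re u is
  -- constant.
  refine ⟨C / γ.width ^ 2 + Real.Gamma (θ * γ.vertex - κ) * Real.exp (-(L * γ.vertex)),
    by positivity, fun u hu => ?_⟩
  rw [add_mul]
  rcases hu with hu | hu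
  · have h1 := hC u hu.1 hu.2.ge
    rw [← sq_abs, hu.2] at h1
    have h2 : ‖Complex.Gamma (θ * u - κ)‖ ≤ C / γ.width ^ 2 * Real.exp (L * u.re) := by
      rw [div_mul_eq_mul_div, le_div_iff₀ (by positivity)]
      exact h1
    have : 0 ≤ Real.Gamma (θ * γ.vertex - κ) * Real.exp (-(L * γ.vertex))
        * Real.exp (L * u.re) := by positivity
    linarith
  · have h1 := norm_Gamma_linear_le_const hθ (u := u) (by rwa [hu.1])
    have : 0 ≤ C / γ.width ^ 2 * Real.exp (L * u.re) := by positivity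
    rw [hu.1] at h1 ⊢
    rw [mul_assoc (Real.Gamma _), ← Real.exp_add, neg_add_cancel, Real.exp_zero, mul_one]
    rw [hu.1] at this
    linarith

/-! ### Evaluation of the loop integrals -/

theorem HankelLoop.le_norm_add (γ : HankelLoop) {u : ℂ}
    (hu : γ.width ≤ |u.im| ∨ u.re = γ.vertex) (j : ℕ) :
    min γ.width γ.vertex ≤ ‖u + j‖ := by
  rcases hu with hu | hu
  · refine (min_le_left _ _).trans (hu.trans ?_)
    simpa using Complex.abs_im_le_norm (u + j)
  · refine (min_le_right _ _).trans ?_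
    have h1 := Complex.re_le_norm (u + j)
    simp only [Complex.add_re, Complex.natCast_re, hu] at h1
    have : (0 : ℝ) ≤ j := by positivity
    linarith

theorem HankelLoop.width_le_or (γ : HankelLoop) {u : ℂ} (hu : u ∈ γ.carrier) :
    γ.width ≤ |u.im| ∨ u.re = γ.vertex :=
  hu.imp (fun h => h.2.ge) fun h => h.1

section

variable {γ : HankelLoop}

theorem LoopDecay.norm_mul_cpow_le {H : ℂ → ℂ} (hH : LoopDecay γ H) {z : ℝ} (hz : 0 < z) :
    ∃ C, 0 ≤ C ∧ ∀ u ∈ γ.carrier, ‖H u * (z : ℂ) ^ (-u)‖ ≤ C * Real.exp u.re := by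
  obtain ⟨C, hC0, hC⟩ := hH.norm_le (Real.log z + 1)
  refine ⟨C, hC0, fun u hu => ?_⟩
  rw [norm_mul, norm_cpow_neg hz, Real.rpow_def_of_pos hz]
  refine (mul_le_mul_of_nonneg_right (hC u hu) (by positivity)).trans (le_of_eq ?_)
  rw [mul_assoc, ← Real.exp_add]
  congr 2
  ring

theorem LoopDecay.loopIntegrable_mul_cpow {H : ℂ → ℂ} (hH : LoopDecay γ H) {z : ℝ}
    (hz : 0 < z) : LoopIntegrable γ fun u => H u * (z : ℂ) ^ (-u) := by
  obtain ⟨C, -, hC⟩ := hH.norm_mul_cpow_le hz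
  exact loopIntegrable_of_norm_le (hH.continuousOn.mul (continuous_cpow_neg hz).continuousOn)
    fun u hu _ => hC u hu

theorem LoopDecay.div_add {H : ℂ → ℂ} (hH : LoopDecay γ H) (hγ : 0 < γ.vertex) (j : ℕ) :
    LoopDecay γ fun u => H u / (u + j) := by
  have hm : 0 < min γ.width γ.vertex := lt_min γ.width_pos hγ
  refine ⟨hH.continuousOn.div (by fun_prop) fun u hu => add_natCast_ne_zero_of_mem hγ hu j,
    fun L => ?_⟩
  obtain ⟨C, hC0, hC⟩ := hH.norm_le L
  refine ⟨C / min γ.width γ.vertex, by positivity, fun u hu => ?_⟩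
  rw [norm_div, div_mul_eq_mul_div]
  exact div_le_div₀ (by positivity) (hC u hu) hm (γ.le_norm_add (γ.width_le_or hu) j)

/-- With the partial fractions of `ratF` inserted, only the integrals of H and H/(u+j) remain to be
found. -/
theorem LoopDecay.loopN_eq {H : ℂ → ℂ} (hH : LoopDecay γ H) (hγ : 0 < γ.vertex) (β : ℝ) (N : ℕ)
    {z : ℝ} (hz : 0 < z) :
    loopN γ β H N z = (-1) ^ N * loopIntegral γ (fun u => H u * (z : ℂ) ^ (-u))
      + ∑ j ∈ Finset.range N, (coefA β N j : ℝ)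
        * loopIntegral γ (fun u => H u / (u + j) * (z : ℂ) ^ (-u)) := by
  have h1 : ∀ j ∈ Finset.range N, LoopIntegrable γ
      (fun u => ((coefA β N j : ℝ) : ℂ) * (H u / (u + j) * (z : ℂ) ^ (-u))) :=
    fun j _ => ((hH.div_add hγ j).loopIntegrable_mul_cpow hz).const_mul _
  have h2 := loopIntegral_sum _ h1
  have h3 := (hH.loopIntegrable_mul_cpow hz).const_mul ((-1) ^ N)
  have h4 : loopN γ β H N z = loopIntegral γ fun u => (-1) ^ N * (H u * (z : ℂ) ^ (-u))
      + ∑ j ∈ Finset.range N, ((coefA β N j : ℝ) : ℂ) * (H u / (u + j) * (z : ℂ) ^ (-u)) := by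
    refine loopIntegral_congr fun u hu => ?_
    rw [ratF_eq_sum _ _ fun i _ => add_natCast_ne_zero_of_im_ne_zero hu i, add_mul, add_mul,
      Finset.sum_mul, Finset.sum_mul]
    simp only [ofReal_coefA]
    congr 1
    · ring
    · exact Finset.sum_congr rfl fun j _ => by ring
  rw [h4, loopIntegral_add h3 h2.1, h2.2, loopIntegral_const_mul]
  simp only [loopIntegral_const_mul]

theorem differentiable_cpow_neg {z : ℝ} (hz : 0 < z) :
    Differentiable ℂ fun u : ℂ => (z : ℂ) ^ (-u) := fun u =>
  DifferentiableAt.const_cpow (by fun_prop) (Or.inl (by exact_mod_cast hz.ne'))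

/-- For the reciprocal Gamma function the loop integral is a polynomial. -/
theorem loopN_invGamma {θ : ℝ} (hθ : 0 < θ) (κ β : ℝ) (hγ : 0 < γ.vertex) (N : ℕ) {z : ℝ}
    (hz : 0 < z) :
    loopN γ β (fun u => (Complex.Gamma (κ - θ * u + 1))⁻¹) N z
      = ((∑ j ∈ Finset.range N, coefA β N j * (z ^ j / Real.Gamma (κ + j * θ + 1)) : ℝ) : ℂ) := by
  have hH := loopDecay_invGamma hθ κ γ
  obtain ⟨C, hC0, hC⟩ := norm_invGamma_le hθ κ (Real.log z + 1) γ.vertex γ.width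
  set g : ℂ → ℂ := fun u => (Complex.Gamma (κ - θ * u + 1))⁻¹ * (z : ℂ) ^ (-u) with hg
  have hgd : Differentiable ℂ g :=
    (Complex.differentiable_one_div_Gamma.comp (by fun_prop :
      Differentiable ℂ fun u : ℂ => (κ : ℂ) - θ * u + 1)).mul (differentiable_cpow_neg hz)
  have hgb : ∀ u : ℂ, u.re ≤ γ.vertex → |u.im| ≤ γ.width → ‖g u‖ ≤ C * Real.exp u.re := by
    intro u h1 h2
    rw [hg, norm_mul, norm_cpow_neg hz, Real.rpow_def_of_pos hz]
    refine (mul_le_mul_of_nonneg_right (hC u h1 h2) (by positivity)).trans (le_of_eq ?_)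
    rw [mul_assoc, ← Real.exp_add]
    congr 2
    ring
  have h0 : ∀ j : ℕ, (fun u => (Complex.Gamma (κ - θ * u + 1))⁻¹ / (u + j) * (z : ℂ) ^ (-u))
      = fun u => g u / (u + j) := fun j => by
    funext u; rw [hg]; ring
  -- The constant term integrates an entire function and vanishes; the j-th term is the residue at
  -- -j, z^j/Γ(κ + jθ + 1).
  rw [hH.loopN_eq hγ β N hz, loopIntegral_eq_zero hgd hgb, mul_zero, zero_add, Complex.ofReal_sum]
  refine Finset.sum_congr rfl fun j _ => ?_
  have h1 := (hH.div_add hγ j).loopIntegrable_mul_cpow hz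
  rw [h0] at h1 ⊢
  have hj : -(j : ℝ) < γ.vertex := by
    have : (0 : ℝ) ≤ j := by positivity
    linarith
  rw [loopIntegral_div_add hgd hC0 hgb j hj h1, Complex.ofReal_mul]
  congr 1
  rw [hg]
  push_cast
  rw [neg_neg, Complex.cpow_natCast, ← Complex.Gamma_ofReal]
  push_cast
  rw [show (κ : ℂ) - θ * -j + 1 = κ + j * θ + 1 by ring, div_eq_mul_inv, mul_comm]

/-- Mellin inversion along a loop, for a Mellin transform that is a bounded multiple of a Gamma
function. -/
theorem loopIntegral_Gamma_mul {θ : ℝ} (hθ : 0 < θ) {κ D : ℝ} (hγ : κ / θ < γ.vertex)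
    (hD : 0 ≤ D) {R : ℂ → ℂ}
    (hRd : ∀ u : ℂ, u.im ≠ 0 ∨ u.re = γ.vertex → DifferentiableAt ℂ R u)
    (hRb : ∀ u : ℂ, γ.width ≤ |u.im| ∨ u.re = γ.vertex → ‖R u‖ ≤ D)
    (hint : ∀ z : ℝ, 0 < z →
      LoopIntegrable γ fun u => Complex.Gamma (θ * u - κ) * R u * (z : ℂ) ^ (-u))
    {F : ℝ → ℝ} (hF : ContinuousOn F (Set.Ioi 0))
    (hmc : MellinConvergent (fun z => (F z : ℂ)) (γ.vertex : ℂ))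
    (hm : ∀ u : ℂ, u.re = γ.vertex →
      mellin (fun z => (F z : ℂ)) u = Complex.Gamma (θ * u - κ) * R u)
    {z : ℝ} (hz : 0 < z) :
    loopIntegral γ (fun u => Complex.Gamma (θ * u - κ) * R u * (z : ℂ) ^ (-u)) = F z := by
  have hw := γ.width_pos
  have hγ' := hγ
  rw [div_lt_iff₀ hθ] at hγ'
  set A := θ * γ.vertex - κ with hA
  have hA0 : 0 < A := by rw [hA]; linarith
  have hline : ∀ y : ℝ, ((γ.vertex : ℂ) + y * Complex.I).re = γ.vertex := fun y => by simp
  have hcont : Continuous fun y : ℝ => Complex.Gamma (θ * (γ.vertex + y * Complex.I) - κ)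
      * R (γ.vertex + y * Complex.I) := by
    refine continuous_iff_continuousAt.2 fun y => ?_
    have h1 : ContinuousAt (fun u : ℂ => Complex.Gamma (θ * u - κ) * R u)
        (γ.vertex + y * Complex.I) :=
      ((differentiableAt_Gamma_linear hθ (Or.inr (by rwa [hline]))).mul
        (hRd _ (Or.inr (hline y)))).continuousAt
    exact ContinuousAt.comp (f := fun y : ℝ => (γ.vertex : ℂ) + y * Complex.I) h1 (by fun_prop)
  -- Γ(A) bounds the Gamma factor and Γ(A+2)/θ² bounds y² times it; adding the two gives the
  -- integrable majorant 1/(1+y²).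
  have hvb : ∀ y : ℝ, ‖Complex.Gamma (θ * (γ.vertex + y * Complex.I) - κ)
      * R (γ.vertex + y * Complex.I)‖
        ≤ (Real.Gamma A + Real.Gamma (A + 2) / θ ^ 2) * D * (1 + y ^ 2)⁻¹ := by
    intro y
    have e1 : ((θ : ℂ) * (γ.vertex + y * Complex.I) - κ).re = A := by simp [hA]
    have e2 : ((θ : ℂ) * (γ.vertex + y * Complex.I) - κ).im = θ * y := by simp
    have h1 := norm_Gamma_le_Gamma_re (s := (θ : ℂ) * (γ.vertex + y * Complex.I) - κ)
      (by rw [e1]; exact hA0)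
    have h2 := norm_Gamma_mul_im_sq_le (s := (θ : ℂ) * (γ.vertex + y * Complex.I) - κ)
      (by rw [e1]; exact hA0)
    rw [e1] at h1 h2
    rw [e2] at h2
    have h3 := hRb _ (Or.inr (hline y))
    rw [norm_mul, mul_right_comm]
    refine mul_le_mul ?_ h3 (norm_nonneg _)
      (by have := Real.Gamma_pos_of_pos hA0
          have := Real.Gamma_pos_of_pos (by linarith : 0 < A + 2)
          positivity)
    rw [← div_eq_mul_inv, le_div_iff₀ (by positivity), mul_add, mul_one]
    refine add_le_add h1 ?_
    rw [le_div_iff₀ (by positivity)]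
    linarith
  have hvi : Integrable fun y : ℝ => Complex.Gamma (θ * (γ.vertex + y * Complex.I) - κ)
      * R (γ.vertex + y * Complex.I) :=
    (integrable_inv_one_add_sq.const_mul _).mono' hcont.aestronglyMeasurable
      (Eventually.of_forall hvb)
  obtain ⟨C, hC0, hC⟩ := norm_Gamma_linear_le hθ κ (Real.log z + 1) γ.vertex hw
  rw [loopIntegral_eq_vertical (C := C * D) (by positivity) (hint z hz)]
  · have hVI : Complex.VerticalIntegrable (mellin fun z => (F z : ℂ)) γ.vertex volume := by
      refine hvi.congr (Eventually.of_forall fun y => ?_)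
      exact (hm _ (hline y)).symm
    have h1 := mellinInv_mellin_eq γ.vertex (fun z => (F z : ℂ)) hz hmc hVI
      (Complex.continuous_ofReal.continuousAt.comp (hF.continuousAt (Ioi_mem_nhds hz)))
    rw [← h1, mellinInv, Complex.real_smul]
    push_cast
    rw [one_div]
    congr 1
    refine integral_congr_ae (Eventually.of_forall fun y => ?_)
    simp only [smul_eq_mul]
    rw [hm _ (hline y), mul_comm]
  · intro u hu
    exact ((differentiableAt_Gamma_linear hθ (Or.inl hu)).mul (hRd u (Or.inl hu))).mul
      (differentiable_cpow_neg hz u)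
  · intro u h1 h2
    rw [norm_mul, norm_mul, norm_cpow_neg hz, Real.rpow_def_of_pos hz]
    calc ‖Complex.Gamma (θ * u - κ)‖ * ‖R u‖ * Real.exp (Real.log z * -u.re) * u.im ^ 2
        = (‖Complex.Gamma (θ * u - κ)‖ * u.im ^ 2) * ‖R u‖ * Real.exp (Real.log z * -u.re) := by
          ring
      _ ≤ (C * Real.exp ((Real.log z + 1) * u.re)) * D * Real.exp (Real.log z * -u.re) := by
          refine mul_le_mul_of_nonneg_right ?_ (Real.exp_pos _).le
          exact mul_le_mul (hC u h1 h2) (hRb u (Or.inl h2)) (norm_nonneg _) (by positivity)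
      _ = C * D * (Real.exp ((Real.log z + 1) * u.re) * Real.exp (Real.log z * -u.re)) := by ring
      _ = _ := by rw [← Real.exp_add]; congr 2; ring
  · refine (hvi.norm.mul_const (z ^ (-γ.vertex))).mono' ?_ (Eventually.of_forall fun y => ?_)
    · exact (hcont.mul ((continuous_cpow_neg hz).comp (by fun_prop :
        Continuous fun y : ℝ => (γ.vertex : ℂ) + y * Complex.I))).aestronglyMeasurable
    · rw [norm_mul, norm_cpow_neg hz, hline]

/-- Mellin inversion with multiplier R = 1 yields `expFun`, and with R = 1/(u+j) it yields
`tailFun`. -/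
theorem loopN_Gamma {θ : ℝ} (hθ : 0 < θ) {κ : ℝ} (β : ℝ) (hγ : max 0 (κ / θ) < γ.vertex) (N : ℕ)
    {z : ℝ} (hz : 0 < z) :
    loopN γ β (fun u => Complex.Gamma (θ * u - κ)) N z
      = (((-1) ^ N * expFun θ κ z
        + ∑ j ∈ Finset.range N, coefA β N j * tailFun θ κ j z : ℝ) : ℂ) := by
  obtain ⟨hγ0, hγκ⟩ := max_lt_iff.1 hγ
  have hH := loopDecay_Gamma hθ hγκ
  have hm : 0 < min γ.width γ.vertex := lt_min γ.width_pos hγ0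
  rw [hH.loopN_eq hγ0 β N hz]
  push_cast
  congr 1
  · congr 1
    have h := loopIntegral_Gamma_mul hθ hγκ zero_le_one (R := fun _ => 1)
      (F := expFun θ κ) (fun u _ => by fun_prop) (fun u _ => by simp)
      (fun z hz => by simpa using hH.loopIntegrable_mul_cpow hz) (continuousOn_expFun θ κ)
      (mellinConvergent_expFun hθ (by simpa using hγκ))
      (fun u hu => by rw [mul_one, mellin_expFun hθ (by rwa [hu])]) hz
    simpa using h
  · refine Finset.sum_congr rfl fun j _ => ?_
    congr 1
    refine loopIntegral_Gamma_mul hθ hγκ (D := (min γ.width γ.vertex)⁻¹) (by positivity)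
      (R := fun u => (u + j)⁻¹) (F := tailFun θ κ j) (fun u hu => ?_) (fun u hu => ?_)
      (fun z hz => (hH.div_add hγ0 j).loopIntegrable_mul_cpow hz) (continuousOn_tailFun hθ j)
      (mellinConvergent_tailFun hθ j (by simpa using hγ))
      (fun u hu => by rw [mellin_tailFun hθ j (by rwa [hu]), div_eq_mul_inv]) hz
    · refine DifferentiableAt.inv (by fun_prop) ?_
      rcases hu with hu | hu
      · exact add_natCast_ne_zero_of_im_ne_zero hu j
      · exact norm_pos_iff.1 (hm.trans_le (γ.le_norm_add (Or.inr hu) j))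
    · rw [norm_inv]
      exact inv_anti₀ hm (γ.le_norm_add hu j)

end

/-! ### The functions `G`, `G̃` as loop integrals of `ratF` -/

theorem gamma_ratio_eq_ratF (α : ℝ) (N : ℕ) {u : ℂ} (hu : u.im ≠ 0) :
    Complex.Gamma u * Complex.Gamma (α + N + 1 - u)
      / (Complex.Gamma (N + u) * Complex.Gamma (α + 1 - u)) = ratF ((α + 1 : ℝ) : ℂ) N u := by
  have hv : ((α : ℂ) + 1 - u).im ≠ 0 := by simpa using hu
  have h1 := Gamma_add_natCast_eq N (u := u) fun i _ => add_natCast_ne_zero_of_im_ne_zero hu i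
  have h2 := Gamma_add_natCast_eq N (u := (α : ℂ) + 1 - u)
    fun i _ => add_natCast_ne_zero_of_im_ne_zero hv i
  have h3 := Gamma_ne_zero_of_im_ne_zero hu
  have h4 := Gamma_ne_zero_of_im_ne_zero hv
  rw [show (α : ℂ) + N + 1 - u = (α : ℂ) + 1 - u + N by ring, add_comm (N : ℂ) u, h1, h2, ratF]
  push_cast
  rw [show Complex.Gamma u * ((∏ i ∈ Finset.range N, ((α : ℂ) + 1 - u + i))
      * Complex.Gamma (α + 1 - u)) = (∏ i ∈ Finset.range N, ((α : ℂ) + 1 - u + i))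
      * (Complex.Gamma u * Complex.Gamma (α + 1 - u)) by ring, mul_assoc,
    mul_div_mul_right _ _ (mul_ne_zero h3 h4)]

theorem gIntegrand_eq (θ α κ : ℝ) (N : ℕ) (z : ℝ) {u : ℂ} (hu : u.im ≠ 0) :
    gIntegrand θ α κ N z u = ratF ((α + 1 : ℝ) : ℂ) N u * (Complex.Gamma (κ - θ * u + 1))⁻¹
      * (z : ℂ) ^ (-u) := by
  rw [gIntegrand, ← gamma_ratio_eq_ratF α N hu, ← div_div, div_eq_mul_inv _ (Complex.Gamma
    (κ - θ * u + 1))]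

theorem gTildeIntegrand'_eq (θ α κ : ℝ) (N : ℕ) (z : ℝ) {u : ℂ} (hu : u.im ≠ 0) :
    gTildeIntegrand' θ α κ N z u = ratF ((α + 1 : ℝ) : ℂ) N u * Complex.Gamma (θ * u - κ)
      * (z : ℂ) ^ (-u) := by
  rw [gTildeIntegrand', ← gamma_ratio_eq_ratF α N hu]
  ring

/-- The reflection formula π/sin(π(θu-κ)) = Γ(θu-κ) Γ(κ-θu+1), whose second factor cancels the
denominator of the integrand of G. -/
theorem gTildeIntegrand_eq {θ : ℝ} (hθ : 0 < θ) (α κ : ℝ) (N : ℕ) (z : ℝ) {u : ℂ}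
    (hu : u.im ≠ 0) :
    gTildeIntegrand θ α κ N z u = ratF ((α + 1 : ℝ) : ℂ) N u * Complex.Gamma (θ * u - κ)
      * (z : ℂ) ^ (-u) := by
  have h1 := Complex.Gamma_mul_Gamma_one_sub ((θ : ℂ) * u - κ)
  have h2 : Complex.Gamma ((κ : ℂ) - θ * u + 1) ≠ 0 :=
    Gamma_ne_zero_of_im_ne_zero (by simpa [hθ.ne'] using hu)
  rw [show (1 : ℂ) - (θ * u - κ) = κ - θ * u + 1 by ring,
    show (Real.pi : ℂ) * (θ * u - κ) = (u * θ - κ) * Real.pi by ring] at h1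
  rw [gTildeIntegrand, ← h1, gIntegrand_eq θ α κ N z hu]
  field_simp

theorem gInfIntegrand_eq (θ α κ z : ℝ) (u : ℂ) :
    gInfIntegrand θ α κ z u = Complex.Gamma u / Complex.Gamma ((α + 1 : ℝ) - u)
      * (Complex.Gamma (κ - θ * u + 1))⁻¹ * (z : ℂ) ^ (-u) := by
  rw [gInfIntegrand, ← div_div]
  push_cast
  ring

theorem gTildeInfIntegrand_eq (θ α κ z : ℝ) (u : ℂ) :
    gTildeInfIntegrand θ α κ z u = Complex.Gamma u / Complex.Gamma ((α + 1 : ℝ) - u)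
      * Complex.Gamma (θ * u - κ) * (z : ℂ) ^ (-u) := by
  rw [gTildeInfIntegrand]
  push_cast
  ring

theorem G_eq_loopN (γ : HankelLoop) (θ α κ : ℝ) (N : ℕ) (z : ℝ) :
    G γ θ α κ N z = loopN γ (α + 1) (fun u => (Complex.Gamma (κ - θ * u + 1))⁻¹) N z :=
  loopIntegral_congr fun _ hu => gIntegrand_eq θ α κ N z hu

theorem GTilde_eq_loopN (γ : HankelLoop) {θ : ℝ} (hθ : 0 < θ) (α κ : ℝ) (N : ℕ) (z : ℝ) :
    GTilde γ θ α κ N z = loopN γ (α + 1) (fun u => Complex.Gamma (θ * u - κ)) N z :=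
  loopIntegral_congr fun _ hu => gTildeIntegrand_eq hθ α κ N z hu

theorem GTilde_eq_loopIntegral (γ : HankelLoop) {θ : ℝ} (hθ : 0 < θ) (α κ : ℝ) (N : ℕ) (z : ℝ) :
    GTilde γ θ α κ N z = loopIntegral γ (gTildeIntegrand' θ α κ N z) :=
  loopIntegral_congr fun _ hu =>
    (gTildeIntegrand_eq hθ α κ N z hu).trans (gTildeIntegrand'_eq θ α κ N z hu).symm

theorem GInf_eq_loopInf (γ : HankelLoop) (θ α κ z : ℝ) :
    GInf γ θ α κ z = loopInf γ (α + 1) (fun u => (Complex.Gamma (κ - θ * u + 1))⁻¹) z :=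
  loopIntegral_congr fun u _ => gInfIntegrand_eq θ α κ z u

theorem GTildeInf_eq_loopInf (γ : HankelLoop) (θ α κ z : ℝ) :
    GTildeInf γ θ α κ z = loopInf γ (α + 1) (fun u => Complex.Gamma (θ * u - κ)) z :=
  loopIntegral_congr fun u _ => gTildeInfIntegrand_eq θ α κ z u

/-! ### Fox H-functions -/

theorem G_eq_foxH (γ : HankelLoop) (θ α κ : ℝ) (N : ℕ) (z : ℝ) :
    G γ θ α κ N z = foxH 1 1 ![(-α - N, 1), (N, 1)] ![(0, 1), (-α, 1), (-κ, θ)] γ z := by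
  refine loopIntegral_congr fun u _ => ?_
  simp only [gIntegrand, Finset.prod_filter, Fin.prod_univ_succ]
  simp
  exact Or.inl (by ring_nf)

theorem GTilde_eq_foxH (γ : HankelLoop) {θ : ℝ} (hθ : 0 < θ) (α κ : ℝ) (N : ℕ) (z : ℝ) :
    GTilde γ θ α κ N z = foxH 2 1 ![(-α - N, 1), (N, 1)] ![(0, 1), (-κ, θ), (-α, 1)] γ z := by
  rw [GTilde_eq_loopIntegral γ hθ]
  refine loopIntegral_congr fun u _ => ?_
  simp only [gTildeIntegrand', Finset.prod_filter, Fin.prod_univ_succ]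
  simp
  exact Or.inl (by ring_nf)

theorem GInf_eq_foxH (γ : HankelLoop) (θ α κ z : ℝ) :
    GInf γ θ α κ z = foxH 1 0 ![] ![(0, 1), (-α, 1), (-κ, θ)] γ z := by
  refine loopIntegral_congr fun u _ => ?_
  simp only [gInfIntegrand, Finset.prod_filter, Fin.prod_univ_succ]
  simp
  ring_nf

theorem GTildeInf_eq_foxH (γ : HankelLoop) (θ α κ z : ℝ) :
    GTildeInf γ θ α κ z = foxH 2 0 ![] ![(0, 1), (-κ, θ), (-α, 1)] γ z := by
  refine loopIntegral_congr fun u _ => ?_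
  simp only [gTildeInfIntegrand, Finset.prod_filter, Fin.prod_univ_succ]
  simp
  ring_nf

/-! ### Hard edge scaling -/

/-- The rescaled function `N^{-β} U_N(z / N²)`. -/
def hardScaled (β : ℝ) (U : ℕ → ℝ → ℂ) (N : ℕ) (z : ℝ) : ℂ :=
  (((N : ℝ) ^ (-β) : ℝ) : ℂ) * U N (z / N ^ 2)

/-- `N^{-β} U_N(z / N²)` converges to `V(z)`, and is bounded by a multiple of `z^{-c}` locally
uniformly on `[0, ∞)`. -/
structure HardEdge (β c : ℝ) (U : ℕ → ℝ → ℂ) (V : ℝ → ℂ) : Prop where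
  continuousOn : ∀ N, ContinuousOn (U N) (Set.Ioi 0)
  norm_le : ∀ Z : ℝ, ∃ C, 0 ≤ C ∧ ∀ N : ℕ, 1 ≤ N → ∀ z : ℝ, 0 < z → z ≤ Z →
    ‖hardScaled β U N z‖ ≤ C * z ^ (-c)
  tendsto : ∀ z : ℝ, 0 < z → Tendsto (fun N => hardScaled β U N z) atTop (𝓝 (V z))

section HardEdge

variable {β c d : ℝ} {U V : ℕ → ℝ → ℂ} {U' V' : ℝ → ℂ} {x y : ℝ}

theorem aestronglyMeasurable_rpow_mul_mul {f g : ℝ → ℂ} (hf : ContinuousOn f (Set.Ioi 0))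
    (hg : ContinuousOn g (Set.Ioi 0)) (hx : 0 < x) (hy : 0 < y) :
    AEStronglyMeasurable (fun t : ℝ => ((t ^ (β - 1) : ℝ) : ℂ) * f (t * x) * g (t * y))
      (volume.restrict (Set.Ioc 0 1)) := by
  refine ContinuousOn.aestronglyMeasurable ?_ measurableSet_Ioc
  refine ContinuousOn.mul (ContinuousOn.mul (fun t ht => ?_) ?_) ?_
  · exact (Complex.continuous_ofReal.continuousAt.comp
      (Real.continuousAt_rpow_const t _ (Or.inl ht.1.ne'))).continuousWithinAt
  · exact hf.comp (by fun_prop) fun t ht => mul_pos ht.1 hx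
  · exact hg.comp (by fun_prop) fun t ht => mul_pos ht.1 hy

theorem norm_comp_mul_le {f : ℝ → ℂ} {C : ℝ} (hx : 0 < x)
    (h : ∀ z, 0 < z → z ≤ x → ‖f z‖ ≤ C * z ^ (-c)) {t : ℝ} (ht : t ∈ Set.Ioc (0 : ℝ) 1) :
    ‖f (t * x)‖ ≤ C * x ^ (-c) * t ^ (-c) := by
  refine (h _ (mul_pos ht.1 hx) (mul_le_of_le_one_left hx.le ht.2)).trans (le_of_eq ?_)
  rw [Real.mul_rpow ht.1.le hx.le]
  ring

theorem HardEdge.norm_limit_le (hU : HardEdge β c U U') (Z : ℝ) :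
    ∃ C, 0 ≤ C ∧ ∀ z : ℝ, 0 < z → z ≤ Z → ‖U' z‖ ≤ C * z ^ (-c) := by
  obtain ⟨C, hC0, hC⟩ := hU.norm_le Z
  refine ⟨C, hC0, fun z hz hzZ => le_of_tendsto (hU.tendsto z hz).norm ?_⟩
  filter_upwards [eventually_ge_atTop 1] with N hN using hC N hN z hz hzZ

theorem HardEdge.continuousOn_scaled (hU : HardEdge β c U U') {N : ℕ} (hN : 1 ≤ N) :
    ContinuousOn (hardScaled β U N) (Set.Ioi 0) := by
  have hN' : (0 : ℝ) < N := by exact_mod_cast hN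
  refine continuousOn_const.mul ((hU.continuousOn N).comp (by fun_prop) fun z hz => ?_)
  exact div_pos (Set.mem_Ioi.1 hz) (by positivity)

theorem HardEdge.norm_apply_le (hU : HardEdge β c U U') {N : ℕ} (hN : 1 ≤ N) (Z : ℝ) :
    ∃ C, 0 ≤ C ∧ ∀ z : ℝ, 0 < z → z ≤ Z → ‖U N z‖ ≤ C * z ^ (-c) := by
  have hN' : (0 : ℝ) < N := by exact_mod_cast hN
  obtain ⟨C, hC0, hC⟩ := hU.norm_le (Z * N ^ 2)
  refine ⟨(N : ℝ) ^ β * (C * ((N : ℝ) ^ 2) ^ (-c)), by positivity, fun z hz hzZ => ?_⟩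
  have h1 := hC N hN (z * N ^ 2) (by positivity) (by gcongr)
  rw [hardScaled, mul_div_cancel_right₀ _ (by positivity), norm_mul, Complex.norm_real,
    Real.norm_of_nonneg (by positivity), Real.mul_rpow hz.le (by positivity), Real.rpow_neg hN'.le,
    inv_mul_le_iff₀ (by positivity)] at h1
  linarith

theorem HardEdge.intervalIntegrable (hU : HardEdge β c U U') (hV : HardEdge β d V V')
    (hcd : c + d < β) (hx : 0 < x) (hy : 0 < y) {N : ℕ} (hN : 1 ≤ N) :
    IntervalIntegrable (fun t : ℝ => ((t ^ (β - 1) : ℝ) : ℂ) * U N (t * x) * V N (t * y))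
      volume 0 1 := by
  obtain ⟨C, -, hC⟩ := hU.norm_apply_le hN x
  obtain ⟨D, -, hD⟩ := hV.norm_apply_le hN y
  exact intervalIntegrable_of_norm_le_rpow (show -1 < β - 1 - c - d by linarith)
    (aestronglyMeasurable_rpow_mul_mul (hU.continuousOn N) (hV.continuousOn N) hx hy)
    fun t ht => norm_rpow_mul_mul_le ht.1 (norm_comp_mul_le hx hC ht) (norm_comp_mul_le hy hD ht)

theorem HardEdge.tendsto_integrand (hU : HardEdge β c U U') (hV : HardEdge β d V V')
    (hx : 0 < x) (hy : 0 < y) {t : ℝ} (ht : 0 < t) :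
    Tendsto (fun N : ℕ => ((t ^ (β - 1) : ℝ) : ℂ)
        * hardScaled β U N (t * x)
        * hardScaled β V N (t * y)) atTop
      (𝓝 (((t ^ (β - 1) : ℝ) : ℂ) * U' (t * x) * V' (t * y))) :=
  (tendsto_const_nhds.mul (hU.tendsto _ (mul_pos ht hx))).mul (hV.tendsto _ (mul_pos ht hy))

theorem HardEdge.intervalIntegrable_limit (hU : HardEdge β c U U') (hV : HardEdge β d V V')
    (hcd : c + d < β) (hx : 0 < x) (hy : 0 < y) :
    IntervalIntegrable (fun t : ℝ => ((t ^ (β - 1) : ℝ) : ℂ) * U' (t * x) * V' (t * y))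
      volume 0 1 := by
  obtain ⟨C, -, hC⟩ := hU.norm_limit_le x
  obtain ⟨D, -, hD⟩ := hV.norm_limit_le y
  refine intervalIntegrable_of_norm_le_rpow (show -1 < β - 1 - c - d by linarith) ?_
    fun t ht => norm_rpow_mul_mul_le ht.1 (norm_comp_mul_le hx hC ht) (norm_comp_mul_le hy hD ht)
  -- The limit is measurable as a pointwise limit of continuous functions. The index N + 1 keeps
  -- z/N² a genuine division.
  refine aestronglyMeasurable_of_tendsto_ae (u := atTop) (f := fun (N : ℕ) (t : ℝ) =>
    ((t ^ (β - 1) : ℝ) : ℂ)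
      * hardScaled β U (N + 1) (t * x)
      * hardScaled β V (N + 1) (t * y)) (fun N => ?_) ?_
  · exact aestronglyMeasurable_rpow_mul_mul (hU.continuousOn_scaled (by omega : 1 ≤ N + 1))
      (hV.continuousOn_scaled (by omega : 1 ≤ N + 1)) hx hy
  · filter_upwards [ae_restrict_mem measurableSet_Ioc] with t ht
    exact (hU.tendsto_integrand hV hx hy ht.1).comp (tendsto_add_atTop_nat 1)

/-- The factor N^{-2β} gives N^{-β} to each function. The majorant t^{β-1-c-d} is integrable because
c + d < β. -/
theorem HardEdge.tendsto_integral (hU : HardEdge β c U U') (hV : HardEdge β d V V')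
    (hcd : c + d < β) (hx : 0 < x) (hy : 0 < y) :
    Tendsto (fun N : ℕ => (((N : ℝ) ^ (-(2 * β)) : ℝ) : ℂ) * ∫ t in (0 : ℝ)..1,
        ((t ^ (β - 1) : ℝ) : ℂ) * U N (t * (x / N ^ 2)) * V N (t * (y / N ^ 2))) atTop
      (𝓝 (∫ t in (0 : ℝ)..1, ((t ^ (β - 1) : ℝ) : ℂ) * U' (t * x) * V' (t * y))) := by
  obtain ⟨C, -, hC⟩ := hU.norm_le x
  obtain ⟨D, -, hD⟩ := hV.norm_le y
  have h1 : Tendsto (fun N : ℕ => ∫ t in (0 : ℝ)..1, ((t ^ (β - 1) : ℝ) : ℂ)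
        * hardScaled β U N (t * x)
        * hardScaled β V N (t * y)) atTop
      (𝓝 (∫ t in (0 : ℝ)..1, ((t ^ (β - 1) : ℝ) : ℂ) * U' (t * x) * V' (t * y))) := by
    refine intervalIntegral.tendsto_integral_filter_of_dominated_convergence
      (fun t => C * x ^ (-c) * (D * y ^ (-d)) * t ^ (β - 1 - c - d)) ?_ ?_ ?_ ?_
    · filter_upwards [eventually_ge_atTop 1] with N hN
      rw [Set.uIoc_of_le zero_le_one]
      exact aestronglyMeasurable_rpow_mul_mul (hU.continuousOn_scaled hN)
        (hV.continuousOn_scaled hN) hx hy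
    · filter_upwards [eventually_ge_atTop 1] with N hN
      refine Eventually.of_forall fun t ht => ?_
      rw [Set.uIoc_of_le zero_le_one] at ht
      exact norm_rpow_mul_mul_le ht.1
        (norm_comp_mul_le hx (hC N hN) ht)
        (norm_comp_mul_le hy (hD N hN) ht)
    · exact (intervalIntegral.intervalIntegrable_rpow' (by linarith)).const_mul _
    · refine Eventually.of_forall fun t ht => ?_
      rw [Set.uIoc_of_le zero_le_one] at ht
      exact hU.tendsto_integrand hV hx hy ht.1
  refine h1.congr' ?_
  filter_upwards [eventually_ge_atTop 1] with N hN
  have hN' : (0 : ℝ) < N := by exact_mod_cast hN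
  rw [← intervalIntegral.integral_const_mul]
  refine intervalIntegral.integral_congr fun t _ => ?_
  simp only [hardScaled]
  rw [show -(2 * β) = -β + -β by ring, Real.rpow_add hN', mul_div_assoc, mul_div_assoc]
  push_cast
  ring

end HardEdge

/-! ### Explicit formulas for G and G̃ at finite N, and their hard edge behaviour -/

theorem G_eq_sum {θ : ℝ} (hθ : 0 < θ) (α κ : ℝ) {γ : HankelLoop} (hγ : 0 < γ.vertex) (N : ℕ)
    {z : ℝ} (hz : 0 < z) :
    G γ θ α κ N z = ((∑ j ∈ Finset.range N,
      coefA (α + 1) N j * (z ^ j / Real.Gamma (κ + j * θ + 1)) : ℝ) : ℂ) := by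
  rw [G_eq_loopN, loopN_invGamma hθ κ _ hγ N hz]

theorem GTilde_eq_sum {θ : ℝ} (hθ : 0 < θ) (α : ℝ) {κ : ℝ} {γ : HankelLoop}
    (hγ : max 0 (κ / θ) < γ.vertex) (N : ℕ) {z : ℝ} (hz : 0 < z) :
    GTilde γ θ α κ N z = (((-1) ^ N * expFun θ κ z
      + ∑ j ∈ Finset.range N, coefA (α + 1) N j * tailFun θ κ j z : ℝ) : ℂ) := by
  rw [GTilde_eq_loopN γ hθ, loopN_Gamma hθ _ hγ N hz]

/-- The exponent c is not tied to the vertex of γ: the explicit formula shows that G does not depend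
on the loop, so the bound is taken from an auxiliary loop with vertex c. -/
theorem hardEdge_G {θ : ℝ} (hθ : 0 < θ) (α κ : ℝ) {γ : HankelLoop} (hγ : 0 < γ.vertex) {c : ℝ}
    (hc : 0 < c) : HardEdge (α + 1) c (G γ θ α κ) (GInf γ θ α κ) where
  continuousOn N := by
    refine ContinuousOn.congr (Complex.continuous_ofReal.comp (?_ : Continuous fun z : ℝ =>
      ∑ j ∈ Finset.range N, coefA (α + 1) N j * (z ^ j / Real.Gamma (κ + j * θ + 1)))).continuousOn
      fun z hz => G_eq_sum hθ α κ hγ N hz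
    fun_prop
  norm_le Z := by
    obtain ⟨C, hC0, hC⟩ := (loopDecay_invGamma hθ κ ⟨c, 1, one_pos⟩).norm_loopN_le hc (α + 1) Z
    refine ⟨C, hC0, fun N hN z hz hzZ => ?_⟩
    have hN' : (0 : ℝ) < N := by exact_mod_cast hN
    have hz' : 0 < z / (N : ℝ) ^ 2 := by positivity
    have h := hC N hN z hz hzZ
    rwa [loopN_invGamma hθ κ _ hc N hz', ← G_eq_sum hθ α κ hγ N hz'] at h
  tendsto z hz := by
    simp only [hardScaled, G_eq_loopN, GInf_eq_loopInf]
    exact (loopDecay_invGamma hθ κ γ).tendsto_loopN hγ (α + 1) hz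

theorem hardEdge_GTilde {θ : ℝ} (hθ : 0 < θ) (α : ℝ) {κ : ℝ} {γ : HankelLoop}
    (hγ : max 0 (κ / θ) < γ.vertex) {c : ℝ} (hc : max 0 (κ / θ) < c) :
    HardEdge (α + 1) c (GTilde γ θ α κ) (GTildeInf γ θ α κ) where
  continuousOn N := by
    refine ContinuousOn.congr (Complex.continuous_ofReal.comp_continuousOn
      ((continuousOn_const.mul (continuousOn_expFun θ κ)).add
        (continuousOn_finsetSum (Finset.range N) fun j _ =>
          continuousOn_const.mul (continuousOn_tailFun hθ j))))
      fun z hz => GTilde_eq_sum hθ α hγ N hz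
  norm_le Z := by
    obtain ⟨hc0, hcκ⟩ := max_lt_iff.1 hc
    -- As for G, the bound comes from a loop with vertex c, and the explicit formula transfers it to
    -- γ.
    obtain ⟨C, hC0, hC⟩ := (loopDecay_Gamma (γ := ⟨c, 1, one_pos⟩) hθ hcκ).norm_loopN_le hc0
      (α + 1) Z
    refine ⟨C, hC0, fun N hN z hz hzZ => ?_⟩
    have hN' : (0 : ℝ) < N := by exact_mod_cast hN
    have hz' : 0 < z / (N : ℝ) ^ 2 := by positivity
    have h := hC N hN z hz hzZ
    rwa [loopN_Gamma hθ _ hc N hz', ← GTilde_eq_sum hθ α hγ N hz'] at h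
  tendsto z hz := by
    obtain ⟨hγ0, hγκ⟩ := max_lt_iff.1 hγ
    simp only [hardScaled, GTilde_eq_loopN γ hθ, GTildeInf_eq_loopInf]
    exact (loopDecay_Gamma hθ hγκ).tendsto_loopN hγ0 (α + 1) hz

/-! ### Integral forms of the kernels -/

/-- Functions with `z u_j' = j u_j - e` that are `O(z^{-c})` at the origin. -/
structure Ladder (c : ℝ) (u : ℕ → ℝ → ℝ) (e : ℝ → ℝ) : Prop where
  hasDerivAt : ∀ (j : ℕ) (z : ℝ), 0 < z → HasDerivAt (u j) ((j * u j z - e z) / z) z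
  continuousOn : ContinuousOn e (Set.Ioi 0)
  abs_le : ∀ (j : ℕ) (Z : ℝ), 0 < Z → ∃ C, ∀ z, 0 < z → z ≤ Z → |u j z| ≤ C * z ^ (-c)
  abs_le_right : ∀ Z : ℝ, 0 < Z → ∃ C, ∀ z, 0 < z → z ≤ Z → |e z| ≤ C * z ^ (-c)

theorem ladder_tailFun {θ κ c : ℝ} (hθ : 0 < θ) (hc : max 0 (κ / θ) < c) :
    Ladder c (tailFun θ κ) (expFun θ κ) where
  hasDerivAt j _ hz := hasDerivAt_tailFun hθ j hz
  continuousOn := continuousOn_expFun θ κ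
  abs_le j _ _ := ⟨_, fun _ hz _ => tailFun_le hθ (max_lt_iff.1 hc).1.le (max_lt_iff.1 hc).2 j hz⟩
  abs_le_right _ _ := by
    obtain ⟨C, -, hC⟩ := expFun_le hθ (max_lt_iff.1 hc).2
    exact ⟨C, fun z hz _ => hC z hz⟩

theorem ladder_pow {c : ℝ} (hc : 0 ≤ c) (w : ℕ → ℝ) :
    Ladder c (fun j z => z ^ j / w j) (fun _ => 0) where
  hasDerivAt j z hz := by
    refine ((hasDerivAt_pow j z).div_const (w j)).congr_deriv ?_
    rcases j with _ | j
    · simp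
    · simp only [Nat.add_sub_cancel, pow_succ, sub_zero]
      field_simp
  continuousOn := continuousOn_const
  abs_le j Z hZ := by
    -- Since Z^c z^{-c} ≥ 1 on (0, Z], a bounded function also satisfies the z^{-c} bound.
    refine ⟨Z ^ j / |w j| * Z ^ c, fun z hz hzZ => ?_⟩
    rw [abs_div, abs_of_pos (pow_pos hz j), mul_assoc]
    have h1 : 1 ≤ Z ^ c * z ^ (-c) := by
      rw [Real.rpow_neg hz.le, ← div_eq_mul_inv, one_le_div (by positivity)]
      gcongr
    calc z ^ j / |w j| ≤ Z ^ j / |w j| * 1 := by rw [mul_one]; gcongr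
      _ ≤ _ := by gcongr
  abs_le_right Z _ := ⟨0, fun z _ _ => by simp⟩

theorem Ladder.comp_mul {c : ℝ} {u : ℕ → ℝ → ℝ} {e : ℝ → ℝ} (h : Ladder c u e) {x : ℝ}
    (hx : 0 < x) : Ladder c (fun j t => u j (t * x)) (fun t => e (t * x)) where
  hasDerivAt j t ht := by
    have h1 := (h.hasDerivAt j (t * x) (mul_pos ht hx)).comp t ((hasDerivAt_id t).mul_const x)
    refine h1.congr_deriv ?_
    field_simp
  continuousOn := h.continuousOn.comp (by fun_prop) fun t ht => mul_pos ht hx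
  abs_le j Z hZ := by
    obtain ⟨C, hC⟩ := h.abs_le j (Z * x) (mul_pos hZ hx)
    refine ⟨C * x ^ (-c), fun t ht htZ => (hC _ (mul_pos ht hx) (by gcongr)).trans (le_of_eq ?_)⟩
    rw [Real.mul_rpow ht.le hx.le]
    ring
  abs_le_right Z hZ := by
    obtain ⟨C, hC⟩ := h.abs_le_right (Z * x) (mul_pos hZ hx)
    refine ⟨C * x ^ (-c), fun t ht htZ => (hC _ (mul_pos ht hx) (by gcongr)).trans (le_of_eq ?_)⟩
    rw [Real.mul_rpow ht.le hx.le]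
    ring

/-- The relation z u' = j u - e is invariant under scaling, so `integral_sum_mul_sum` applies to
u_j(tx) and v_k(ty), whose values at t = 1 are u_j(x) and v_k(y). -/
theorem Ladder.integral_eq {β c d : ℝ} (hβ : 0 < β) (hcd : c + d < β) (N : ℕ)
    {u v : ℕ → ℝ → ℝ} {e f : ℝ → ℝ} (hu : Ladder c u e) (hv : Ladder d v f) {U V : ℝ → ℂ}
    (hU : ∀ z, 0 < z →
      U z = (((-1) ^ N * e z + ∑ j ∈ Finset.range N, coefA β N j * u j z : ℝ) : ℂ))
    (hV : ∀ z, 0 < z →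
      V z = (((-1) ^ N * f z + ∑ j ∈ Finset.range N, coefA β N j * v j z : ℝ) : ℂ))
    {x y : ℝ} (hx : 0 < x) (hy : 0 < y) :
    ∫ t in (0 : ℝ)..1, ((t ^ (β - 1) : ℝ) : ℂ) * U (t * x) * V (t * y)
      = (((∫ t in (0 : ℝ)..1, t ^ (β - 1) * e (t * x) * f (t * y))
        + ∑ j ∈ Finset.range N, ∑ k ∈ Finset.range N,
          coefA β N j * coefA β N k / (β + j + k) * (u j x * v k y) : ℝ) : ℂ) := by
  have hu' := hu.comp_mul hx
  have hv' := hv.comp_mul hy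
  have h1 := integral_sum_mul_sum hβ hcd N hu'.hasDerivAt hv'.hasDerivAt hu'.continuousOn
    hv'.continuousOn (fun j => (hu'.abs_le j 1 one_pos).imp fun C hC t ht => hC t ht.1 ht.2)
    (fun j => (hv'.abs_le j 1 one_pos).imp fun C hC t ht => hC t ht.1 ht.2)
    ((hu'.abs_le_right 1 one_pos).imp fun C hC t ht => hC t ht.1 ht.2)
    ((hv'.abs_le_right 1 one_pos).imp fun C hC t ht => hC t ht.1 ht.2)
  simp only [one_mul] at h1
  rw [← h1, ← intervalIntegral.integral_ofReal]
  refine intervalIntegral.integral_congr_ae (Eventually.of_forall fun t ht => ?_)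
  rw [Set.uIoc_of_le zero_le_one] at ht
  rw [hU _ (mul_pos ht.1 hx), hV _ (mul_pos ht.1 hy)]
  push_cast
  ring

theorem integral_rpow_mul_exp_neg_mul_rpow {p s : ℝ} (hp : 0 < p) (hs : 0 < s) :
    ∫ t in (0 : ℝ)..1, t ^ (p - 1) * Real.exp (-(s * t ^ p))
      = (1 - Real.exp (-s)) / (p * s) := by
  have hc : Continuous fun t : ℝ => Real.exp (-(s * t ^ p)) :=
    Real.continuous_exp.comp ((Real.continuous_rpow_const hp.le).const_mul s).neg
  rw [intervalIntegral.integral_eq_sub_of_hasDerivAt_of_le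
    (f := fun t => -(p * s)⁻¹ * Real.exp (-(s * t ^ p))) zero_le_one
    (continuous_const.mul hc).continuousOn (fun t ht => ?_)
    ((intervalIntegral.intervalIntegrable_rpow' (by linarith)).mul_continuousOn hc.continuousOn)]
  · simp [Real.zero_rpow hp.ne']
    field_simp
    ring
  · have h1 := (Real.hasDerivAt_rpow_const (p := p) (Or.inl ht.1.ne')).const_mul s
    refine (h1.neg.exp.const_mul (-(p * s)⁻¹)).congr_deriv ?_
    simp only [Pi.neg_apply]
    field_simp

theorem expFun_mul_rpow {θ : ℝ} (hθ : 0 < θ) (κ : ℝ) {t y : ℝ} (ht : 0 < t) (hy : 0 < y) :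
    expFun θ κ (t * y ^ θ)
      = θ⁻¹ * (t ^ (-(κ / θ)) * y ^ (-κ)) * Real.exp (-(y * t ^ θ⁻¹)) := by
  rw [expFun, Real.mul_rpow ht.le (by positivity), Real.mul_rpow ht.le (by positivity),
    ← Real.rpow_mul hy.le, ← Real.rpow_mul hy.le, mul_inv_cancel₀ hθ.ne', Real.rpow_one,
    show θ * -(κ / θ) = -κ by field_simp, mul_comm (t ^ θ⁻¹) y]

/-- The powers of t combine to t^{1/θ-1}, up to a constant the derivative of the t^{1/θ} in the
exponent, so the integral is elementary. It is needed for K₁₁ only; in the other kernels one of the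
two functions is 0. -/
theorem integral_expFun_mul_expFun {θ : ℝ} (hθ : 0 < θ) (a b : ℝ) {x y : ℝ} (hx : 0 < x)
    (hy : 0 < y) :
    ∫ t in (0 : ℝ)..1, t ^ ((a + b + 1) / θ - 1) * expFun θ a (t * y ^ θ) * expFun θ b (t * x ^ θ)
      = θ⁻¹ * (x ^ (-b) * y ^ (-a)) * ((1 - Real.exp (-(x + y))) / (x + y)) := by
  have h1 : ∫ t in (0 : ℝ)..1, t ^ ((a + b + 1) / θ - 1) * expFun θ a (t * y ^ θ)
        * expFun θ b (t * x ^ θ)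
      = ∫ t in (0 : ℝ)..1, (θ⁻¹ ^ 2 * (x ^ (-b) * y ^ (-a)))
        * (t ^ (θ⁻¹ - 1) * Real.exp (-((x + y) * t ^ θ⁻¹))) := by
    refine intervalIntegral.integral_congr_ae (Eventually.of_forall fun t ht => ?_)
    rw [Set.uIoc_of_le zero_le_one] at ht
    have h2 : t ^ (θ⁻¹ - 1) = t ^ ((a + b + 1) / θ - 1) * t ^ (-(a / θ)) * t ^ (-(b / θ)) := by
      rw [← Real.rpow_add ht.1, ← Real.rpow_add ht.1]
      congr 1
      field_simp
      ring
    have h3 : Real.exp (-((x + y) * t ^ θ⁻¹))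
        = Real.exp (-(y * t ^ θ⁻¹)) * Real.exp (-(x * t ^ θ⁻¹)) := by
      rw [← Real.exp_add]
      congr 1
      ring
    rw [expFun_mul_rpow hθ a ht.1 hy, expFun_mul_rpow hθ b ht.1 hx, h2, h3]
    ring
  rw [h1, intervalIntegral.integral_const_mul,
    integral_rpow_mul_exp_neg_mul_rpow (by positivity) (by positivity)]
  field_simp

theorem expIntegral_eq_tailFun {θ x : ℝ} (hθ : 0 < θ) (κ : ℝ) (k : ℕ) (hx : 0 < x) :
    expIntegral (κ + k * θ) x = x ^ κ * tailFun θ κ k (x ^ θ) := by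
  rw [tailFun_rpow hθ k hx, ← mul_assoc, ← Real.rpow_add hx, add_neg_cancel, Real.rpow_zero,
    one_mul]

/-- Exponents `c`, `d` for which the products in the kernels are integrable. -/
theorem exists_exponents {θ a b : ℝ} (hθ : 0 < θ) (ha : -1 < a) (hb : -1 < b)
    (hab : -1 < a + b) : ∃ c d, max 0 (a / θ) < c ∧ max 0 (b / θ) < d ∧
      c + d < (a + b + 1) / θ := by
  have h1 : max 0 (a / θ) + max 0 (b / θ) < (a + b + 1) / θ := by
    rw [← zero_div θ, max_div_div_right hθ.le, max_div_div_right hθ.le, ← add_div]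
    refine div_lt_div_of_pos_right ?_ hθ
    -- The four sign patterns reduce to a + b > -1, b > -1, a > -1 and 0 < 1.
    rcases max_cases 0 a with h | h <;> rcases max_cases 0 b with h' | h' <;> linarith
  obtain ⟨ε, hε⟩ : ∃ ε, ε = ((a + b + 1) / θ - max 0 (a / θ) - max 0 (b / θ)) / 3 := ⟨_, rfl⟩
  exact ⟨max 0 (a / θ) + ε, max 0 (b / θ) + ε, by linarith, by linarith, by linarith⟩

section Kernels

variable {θ a b α : ℝ} {P Q : ℕ → Polynomial ℝ}

theorem K01_eq_integral (hθ : 0 < θ) (ha : -1 < a) (hb : -1 < b) (hab : -1 < a + b)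
    (hα : α + 1 = (a + b + 1) / θ) (hPQ : IsBiorthogonal θ a b P Q) {γ₀ γb : HankelLoop}
    (hγ₀ : 0 < γ₀.vertex) (hγb : max 0 (b / θ) < γb.vertex) (N : ℕ) {x x' : ℝ} (hx : 0 < x)
    (hx' : 0 < x') :
    (K01 θ a b P Q N x x' : ℂ) = (θ * Real.exp x' * x' ^ b : ℝ)
      * ∫ t in (0 : ℝ)..1, ((t ^ α : ℝ) : ℂ)
        * G γ₀ θ α a N (t * x ^ θ) * GTilde γb θ α b N (t * x' ^ θ) := by
  obtain ⟨c, d, hc, hd, hcd⟩ := exists_exponents hθ ha hb hab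
  have hβ : 0 < α + 1 := by rw [hα]; exact div_pos (by linarith) hθ
  have h := Ladder.integral_eq hβ (hα ▸ hcd) N
    (ladder_pow (max_lt_iff.1 hc).1.le fun j => Real.Gamma (a + j * θ + 1)) (ladder_tailFun hθ hd)
    (U := G γ₀ θ α a N) (V := GTilde γb θ α b N)
    (fun z hz => by simpa using G_eq_sum hθ α a hγ₀ N hz)
    (fun z hz => GTilde_eq_sum hθ α hγb N hz) (x := x ^ θ) (y := x' ^ θ) (by positivity)
    (by positivity)
  rw [add_sub_cancel_right] at h
  rw [h, K01_eq_sum hθ ha hb hab hPQ N x hx', ← Complex.ofReal_mul]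
  congr 1
  simp only [mul_zero, zero_mul, intervalIntegral.integral_zero, zero_add, Finset.mul_sum, hα]
  refine Finset.sum_congr rfl fun j _ => Finset.sum_congr rfl fun k _ => ?_
  rw [expIntegral_eq_tailFun hθ b k hx']
  ring

theorem K10_eq_integral (hθ : 0 < θ) (ha : -1 < a) (hb : -1 < b) (hab : -1 < a + b)
    (hα : α + 1 = (a + b + 1) / θ) (hPQ : IsBiorthogonal θ a b P Q) {γ₀ γa : HankelLoop}
    (hγ₀ : 0 < γ₀.vertex) (hγa : max 0 (a / θ) < γa.vertex) (N : ℕ) {y y' : ℝ} (hy : 0 < y)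
    (hy' : 0 < y') :
    (K10 θ a b P Q N y y' : ℂ) = (θ * Real.exp y * y ^ a : ℝ)
      * ∫ t in (0 : ℝ)..1, ((t ^ α : ℝ) : ℂ)
        * GTilde γa θ α a N (t * y ^ θ) * G γ₀ θ α b N (t * y' ^ θ) := by
  obtain ⟨c, d, hc, hd, hcd⟩ := exists_exponents hθ ha hb hab
  have hβ : 0 < α + 1 := by rw [hα]; exact div_pos (by linarith) hθ
  have h := Ladder.integral_eq hβ (hα ▸ hcd) N (ladder_tailFun hθ hc)
    (ladder_pow (max_lt_iff.1 hd).1.le fun j => Real.Gamma (b + j * θ + 1))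
    (U := GTilde γa θ α a N) (V := G γ₀ θ α b N) (fun z hz => GTilde_eq_sum hθ α hγa N hz)
    (fun z hz => by simpa using G_eq_sum hθ α b hγ₀ N hz) (x := y ^ θ) (y := y' ^ θ)
    (by positivity) (by positivity)
  rw [add_sub_cancel_right] at h
  rw [h, K10_eq_sum hθ ha hb hab hPQ N y' hy, ← Complex.ofReal_mul]
  congr 1
  simp only [mul_zero, intervalIntegral.integral_zero, zero_add, Finset.mul_sum, hα]
  refine Finset.sum_congr rfl fun j _ => Finset.sum_congr rfl fun k _ => ?_
  rw [expIntegral_eq_tailFun hθ a j hy]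
  ring

theorem K11_eq_integral (hθ : 0 < θ) (ha : -1 < a) (hb : -1 < b) (hab : -1 < a + b)
    (hα : α + 1 = (a + b + 1) / θ) (hPQ : IsBiorthogonal θ a b P Q) {γa γb : HankelLoop}
    (hγa : max 0 (a / θ) < γa.vertex) (hγb : max 0 (b / θ) < γb.vertex) (N : ℕ) {y x : ℝ}
    (hy : 0 < y) (hx : 0 < x) :
    (K11 θ a b P Q N y x : ℂ) = (θ * Real.exp (x + y) * x ^ b * y ^ a : ℝ)
      * (∫ t in (0 : ℝ)..1, ((t ^ α : ℝ) : ℂ)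
        * GTilde γa θ α a N (t * y ^ θ) * GTilde γb θ α b N (t * x ^ θ))
      - (Real.exp (x + y) / (x + y) : ℝ) := by
  obtain ⟨c, d, hc, hd, hcd⟩ := exists_exponents hθ ha hb hab
  have hβ : 0 < α + 1 := by rw [hα]; exact div_pos (by linarith) hθ
  have h := Ladder.integral_eq hβ (hα ▸ hcd) N (ladder_tailFun hθ hc) (ladder_tailFun hθ hd)
    (U := GTilde γa θ α a N) (V := GTilde γb θ α b N) (fun z hz => GTilde_eq_sum hθ α hγa N hz)
    (fun z hz => GTilde_eq_sum hθ α hγb N hz) (x := y ^ θ) (y := x ^ θ)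
    (by positivity) (by positivity)
  rw [hα, integral_expFun_mul_expFun hθ a b hx hy, ← hα, add_sub_cancel_right] at h
  rw [h, K11_eq_sum hθ ha hb hab hPQ N hy hx, ← Complex.ofReal_mul, ← Complex.ofReal_sub]
  congr 1
  -- The surviving e f integral contributes e^{x+y}/(x+y) - 1/(x+y), the difference between the
  -- subtracted terms on the two sides.
  have h1 : θ * Real.exp (x + y) * x ^ b * y ^ a
      * (θ⁻¹ * (x ^ (-b) * y ^ (-a)) * ((1 - Real.exp (-(x + y))) / (x + y)))
      = Real.exp (x + y) / (x + y) - 1 / (x + y) := by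
    rw [Real.rpow_neg hx.le, Real.rpow_neg hy.le, Real.exp_neg]
    have := (Real.exp_pos (x + y)).ne'
    field_simp
  rw [mul_add, h1, Finset.mul_sum]
  simp only [Finset.mul_sum, hα]
  rw [sub_add_eq_add_sub, sub_right_comm, add_sub_cancel_left]
  congr 1
  refine Finset.sum_congr rfl fun j _ => Finset.sum_congr rfl fun k _ => ?_
  rw [expIntegral_eq_tailFun hθ a j hy, expIntegral_eq_tailFun hθ b k hx, Real.exp_add]
  ring

end Kernels

/-! ### Hard edge limits of the kernels -/

theorem div_rpow_two_div_rpow {θ X : ℝ} (hX : 0 < X) (s : ℝ) (N : ℕ) :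
    (X / (N : ℝ) ^ (2 / θ)) ^ s = X ^ s / (N : ℝ) ^ (2 * s / θ) := by
  rw [Real.div_rpow hX.le (by positivity), ← Real.rpow_mul (by positivity), div_mul_eq_mul_div]

theorem div_rpow_two_div_rpow_self {θ X : ℝ} (hθ : 0 < θ) (hX : 0 < X) (N : ℕ) :
    (X / (N : ℝ) ^ (2 / θ)) ^ θ = X ^ θ / (N : ℝ) ^ 2 := by
  rw [div_rpow_two_div_rpow hX, mul_div_cancel_right₀ _ hθ.ne', Real.rpow_two]

theorem tendsto_exp_div_rpow {θ : ℝ} (hθ : 0 < θ) (X : ℝ) :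
    Tendsto (fun N : ℕ => ((Real.exp (X / (N : ℝ) ^ (2 / θ)) : ℝ) : ℂ)) atTop (𝓝 1) := by
  have h1 : Tendsto (fun N : ℕ => (N : ℝ) ^ (2 / θ)) atTop atTop :=
    (tendsto_rpow_atTop (by positivity)).comp tendsto_natCast_atTop_atTop
  have h2 := (Real.continuous_exp.tendsto 0).comp (h1.const_div_atTop X)
  rw [Real.exp_zero] at h2
  exact_mod_cast (Complex.continuous_ofReal.tendsto 1).comp h2

section Limits

variable {θ a b α : ℝ} {P Q : ℕ → Polynomial ℝ}

/-- Since (X/N^{2/θ})^θ = X^θ/N², the integral form is already in the scaling of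
`HardEdge.tendsto_integral`. The factor x'^b explains N^{2b/θ}, and e^{x'} tends to 1. -/
theorem tendsto_K01 (hθ : 0 < θ) (ha : -1 < a) (hb : -1 < b) (hab : -1 < a + b)
    (hα : α + 1 = (a + b + 1) / θ) (hPQ : IsBiorthogonal θ a b P Q) {γ₀ γb : HankelLoop}
    (hγ₀ : 0 < γ₀.vertex) (hγb : max 0 (b / θ) < γb.vertex) {X X' : ℝ} (hX : 0 < X)
    (hX' : 0 < X') :
    Tendsto (fun N : ℕ => (((N : ℝ) ^ (-2 * (α + 1) + 2 * b / θ)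
        * K01 θ a b P Q N (X / (N : ℝ) ^ (2 / θ)) (X' / (N : ℝ) ^ (2 / θ)) : ℝ) : ℂ))
      atTop (𝓝 ((θ * X' ^ b : ℝ) * ∫ t in (0 : ℝ)..1, ((t ^ α : ℝ) : ℂ)
        * GInf γ₀ θ α a (t * X ^ θ) * GTildeInf γb θ α b (t * X' ^ θ))) := by
  obtain ⟨c, d, hc, hd, hcd⟩ := exists_exponents hθ ha hb hab
  have h := (hardEdge_G hθ α a hγ₀ (max_lt_iff.1 hc).1).tendsto_integral
    (hardEdge_GTilde hθ α hγb hd) (hα ▸ hcd) (x := X ^ θ) (y := X' ^ θ) (by positivity)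
    (by positivity)
  rw [add_sub_cancel_right] at h
  have h' := ((tendsto_exp_div_rpow hθ X').mul h).const_mul ((θ * X' ^ b : ℝ) : ℂ)
  rw [one_mul] at h'
  refine h'.congr' ?_
  filter_upwards [eventually_ge_atTop 1] with N hN
  have hN' : (0 : ℝ) < N := by exact_mod_cast hN
  rw [Complex.ofReal_mul _ (K01 θ a b P Q N _ _),
    K01_eq_integral hθ ha hb hab hα hPQ hγ₀ hγb N (by positivity)
    (by positivity), div_rpow_two_div_rpow_self hθ hX, div_rpow_two_div_rpow_self hθ hX',
    ← mul_assoc, ← mul_assoc, ← mul_assoc, ← Complex.ofReal_mul, ← Complex.ofReal_mul,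
    ← Complex.ofReal_mul]
  congr 2
  rw [div_rpow_two_div_rpow hX', Real.rpow_add hN', neg_mul]
  field_simp

theorem tendsto_K10 (hθ : 0 < θ) (ha : -1 < a) (hb : -1 < b) (hab : -1 < a + b)
    (hα : α + 1 = (a + b + 1) / θ) (hPQ : IsBiorthogonal θ a b P Q) {γ₀ γa : HankelLoop}
    (hγ₀ : 0 < γ₀.vertex) (hγa : max 0 (a / θ) < γa.vertex) {Y Y' : ℝ} (hY : 0 < Y)
    (hY' : 0 < Y') :
    Tendsto (fun N : ℕ => (((N : ℝ) ^ (-2 * (α + 1) + 2 * a / θ)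
        * K10 θ a b P Q N (Y / (N : ℝ) ^ (2 / θ)) (Y' / (N : ℝ) ^ (2 / θ)) : ℝ) : ℂ))
      atTop (𝓝 ((θ * Y ^ a : ℝ) * ∫ t in (0 : ℝ)..1, ((t ^ α : ℝ) : ℂ)
        * GTildeInf γa θ α a (t * Y ^ θ) * GInf γ₀ θ α b (t * Y' ^ θ))) := by
  obtain ⟨c, d, hc, hd, hcd⟩ := exists_exponents hθ ha hb hab
  have h := (hardEdge_GTilde hθ α hγa hc).tendsto_integral
    (hardEdge_G hθ α b hγ₀ (max_lt_iff.1 hd).1) (hα ▸ hcd) (x := Y ^ θ) (y := Y' ^ θ)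
    (by positivity) (by positivity)
  rw [add_sub_cancel_right] at h
  have h' := ((tendsto_exp_div_rpow hθ Y).mul h).const_mul ((θ * Y ^ a : ℝ) : ℂ)
  rw [one_mul] at h'
  refine h'.congr' ?_
  filter_upwards [eventually_ge_atTop 1] with N hN
  have hN' : (0 : ℝ) < N := by exact_mod_cast hN
  rw [Complex.ofReal_mul _ (K10 θ a b P Q N _ _),
    K10_eq_integral hθ ha hb hab hα hPQ hγ₀ hγa N (by positivity)
    (by positivity), div_rpow_two_div_rpow_self hθ hY, div_rpow_two_div_rpow_self hθ hY',
    ← mul_assoc, ← mul_assoc, ← mul_assoc, ← Complex.ofReal_mul, ← Complex.ofReal_mul,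
    ← Complex.ofReal_mul]
  congr 2
  rw [div_rpow_two_div_rpow hY, Real.rpow_add hN', neg_mul]
  field_simp

theorem tendsto_K11 (hθ : 0 < θ) (ha : -1 < a) (hb : -1 < b) (hab : -1 < a + b)
    (hα : α + 1 = (a + b + 1) / θ) (hPQ : IsBiorthogonal θ a b P Q) {γa γb : HankelLoop}
    (hγa : max 0 (a / θ) < γa.vertex) (hγb : max 0 (b / θ) < γb.vertex) {Y X : ℝ} (hY : 0 < Y)
    (hX : 0 < X) :
    Tendsto (fun N : ℕ => (((N : ℝ) ^ (-(2 / θ))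
        * K11 θ a b P Q N (Y / (N : ℝ) ^ (2 / θ)) (X / (N : ℝ) ^ (2 / θ)) + 1 / (X + Y) : ℝ) : ℂ))
      atTop (𝓝 ((θ * X ^ b * Y ^ a : ℝ) * ∫ t in (0 : ℝ)..1, ((t ^ α : ℝ) : ℂ)
        * GTildeInf γa θ α a (t * Y ^ θ) * GTildeInf γb θ α b (t * X ^ θ))) := by
  obtain ⟨c, d, hc, hd, hcd⟩ := exists_exponents hθ ha hb hab
  have h := (hardEdge_GTilde hθ α hγa hc).tendsto_integral
    (hardEdge_GTilde hθ α hγb hd) (hα ▸ hcd) (x := Y ^ θ) (y := X ^ θ)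
    (by positivity) (by positivity)
  rw [add_sub_cancel_right] at h
  have hexp := tendsto_exp_div_rpow hθ (X + Y)
  -- The rescaled kernel contains -e^{x+y}/(X+Y), with x + y = (X+Y)/N^{2/θ}, whereas 1/(X+Y) is
  -- added; their sum is the second summand, which tends to 0.
  have h' := ((hexp.mul h).const_mul ((θ * X ^ b * Y ^ a : ℝ) : ℂ)).add
    ((hexp.const_sub 1).mul_const ((1 / (X + Y) : ℝ) : ℂ))
  rw [one_mul, sub_self, zero_mul, add_zero] at h'
  refine h'.congr' ?_
  filter_upwards [eventually_ge_atTop 1] with N hN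
  have hN' : (0 : ℝ) < N := by exact_mod_cast hN
  -- From 2(α+1) = (2 + 2b + 2a)/θ: two of the powers come from x^b y^a, the third is the prefactor
  -- of the kernel.
  have hr : (N : ℝ) ^ (-(2 * (α + 1)))
      = (N : ℝ) ^ (-(2 / θ)) / (N : ℝ) ^ (2 * b / θ) / (N : ℝ) ^ (2 * a / θ) := by
    rw [hα, ← Real.rpow_sub hN', ← Real.rpow_sub hN']
    congr 1
    field_simp
    ring
  rw [Complex.ofReal_add, Complex.ofReal_mul _ (K11 θ a b P Q N _ _),
    K11_eq_integral hθ ha hb hab hα hPQ hγa hγb N (by positivity) (by positivity),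
    div_rpow_two_div_rpow_self hθ hX,
    div_rpow_two_div_rpow_self hθ hY, ← add_div, div_rpow_two_div_rpow hX,
    div_rpow_two_div_rpow hY, hr, Real.rpow_neg hN'.le]
  have hM : (0 : ℝ) < (N : ℝ) ^ (2 / θ) := by positivity
  have hM' : (((N : ℝ) ^ (2 / θ) : ℝ) : ℂ) ≠ 0 := by exact_mod_cast hM.ne'
  generalize (N : ℝ) ^ (2 / θ) = M at *
  generalize (∫ t in (0 : ℝ)..1, _ : ℂ) = J
  have hXY : ((X : ℂ) + Y) ≠ 0 := by exact_mod_cast (by positivity : X + Y ≠ 0)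
  push_cast
  field_simp
  ring

end Limits

end CauchyTwoMatrix

end

/-! ### The main theorem -/

theorem mainTheorem3 (θ a b α : ℝ) (hθ : 0 < θ) (ha : -1 < a) (hb : -1 < b)
    (hab : -1 < a + b) (hα : α = (a + b + 1) / θ - 1) :
    -- the contour integrals converge, the two forms of `G̃` agree, all four are Fox H-functions
    (∀ (κ : ℝ) (γ : HankelLoop) (z : ℝ), 0 < z → 0 < γ.vertex →
      (∀ N : ℕ, 1 ≤ N →
        LoopIntegrable γ (gIntegrand θ α κ N z) ∧
        G γ θ α κ N z
          = foxH 1 1 ![(-α - N, 1), (N, 1)] ![(0, 1), (-α, 1), (-κ, θ)] γ z) ∧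
      LoopIntegrable γ (gInfIntegrand θ α κ z) ∧
      GInf γ θ α κ z = foxH 1 0 ![] ![(0, 1), (-α, 1), (-κ, θ)] γ z) ∧
    (∀ (κ : ℝ) (γ : HankelLoop) (z : ℝ), 0 < z → max 0 (κ / θ) < γ.vertex →
      (∀ N : ℕ, 1 ≤ N →
        LoopIntegrable γ (gTildeIntegrand θ α κ N z) ∧
        LoopIntegrable γ (gTildeIntegrand' θ α κ N z) ∧
        GTilde γ θ α κ N z = loopIntegral γ (gTildeIntegrand' θ α κ N z) ∧
        GTilde γ θ α κ N z
          = foxH 2 1 ![(-α - N, 1), (N, 1)] ![(0, 1), (-κ, θ), (-α, 1)] γ z) ∧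
      LoopIntegrable γ (gTildeInfIntegrand θ α κ z) ∧
      GTildeInf γ θ α κ z = foxH 2 0 ![] ![(0, 1), (-κ, θ), (-α, 1)] γ z) ∧
    -- biorthogonal systems exist, and for each of them:
    (∃ P Q : ℕ → Polynomial ℝ, IsBiorthogonal θ a b P Q) ∧
    ∀ P Q : ℕ → Polynomial ℝ, IsBiorthogonal θ a b P Q →
    ∀ γ₀ γa γb : HankelLoop, 0 < γ₀.vertex → max 0 (a / θ) < γa.vertex →
      max 0 (b / θ) < γb.vertex →
    -- integral forms of the kernels
    (∀ N : ℕ, 1 ≤ N → ∀ x x' : ℝ, 0 < x → 0 < x' →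
      IntervalIntegrable (fun t : ℝ => ((t ^ α : ℝ) : ℂ)
        * G γ₀ θ α a N (t * x ^ θ) * GTilde γb θ α b N (t * x' ^ θ)) volume 0 1 ∧
      (K01 θ a b P Q N x x' : ℂ) = (θ * Real.exp x' * x' ^ b : ℝ)
        * ∫ t in (0 : ℝ)..1, ((t ^ α : ℝ) : ℂ)
          * G γ₀ θ α a N (t * x ^ θ) * GTilde γb θ α b N (t * x' ^ θ)) ∧
    (∀ N : ℕ, 1 ≤ N → ∀ y y' : ℝ, 0 < y → 0 < y' →
      IntervalIntegrable (fun t : ℝ => ((t ^ α : ℝ) : ℂ)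
        * GTilde γa θ α a N (t * y ^ θ) * G γ₀ θ α b N (t * y' ^ θ)) volume 0 1 ∧
      (K10 θ a b P Q N y y' : ℂ) = (θ * Real.exp y * y ^ a : ℝ)
        * ∫ t in (0 : ℝ)..1, ((t ^ α : ℝ) : ℂ)
          * GTilde γa θ α a N (t * y ^ θ) * G γ₀ θ α b N (t * y' ^ θ)) ∧
    (∀ N : ℕ, 1 ≤ N → ∀ y x : ℝ, 0 < y → 0 < x →
      IntervalIntegrable (fun t : ℝ => ((t ^ α : ℝ) : ℂ)
        * GTilde γa θ α a N (t * y ^ θ) * GTilde γb θ α b N (t * x ^ θ)) volume 0 1 ∧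
      (K11 θ a b P Q N y x : ℂ) = (θ * Real.exp (x + y) * x ^ b * y ^ a : ℝ)
        * (∫ t in (0 : ℝ)..1, ((t ^ α : ℝ) : ℂ)
          * GTilde γa θ α a N (t * y ^ θ) * GTilde γb θ α b N (t * x ^ θ))
        - (Real.exp (x + y) / (x + y) : ℝ)) ∧
    -- hard edge limits
    (∀ X X' : ℝ, 0 < X → 0 < X' →
      IntervalIntegrable (fun t : ℝ => ((t ^ α : ℝ) : ℂ)
        * GInf γ₀ θ α a (t * X ^ θ) * GTildeInf γb θ α b (t * X' ^ θ)) volume 0 1 ∧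
      Tendsto (fun N : ℕ => (((N : ℝ) ^ (-2 * (α + 1) + 2 * b / θ)
          * K01 θ a b P Q N (X / (N : ℝ) ^ (2 / θ)) (X' / (N : ℝ) ^ (2 / θ)) : ℝ) : ℂ))
        atTop (𝓝 ((θ * X' ^ b : ℝ) * ∫ t in (0 : ℝ)..1, ((t ^ α : ℝ) : ℂ)
          * GInf γ₀ θ α a (t * X ^ θ) * GTildeInf γb θ α b (t * X' ^ θ)))) ∧
    (∀ Y Y' : ℝ, 0 < Y → 0 < Y' →
      IntervalIntegrable (fun t : ℝ => ((t ^ α : ℝ) : ℂ)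
        * GTildeInf γa θ α a (t * Y ^ θ) * GInf γ₀ θ α b (t * Y' ^ θ)) volume 0 1 ∧
      Tendsto (fun N : ℕ => (((N : ℝ) ^ (-2 * (α + 1) + 2 * a / θ)
          * K10 θ a b P Q N (Y / (N : ℝ) ^ (2 / θ)) (Y' / (N : ℝ) ^ (2 / θ)) : ℝ) : ℂ))
        atTop (𝓝 ((θ * Y ^ a : ℝ) * ∫ t in (0 : ℝ)..1, ((t ^ α : ℝ) : ℂ)
          * GTildeInf γa θ α a (t * Y ^ θ) * GInf γ₀ θ α b (t * Y' ^ θ)))) ∧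
    (∀ Y X : ℝ, 0 < Y → 0 < X →
      IntervalIntegrable (fun t : ℝ => ((t ^ α : ℝ) : ℂ)
        * GTildeInf γa θ α a (t * Y ^ θ) * GTildeInf γb θ α b (t * X ^ θ)) volume 0 1 ∧
      Tendsto (fun N : ℕ => (((N : ℝ) ^ (-(2 / θ))
          * K11 θ a b P Q N (Y / (N : ℝ) ^ (2 / θ)) (X / (N : ℝ) ^ (2 / θ))
          + 1 / (X + Y) : ℝ) : ℂ))
        atTop (𝓝 ((θ * X ^ b * Y ^ a : ℝ) * ∫ t in (0 : ℝ)..1, ((t ^ α : ℝ) : ℂ)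
          * GTildeInf γa θ α a (t * Y ^ θ) * GTildeInf γb θ α b (t * X ^ θ)))) := by
  have hα' : α + 1 = (a + b + 1) / θ := by rw [hα]; ring
  -- One pair of exponents serves all six integrability claims, whatever loops are chosen.
  obtain ⟨c, d, hc, hd, hcd⟩ := exists_exponents hθ ha hb hab
  rw [← hα'] at hcd
  have hc0 := (max_lt_iff.1 hc).1
  have hd0 := (max_lt_iff.1 hd).1
  have hexp : α + 1 - 1 = α := add_sub_cancel_right α 1
  refine ⟨fun κ γ z hz hγ => ⟨fun N hN => ⟨?_, G_eq_foxH γ θ α κ N z⟩, ?_,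
    GInf_eq_foxH γ θ α κ z⟩, fun κ γ z hz hγ => ⟨fun N hN => ⟨?_, ?_,
    GTilde_eq_loopIntegral γ hθ α κ N z, GTilde_eq_foxH γ hθ α κ N z⟩, ?_,
    GTildeInf_eq_foxH γ θ α κ z⟩, exists_isBiorthogonal hθ ha hb hab, ?_⟩
  · exact ((loopDecay_invGamma hθ κ γ).loopIntegrable_ratF hγ (α + 1) hN hz).congr
      fun u hu => (gIntegrand_eq θ α κ N z hu).symm
  · exact ((loopDecay_invGamma hθ κ γ).loopIntegrable_inf hγ (α + 1) hz).congr
      fun u _ => (gInfIntegrand_eq θ α κ z u).symm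
  · obtain ⟨h0, hκ⟩ := max_lt_iff.1 hγ
    exact ((loopDecay_Gamma hθ hκ).loopIntegrable_ratF h0 (α + 1) hN hz).congr
      fun u hu => (gTildeIntegrand_eq hθ α κ N z hu).symm
  · obtain ⟨h0, hκ⟩ := max_lt_iff.1 hγ
    exact ((loopDecay_Gamma hθ hκ).loopIntegrable_ratF h0 (α + 1) hN hz).congr
      fun u hu => (gTildeIntegrand'_eq θ α κ N z hu).symm
  · obtain ⟨h0, hκ⟩ := max_lt_iff.1 hγ
    exact ((loopDecay_Gamma hθ hκ).loopIntegrable_inf h0 (α + 1) hz).congr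
      fun u _ => (gTildeInfIntegrand_eq θ α κ z u).symm
  intro P Q hPQ γ₀ γa γb hγ₀ hγa hγb
  have hG : ∀ κ c, 0 < c → HardEdge (α + 1) c (G γ₀ θ α κ) (GInf γ₀ θ α κ) :=
    fun κ c hc => hardEdge_G hθ α κ hγ₀ hc
  have hGa := hardEdge_GTilde hθ α hγa hc
  have hGb := hardEdge_GTilde hθ α hγb hd
  refine ⟨fun N hN x x' hx hx' => ⟨?_, K01_eq_integral hθ ha hb hab hα' hPQ hγ₀ hγb N hx hx'⟩,
    fun N hN y y' hy hy' => ⟨?_, K10_eq_integral hθ ha hb hab hα' hPQ hγ₀ hγa N hy hy'⟩,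
    fun N hN y x hy hx => ⟨?_, K11_eq_integral hθ ha hb hab hα' hPQ hγa hγb N hy hx⟩,
    fun X X' hX hX' => ⟨?_, tendsto_K01 hθ ha hb hab hα' hPQ hγ₀ hγb hX hX'⟩,
    fun Y Y' hY hY' => ⟨?_, tendsto_K10 hθ ha hb hab hα' hPQ hγ₀ hγa hY hY'⟩,
    fun Y X hY hX => ⟨?_, tendsto_K11 hθ ha hb hab hα' hPQ hγa hγb hY hX⟩⟩
  · have := (hG a c hc0).intervalIntegrable hGb hcd (Real.rpow_pos_of_pos hx θ)
      (Real.rpow_pos_of_pos hx' θ) hN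
    rwa [hexp] at this
  · have := hGa.intervalIntegrable (hG b d hd0) hcd (Real.rpow_pos_of_pos hy θ)
      (Real.rpow_pos_of_pos hy' θ) hN
    rwa [hexp] at this
  · have := hGa.intervalIntegrable hGb hcd (Real.rpow_pos_of_pos hy θ)
      (Real.rpow_pos_of_pos hx θ) hN
    rwa [hexp] at this
  · have := (hG a c hc0).intervalIntegrable_limit hGb hcd (Real.rpow_pos_of_pos hX θ)
      (Real.rpow_pos_of_pos hX' θ)
    rwa [hexp] at this
  · have := hGa.intervalIntegrable_limit (hG b d hd0) hcd (Real.rpow_pos_of_pos hY θ)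
      (Real.rpow_pos_of_pos hY' θ)
    rwa [hexp] at this
  · have := hGa.intervalIntegrable_limit hGb hcd (Real.rpow_pos_of_pos hY θ)
      (Real.rpow_pos_of_pos hX θ)
    rwa [hexp] at this
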